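/- Let $I$ be a countable set and $A=(a_{ij})_{i,j\in I}$ a Borcherds–Cartan matrix: an integer matrix with $a_{ii}=2$ ($i$ is then called real) or $a_{ii}\le 0$ ($i$ imaginary), $a_{ij}\le 0$ for $i\ne j$, and $a_{ij}=0\iff a_{ji}=0$. Let $\mathfrak h$ be a $\mathbb Q$-vector space with elements $\alpha_i^\vee\in\mathfrak h$ and linearly independent $\alpha_i\in\mathfrak h^*$ $(i\in I)$ such that $\alpha_i^\vee(\alpha_j)=a_{ij}$. All intervals below are intervals of rational numbers. *Weights.* Put $r_ix=x-\alpha_i^\vee(x)\alpha_i$ on $\mathfrak h^*$ and $r_ih=h-h(\alpha_i)\alpha_i^\vee$ on $\mathfrak h$. Let $T$ be the monoid generated by all $r_i$, $W$ the group generated by the $r_i$ with $i$ real, $Q^+=\sum_i\mathbb N\alpha_i$, $P^+=\{\lambda\in\mathfrak h^*: \alpha_i^\vee(\lambda)\in\mathbb N\ \forall i\}$, where $\mathbb N=\{0,1,2,\dots\}$. For $\beta=w\alpha_i$ $(w\in W)$ put $\beta^\vee=w\alpha_i^\vee$ and $r_\beta x=x-\beta^\vee(x)\beta$; call $\beta$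 real or imaginary according to $i$, and positive if $\beta\in Q^+$. Fix $\lambda\in P^+$. For $\mu,\nu\in T\lambda$ write $\mu>\nu$ if there are $n\ge1$, weights $\mu=\kappa_0,\kappa_1,\dots,\kappa_n=\nu$ and positive $\beta_1,\dots,\beta_n\in W\{\alpha_i\}_{i\in I}$ with $\kappa_{k-1}=r_{\beta_k}\kappa_k$ and $\beta_k^\vee(\kappa_k)>0$ for all $k$. The maximal such $n$ is $\operatorname{dist}(\mu,\nu)$. Write $\nu\xleftarrow{\beta}\mu$ if $\mu=r_\beta\nu$, $\beta$ is positive, $\beta^\vee(\nu)>0$ and $\operatorname{dist}(\mu,\nu)=1$. For rational $0<a\le1$, an $a$-chain for $\mu>\nu$ is a sequence $\nu=\nu_n\xleftarrow{\beta_n}\cdots\xleftarrow{\beta_1}\nu_0=\mu$ in $T\lambda$ $(n\ge 1)$ such that $a\beta_k^\vee(\nu_k)$ is a positive integer if $\beta_k$ is real and equals $1$ if $\beta_k$ is imaginary. *Paths.* For $s\geq 1$, weights $\lambda_1,\dots,\lambda_s$ and rationals $0=a_0\le a_1\le\dots\le a_s=1$, let $(\lambda_1,\dots,\lambda_s;a_0,\dots,a_s)$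 denote the path $\pi:[0,1]\to\mathfrak h^*$ with $\pi(t)=\sum_{i<j}(a_i-a_{i-1})\lambda_i+(t-a_{j-1})\lambda_j$ for $a_{j-1}\le t\le a_j$. It is a generalized Lakshmibai–Seshadri (GLS) path of shape $\lambda$ if it can be so written with $\lambda_1>\dots>\lambda_s$ in $T\lambda$ and $a_0<a_1<\dots<a_s$ such that there is an $a_j$-chain for $(\lambda_j,\lambda_{j+1})$ for $1\le j\le s-1$ and, if $\lambda_s\ne\lambda$, a $1$-chain for $(\lambda_s,\lambda)$. For a path $\pi$ put $h_i(t)=\alpha_i^\vee(\pi(t))$, and let $m_i$ be the least integer value of $h_i$. *Operators.* Let $f_+^i$ be the largest $t$ with $h_i(t)=m_i$. If $f^i_+=1$, put $f_i\pi=0$; otherwise let $f_-^i$ be the least $t\ge f_+^i$ with $h_i(t)=m_i+1$, and let $f_i\pi$ be $\pi(t)$ on $[0,f_+^i]$, $\pi(f_+^i)+r_i(\pi(t)-\pi(f_+^i))$ on $[f_+^i,f_-^i]$, and $\pi(t)-\alpha_i$ on $[f_-^i,1]$. For $i$ real, let $e_+^i$ be the least $t$ with $h_i(t)=m_i$. If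 $e_+^i=0$, put $e_i\pi=0$; otherwise let $e_-^i$ be the largest $t\le e_+^i$ with $h_i(t)=m_i+1$, and let $e_i\pi$ be $\pi(t)$ on $[0,e_-^i]$, $\pi(e_-^i)+r_i(\pi(t)-\pi(e_-^i))$ on $[e_-^i,e_+^i]$, and $\pi(t)+\alpha_i$ on $[e_+^i,1]$. **Theorem.** For GLS paths of shape $\lambda$ the numbers $m_i$, $f_+^i$, $e_+^i$ exist, $f_-^i$ exists if $f_+^i<1$, and $e_-^i$ exists if $e_+^i>0$. Let $\pi=(\lambda_1,\dots,\lambda_s;a_0,\dots,a_s)$ be a GLS path of shape $\lambda$, written with strictly monotone sequences as in the definition. 1. If $i$ is real and $f_i\pi\ne0$, then $f_+^i=a_t$ and $a_{p-1}<f_-^i\le a_p$ for some $0\le t<p\le s$, and $$f_i\pi=(\lambda_1,\dots,\lambda_t,r_i\lambda_{t+1},\dots,r_i\lambda_p,\lambda_p,\dots,\lambda_s;\ a_0,\dots,a_{p-1},f_-^i,a_p,\dots,a_s)$$ is a GLS path of shape $\lambda$. 2. If $i$ is imaginary and $f_i\pi\ne0$, then $f_+^i=0$ and $a_{p-1}<f_-^i\le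 a_p$ for some $1\le p\le s$, $$f_i\pi=(r_i\lambda_1,\dots,r_i\lambda_p,\lambda_p,\dots,\lambda_s;\ a_0,\dots,a_{p-1},f_-^i,a_p,\dots,a_s)$$ is a GLS path of shape $\lambda$, and $\alpha_i^\vee(\lambda_j)=\alpha_i^\vee(\lambda_{j+1})$ for $1\le j\le p-1$. 3. If $i$ is real and $e_i\pi\ne0$, then $e_+^i>0$, $e_+^i=a_k$ and $a_{q-1}\le e_-^i<a_q$ for some $1\le q\le k\le s$, and $$e_i\pi=(\lambda_1,\dots,\lambda_q,r_i\lambda_q,\dots,r_i\lambda_k,\lambda_{k+1},\dots,\lambda_s;\ a_0,\dots,a_{q-1},e_-^i,a_q,\dots,a_s)$$ is a GLS path of shape $\lambda$. In 1–3 the displayed sequence of weights lies in $T\lambda$ and is weakly decreasing (consecutive terms are equal or related by $>$), and the displayed sequence of rationals is weakly increasing. In particular the set of GLS paths of shape $\lambda$ is stable under all $f_i$, $i\in I$, and under all $e_i$ with $i$ real (up to the value $0$). -/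

import Mathlib

namespace GLS

/-- A Borcherds-Cartan matrix: diagonal entries are `2` or non-positive integers, off-diagonal
entries are non-positive integers, and the zero pattern is symmetric. -/
structure IsBorcherdsCartan {I : Type*} (A : Matrix I I ℤ) : Prop where
  diag : ∀ i, A i i = 2 ∨ A i i ≤ 0
  off_diag : ∀ i j, i ≠ j → A i j ≤ 0
  zero_iff : ∀ i j, A i j = 0 ↔ A j i = 0

/-- A Cartan subalgebra `𝔥` over `ℚ` with simple coroots `αᵢ^∨ ∈ 𝔥` and linearly independent
simple roots `αᵢ ∈ 𝔥*` such that `αᵢ^∨(αⱼ) = aᵢⱼ`. -/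
structure Realization {I : Type*} (A : Matrix I I ℤ) (𝔥 : Type*)
    [AddCommGroup 𝔥] [Module ℚ 𝔥] where
  coroot : I → 𝔥
  root : I → Module.Dual ℚ 𝔥
  root_coroot : ∀ i j, root j (coroot i) = (A i j : ℚ)
  linearIndependent_root : LinearIndependent ℚ root

/-- The rational unit interval. -/
abbrev UnitQ : Type := Set.Icc (0 : ℚ) 1

/-- Paths: functions on the rational unit interval with values in `𝔥*`. -/
abbrev RatPath (𝔥 : Type*) [AddCommGroup 𝔥] [Module ℚ 𝔥] : Type _ :=
  UnitQ → Module.Dual ℚ 𝔥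

/-- The greatest element of `S` (with value `0` if there is none). -/
noncomputable def greatest (S : Set UnitQ) : UnitQ :=
  open Classical in if h : ∃ t, IsGreatest S t then h.choose else 0

/-- The least element of `S` (with value `0` if there is none). -/
noncomputable def least (S : Set UnitQ) : UnitQ :=
  open Classical in if h : ∃ t, IsLeast S t then h.choose else 0

/-- The piecewise linear path `(λ₁, …, λₛ ; a₀, a₁, …, aₛ)` whose direction on the interval
`[aⱼ₋₁, aⱼ]` is `λⱼ`; only the values `λⱼ = L j` for `1 ≤ j ≤ s` and `aⱼ = a j` for `0 ≤ j ≤ s`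
matter. See `linePath_eq` for the formula on each of the intervals. -/
def linePath {𝔥 : Type*} [AddCommGroup 𝔥] [Module ℚ 𝔥] (s : ℕ)
    (L : ℕ → Module.Dual ℚ 𝔥) (a : ℕ → ℚ) : RatPath 𝔥 :=
  fun t => ∑ j ∈ Finset.Icc 1 s, (min (t : ℚ) (a j) - min (t : ℚ) (a (j - 1))) • L j

/-- If `0 = a₀ ≤ a₁ ≤ ⋯ ≤ aₛ`, then for `a_{j-1} ≤ t ≤ a_j` the path takes the value
`∑_{i=1}^{j-1} (aᵢ - aᵢ₋₁) λᵢ + (t - aⱼ₋₁) λⱼ`. -/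
theorem linePath_eq {𝔥 : Type*} [AddCommGroup 𝔥] [Module ℚ 𝔥] (s : ℕ)
    (L : ℕ → Module.Dual ℚ 𝔥) (a : ℕ → ℚ) (ha : ∀ j < s, a j ≤ a (j + 1))
    (j : ℕ) (hj : 1 ≤ j) (hjs : j ≤ s) (t : UnitQ) (h1 : a (j - 1) ≤ t) (h2 : (t : ℚ) ≤ a j) :
    linePath s L a t =
      ∑ i ∈ Finset.Icc 1 (j - 1), (a i - a (i - 1)) • L i + ((t : ℚ) - a (j - 1)) • L j := by
  have hmono : ∀ m n, m ≤ n → n ≤ s → a m ≤ a n := by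
    intro m n hmn
    induction n, hmn using Nat.le_induction with
    | base => intro _; exact le_rfl
    | succ n _ ih => intro hn; exact (ih (by omega)).trans (ha n (by omega))
  have hsplit : Finset.Icc 1 s = Finset.Icc 1 j ∪ Finset.Icc (j + 1) s := by
    ext x; simp only [Finset.mem_union, Finset.mem_Icc]; omega
  have hdisj : Disjoint (Finset.Icc 1 j) (Finset.Icc (j + 1) s) := by
    rw [Finset.disjoint_left]; intro x; simp only [Finset.mem_Icc]; omega
  have htail : ∑ i ∈ Finset.Icc (j + 1) s,
      (min (t : ℚ) (a i) - min (t : ℚ) (a (i - 1))) • L i = 0 := by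
    refine Finset.sum_eq_zero fun i hi => ?_
    rw [Finset.mem_Icc] at hi
    rw [min_eq_left (h2.trans (hmono j i (by omega) hi.2)),
      min_eq_left (h2.trans (hmono j (i - 1) (by omega) (by omega))), sub_self, zero_smul]
  have hj' : Finset.Icc 1 j = insert j (Finset.Icc 1 (j - 1)) := by
    ext x; simp only [Finset.mem_insert, Finset.mem_Icc]; omega
  have hnot : j ∉ Finset.Icc 1 (j - 1) := by simp only [Finset.mem_Icc]; omega
  unfold linePath
  rw [hsplit, Finset.sum_union hdisj, htail, add_zero, hj', Finset.sum_insert hnot,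
    min_eq_left h2, min_eq_right h1, add_comm]
  congr 1
  refine Finset.sum_congr rfl fun i hi => ?_
  rw [Finset.mem_Icc] at hi
  rw [min_eq_right ((hmono i (j - 1) hi.2 (by omega)).trans h1),
    min_eq_right ((hmono (i - 1) (j - 1) (by omega) (by omega)).trans h1)]

namespace Realization

section

variable {I : Type*} {A : Matrix I I ℤ} {𝔥 : Type*} [AddCommGroup 𝔥] [Module ℚ 𝔥]
  (D : Realization A 𝔥)

/-- `rᵢ x = x - αᵢ^∨(x) αᵢ` on `𝔥*`. -/
def r (i : I) : Module.End ℚ (Module.Dual ℚ 𝔥) :=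
  LinearMap.id - (Module.Dual.eval ℚ 𝔥 (D.coroot i)).smulRight (D.root i)

theorem r_apply (i : I) (x : Module.Dual ℚ 𝔥) :
    D.r i x = x - x (D.coroot i) • D.root i := by
  simp [r]

/-- `rᵢ h = h - h(αᵢ) αᵢ^∨` on `𝔥`. -/
def rv (i : I) : Module.End ℚ 𝔥 :=
  LinearMap.id - (D.root i).smulRight (D.coroot i)

theorem rv_apply (i : I) (h : 𝔥) : D.rv i h = h - D.root i h • D.coroot i := by
  simp [rv]

/-- The monoid `T` generated by all `rᵢ`. -/
def T : Submonoid (Module.End ℚ (Module.Dual ℚ 𝔥)) :=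
  Submonoid.closure (Set.range D.r)

/-- The orbit `T lam`. -/
def orbit (lam : Module.Dual ℚ 𝔥) : Set (Module.Dual ℚ 𝔥) :=
  {μ | ∃ τ ∈ D.T, μ = τ lam}

/-- `P⁺`: the weights on which all simple coroots take values in `{0, 1, 2, …}`. -/
def dominantWeights : Set (Module.Dual ℚ 𝔥) :=
  {μ | ∀ i, ∃ n : ℕ, μ (D.coroot i) = n}

/-- `Q⁺`: the sums of simple roots. -/
def Qplus : AddSubmonoid (Module.Dual ℚ 𝔥) :=
  AddSubmonoid.closure (Set.range D.root)

/-- `D.IsRoot j β h` means that `(β, h) = (w αⱼ, w αⱼ^∨)` for some `w` in the group `W` generated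
by the reflections `rᵢ` with `i` real. So `β` runs through `W Π`, `h` is the coroot `β^∨`, and
`β` is real or imaginary according to `j`. -/
inductive IsRoot (j : I) : Module.Dual ℚ 𝔥 → 𝔥 → Prop
  | simple : IsRoot j (D.root j) (D.coroot j)
  | reflect (i : I) (hi : A i i = 2) (β : Module.Dual ℚ 𝔥) (h : 𝔥) (hβ : IsRoot j β h) :
      IsRoot j (D.r i β) (D.rv i h)

/-- `β = w αⱼ` is a positive root with coroot `h`, `μ = r_β ν` and `β^∨(ν) > 0`. -/
def IsAscent (j : I) (β : Module.Dual ℚ 𝔥) (h : 𝔥) (μ ν : Module.Dual ℚ 𝔥) : Prop :=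
  D.IsRoot j β h ∧ β ∈ D.Qplus ∧ 0 < ν h ∧ μ = ν - ν h • β

/-- There is a sequence `μ = κ₀, κ₁, …, κₙ = ν` of length `n` in which each `κₖ` is obtained from
`κₖ₊₁` by an ascent. -/
def HasSeq (n : ℕ) (μ ν : Module.Dual ℚ 𝔥) : Prop :=
  ∃ κ : ℕ → Module.Dual ℚ 𝔥, κ 0 = μ ∧ κ n = ν ∧
    ∀ k < n, ∃ j β h, D.IsAscent j β h (κ k) (κ (k + 1))

/-- `μ > ν` for weights in the orbit `T lam`. -/
def Gt (lam μ ν : Module.Dual ℚ 𝔥) : Prop :=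
  μ ∈ D.orbit lam ∧ ν ∈ D.orbit lam ∧ ∃ n, 1 ≤ n ∧ D.HasSeq n μ ν

/-- `dist (μ, ν) = n`: the maximal length of a sequence from `μ` to `ν` is `n`. -/
def IsDist (μ ν : Module.Dual ℚ 𝔥) (n : ℕ) : Prop :=
  IsGreatest {m : ℕ | D.HasSeq m μ ν} n

/-- One step `ν ←β μ` (that is, `μ = r_β ν > ν` and `dist (μ, ν) = 1`) of an `a`-chain. -/
def ChainStep (lam : Module.Dual ℚ 𝔥) (a : ℚ) (μ ν : Module.Dual ℚ 𝔥) : Prop :=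
  μ ∈ D.orbit lam ∧ ν ∈ D.orbit lam ∧ D.IsDist μ ν 1 ∧
    ∃ j β h, D.IsAscent j β h μ ν ∧
      (A j j = 2 → ∃ n : ℕ, 0 < n ∧ a * ν h = n) ∧
      (A j j ≠ 2 → a * ν h = 1)

/-- There exists an `a`-chain for the pair `(μ, ν)` of weights in `T lam`. -/
def HasChain (lam : Module.Dual ℚ 𝔥) (a : ℚ) (μ ν : Module.Dual ℚ 𝔥) : Prop :=
  0 < a ∧ a ≤ 1 ∧ D.Gt lam μ ν ∧
    ∃ n, 1 ≤ n ∧ ∃ κ : ℕ → Module.Dual ℚ 𝔥, κ 0 = μ ∧ κ n = ν ∧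
      ∀ k < n, D.ChainStep lam a (κ k) (κ (k + 1))

/-- `(λ₁ > ⋯ > λₛ ; 0 = a₀ < a₁ < ⋯ < aₛ = 1)` satisfies the conditions that define a
generalized Lakshmibai-Seshadri path of shape `lam`. -/
structure IsGLSData (lam : Module.Dual ℚ 𝔥) (s : ℕ) (L : ℕ → Module.Dual ℚ 𝔥) (a : ℕ → ℚ) :
    Prop where
  one_le : 1 ≤ s
  mem_orbit : ∀ j, 1 ≤ j → j ≤ s → L j ∈ D.orbit lam
  gt : ∀ j, 1 ≤ j → j < s → D.Gt lam (L j) (L (j + 1))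
  a_zero : a 0 = 0
  a_last : a s = 1
  a_lt : ∀ j < s, a j < a (j + 1)
  chain : ∀ j, 1 ≤ j → j < s → D.HasChain lam (a j) (L j) (L (j + 1))
  chain_last : L s ≠ lam → D.HasChain lam 1 (L s) lam

/-- Weakly monotone data `(λ₁ ≥ ⋯ ≥ λₛ ; 0 = a₀ ≤ a₁ ≤ ⋯ ≤ aₛ = 1)`, with `λⱼ` in `T lam`. -/
structure IsWeakData (lam : Module.Dual ℚ 𝔥) (s : ℕ) (L : ℕ → Module.Dual ℚ 𝔥) (a : ℕ → ℚ) :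
    Prop where
  one_le : 1 ≤ s
  mem_orbit : ∀ j, 1 ≤ j → j ≤ s → L j ∈ D.orbit lam
  ge : ∀ j, 1 ≤ j → j < s → L j = L (j + 1) ∨ D.Gt lam (L j) (L (j + 1))
  a_zero : a 0 = 0
  a_last : a s = 1
  a_le : ∀ j < s, a j ≤ a (j + 1)

/-- The set of generalized Lakshmibai-Seshadri paths of shape `lam`. -/
def glsPaths (lam : Module.Dual ℚ 𝔥) : Set (RatPath 𝔥) :=
  {π | ∃ s L a, D.IsGLSData lam s L a ∧ π = linePath s L a}

/-- `hᵢ^π(t) = αᵢ^∨(π(t))`. -/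
def height (i : I) (π : RatPath 𝔥) (t : UnitQ) : ℚ := π t (D.coroot i)

/-- `mᵢ^π`, the minimal integral value of `hᵢ^π`. -/
noncomputable def minInt (i : I) (π : RatPath 𝔥) : ℤ :=
  sInf {n : ℤ | ∃ t, D.height i π t = n}

/-- `f₊^i(π)`: the maximal `t` with `hᵢ^π(t) = mᵢ^π`. -/
noncomputable def fPlus (i : I) (π : RatPath 𝔥) : UnitQ :=
  greatest {t | D.height i π t = D.minInt i π}

/-- `f₋^i(π)`: the minimal `t ≥ f₊^i(π)` with `hᵢ^π(t) = mᵢ^π + 1`. -/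
noncomputable def fMinus (i : I) (π : RatPath 𝔥) : UnitQ :=
  least {t | D.fPlus i π ≤ t ∧ D.height i π t = D.minInt i π + 1}

/-- The operator `fᵢ`; the value `none` stands for `0`. -/
noncomputable def f (i : I) (π : RatPath 𝔥) : Option (RatPath 𝔥) :=
  if D.fPlus i π < 1 then
    some fun t =>
      if t ≤ D.fPlus i π then π t
      else if t ≤ D.fMinus i π then
        π (D.fPlus i π) + D.r i (π t - π (D.fPlus i π))
      else π t - D.root i
  else none

/-- `e₊^i(π)` for `i` real: the minimal `t` with `hᵢ^π(t) = mᵢ^π`. -/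
noncomputable def ePlus (i : I) (π : RatPath 𝔥) : UnitQ :=
  least {t | D.height i π t = D.minInt i π}

/-- `e₋^i(π)` for `i` real: the maximal `t ≤ e₊^i(π)` with `hᵢ^π(t) = mᵢ^π + 1`. -/
noncomputable def eMinus (i : I) (π : RatPath 𝔥) : UnitQ :=
  greatest {t | t ≤ D.ePlus i π ∧ D.height i π t = D.minInt i π + 1}

/-- The operator `eᵢ` for `i` real; the value `none` stands for `0`. -/
noncomputable def e (i : I) (π : RatPath 𝔥) : Option (RatPath 𝔥) :=
  if 0 < D.ePlus i π then
    some fun t =>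
      if t ≤ D.eMinus i π then π t
      else if t ≤ D.ePlus i π then
        π (D.eMinus i π) + D.r i (π t - π (D.eMinus i π))
      else π t + D.root i
  else none

/-- `(λ₁, …, λₜ, rᵢλₜ₊₁, …, rᵢλₚ, λₚ, …, λₛ)`. -/
def fWeights (i : I) (L : ℕ → Module.Dual ℚ 𝔥) (t p : ℕ) : ℕ → Module.Dual ℚ 𝔥 :=
  fun j => if j ≤ t then L j else if j ≤ p then D.r i (L j) else L (j - 1)

/-- `(λ₁, …, λ_q, rᵢλ_q, …, rᵢλₖ, λₖ₊₁, …, λₛ)`. -/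
def eWeights (i : I) (L : ℕ → Module.Dual ℚ 𝔥) (q k : ℕ) : ℕ → Module.Dual ℚ 𝔥 :=
  fun j => if j ≤ q then L j else if j ≤ k + 1 then D.r i (L (j - 1)) else L (j - 1)

end

end Realization

/-- `(a₀, …, aₚ₋₁, c, aₚ, …, aₛ)`. -/
def insertAt (a : ℕ → ℚ) (p : ℕ) (c : ℚ) : ℕ → ℚ :=
  fun j => if j < p then a j else if j = p then c else a (j - 1)

end GLS

/-!
# Root operators on generalized Lakshmibai-Seshadri paths

Let `π = (λ₁, …, λₛ; a₀, …, aₛ)` be a path of shape `λ` and `h(t) = αᵢ^∨(π(t))`, a piecewise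
linear function with slopes `cⱼ = αᵢ^∨(λⱼ)`.

*Reflections of chains.* A simple real reflection `rᵢ` maps an ascent `μ = r_β ν` to an ascent,
unless `r_β = rᵢ` (`IsAscent.eq_r_or`). This is where the structure of the root system enters:
real roots are positive or negative, and imaginary roots are positive (`apply_root_mem_Qplus`,
`IsRoot.mem_Qplus_or_neg`, `IsRoot.mem_Qplus`), which follows from the length criterion for
positivity by reduction to rank two. Consequently a sequence of ascents between weights of the
same sign on `αᵢ^∨` can be reflected without becoming shorter (`HasSeq.exists_nonneg`,
`HasSeq.exists_nonpos`), so `rᵢ` preserves distance one between such weights; and if `μ > ν` have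
distance one and `αᵢ^∨` changes from negative to nonnegative, or from nonpositive to positive, on
the way from `μ` to `ν`, then `μ = rᵢ ν`. For `a`-chains this means the following. If the sign
changes in this way along the chain, then `a αᵢ^∨(μ)` and `a αᵢ^∨(ν)` are integers
(`WeakChain.int_of_neg`, `WeakChain.int_of_pos`), and one end of the chain can be replaced by its
reflection (`WeakChain.r_left`, `WeakChain.r_right`). If these numbers are not integers and
`αᵢ^∨(ν) > 0` or `αᵢ^∨(μ) < 0`, then the whole chain can be reflected (`WeakChain.r_r_of_pos`,
`WeakChain.r_r_of_neg`). For imaginary `i`, a chain along which `αᵢ^∨` is constant consists of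
reflections in roots orthogonal to `αᵢ`, and `rᵢ` translates it by a multiple of `αᵢ`
(`WeakChain.r_r_of_imaginary`, `IsRoot.root_apply_eq_zero`).

*Heights.* Since `aⱼ (λⱼ₊₁ - λⱼ)` lies in `Q⁺`, the number `h(aⱼ)` differs by an integer from `aⱼ
cⱼ` and from `aⱼ cⱼ₊₁`. So `h` is integral at `1` and wherever the sign of the slope changes
upwards (`IsGLSData.isIntegralLine`). Hence the minimum of `h` is an integer that is attained at
breakpoints; after the last of them `h` increases strictly until it first takes the value `m + 1`,
before the first of them it decreases strictly since it last took this value, and at the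
breakpoints in between it is not integral (`IsIntegralLine.exists_min`,
`IsIntegralLine.exists_next`, `IsIntegralLine.exists_prev`). For imaginary `i` the slopes decrease
weakly and are constant as long as `h < 1` (`IsGLSData.slope_eq_of_imaginary`).

*Operators.* Inserting the new breakpoint `x` and applying `rᵢ` to the weights on the interval
where the operator acts gives the asserted formulas (`linePath_reflectOn`). The new sequence has
the necessary chains: inside the interval because `h` is not integral there (because the slope is
constant, for imaginary `i`), at the end where `h` is minimal because the sign of the slope
changes, and at `x` because `x c`, for the slope `c` at `x`, is an integer (equal to `1` for
imaginary `i`), so that `rᵢ` itself is a step of an `x`-chain (`chainStep_r`). It is only weakly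
monotone, but merging equal weights and deleting intervals of length zero makes it strict
(`IsWeakGLSData.linePath_mem`).
-/

namespace GLS

namespace Realization

section Coordinates

variable {I : Type*} {A : Matrix I I ℤ} {𝔥 : Type*} [AddCommGroup 𝔥] [Module ℚ 𝔥]
  (D : Realization A 𝔥)

/-! ### Coordinates with respect to the simple roots -/

theorem exists_functional (c : I → ℚ) :
    ∃ φ : Module.Dual ℚ 𝔥 →ₗ[ℚ] ℚ, ∀ k, φ (D.root k) = c k := by
  obtain ⟨φ, hφ⟩ := LinearMap.exists_extend
    ((Module.Basis.span D.linearIndependent_root).constr ℚ c)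
  refine ⟨φ, fun k => ?_⟩
  have h1 := LinearMap.congr_fun hφ (Module.Basis.span D.linearIndependent_root k)
  rw [Module.Basis.constr_basis] at h1
  rw [← h1, LinearMap.comp_apply, Submodule.subtype_apply, Module.Basis.span_apply]

open Classical in
/-- A linear functional on `𝔥*` that reads off the coefficient of the simple root `αᵢ` on the
span of the simple roots (outside that span it is an arbitrary linear extension). -/
noncomputable def coord (i : I) : Module.Dual ℚ 𝔥 →ₗ[ℚ] ℚ :=
  (D.exists_functional (Pi.single i 1)).choose

/-- A linear functional on `𝔥*` that takes the value `1` on each simple root: on the span of the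
simple roots it is the height (elsewhere it is an arbitrary linear extension). -/
noncomputable def ht : Module.Dual ℚ 𝔥 →ₗ[ℚ] ℚ :=
  (D.exists_functional fun _ => 1).choose

theorem ht_root (k : I) : D.ht (D.root k) = 1 :=
  (D.exists_functional fun _ => 1).choose_spec k

theorem coord_root_self (i : I) : D.coord i (D.root i) = 1 := by
  classical
  rw [coord, (D.exists_functional (Pi.single i 1)).choose_spec i, Pi.single_eq_same]

theorem coord_root_ne {i k : I} (h : k ≠ i) : D.coord i (D.root k) = 0 := by
  classical
  rw [coord, (D.exists_functional (Pi.single i 1)).choose_spec k, Pi.single_eq_of_ne h]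

theorem root_ne_zero (i : I) : D.root i ≠ 0 := D.linearIndependent_root.ne_zero i

theorem root_mem_Qplus (i : I) : D.root i ∈ D.Qplus :=
  AddSubmonoid.subset_closure ⟨i, rfl⟩

theorem coord_of_mem_Qplus {x : Module.Dual ℚ 𝔥} (hx : x ∈ D.Qplus) (i : I) :
    ∃ n : ℕ, D.coord i x = n := by
  refine AddSubmonoid.closure_induction ?_ ?_ ?_ hx
  · rintro _ ⟨k, rfl⟩
    by_cases h : k = i
    · exact ⟨1, by rw [h, coord_root_self, Nat.cast_one]⟩
    · exact ⟨0, by rw [D.coord_root_ne h, Nat.cast_zero]⟩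
  · exact ⟨0, by simp⟩
  · rintro x y - - ⟨m, hm⟩ ⟨n, hn⟩
    exact ⟨m + n, by rw [map_add, hm, hn, Nat.cast_add]⟩

theorem coord_nonneg {x : Module.Dual ℚ 𝔥} (hx : x ∈ D.Qplus) (i : I) : 0 ≤ D.coord i x := by
  obtain ⟨n, hn⟩ := D.coord_of_mem_Qplus hx i
  exact hn ▸ n.cast_nonneg

theorem ht_of_mem_Qplus {x : Module.Dual ℚ 𝔥} (hx : x ∈ D.Qplus) : ∃ n : ℕ, D.ht x = n := by
  refine AddSubmonoid.closure_induction ?_ ?_ ?_ hx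
  · rintro _ ⟨k, rfl⟩
    exact ⟨1, by rw [ht_root, Nat.cast_one]⟩
  · exact ⟨0, by simp⟩
  · rintro x y - - ⟨m, hm⟩ ⟨n, hn⟩
    exact ⟨m + n, by rw [map_add, hm, hn, Nat.cast_add]⟩

theorem ht_nonneg {x : Module.Dual ℚ 𝔥} (hx : x ∈ D.Qplus) : 0 ≤ D.ht x := by
  obtain ⟨n, hn⟩ := D.ht_of_mem_Qplus hx
  exact hn ▸ n.cast_nonneg

theorem ht_pos {x : Module.Dual ℚ 𝔥} (hx : x ∈ D.Qplus) (h0 : x ≠ 0) : 0 < D.ht x := by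
  have key : x = 0 ∨ 0 < D.ht x := by
    refine AddSubmonoid.closure_induction ?_ ?_ ?_ hx
    · rintro _ ⟨k, rfl⟩
      exact Or.inr (by rw [ht_root]; exact one_pos)
    · exact Or.inl rfl
    · rintro x y - hy (rfl | h1) (rfl | h2)
      · exact Or.inl (add_zero _)
      · exact Or.inr (by rwa [zero_add])
      · exact Or.inr (by rwa [add_zero])
      · exact Or.inr (by rw [map_add]; exact add_pos h1 h2)
  exact key.resolve_left h0

theorem eq_coord_smul_of_mem_Qplus {x : Module.Dual ℚ 𝔥} (hx : x ∈ D.Qplus) (i : I)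
    (h : ∀ k, k ≠ i → D.coord k x = 0) : x = D.coord i x • D.root i := by
  revert h
  refine AddSubmonoid.closure_induction ?_ ?_ ?_ hx
  · rintro _ ⟨k, rfl⟩ h
    have hk : k = i := by
      by_contra hne
      have := h k hne
      rw [coord_root_self] at this
      exact one_ne_zero this
    rw [hk, coord_root_self, one_smul]
  · simp
  · intro x y hx hy ihx ihy h
    have h1 : ∀ k, k ≠ i → D.coord k x = 0 ∧ D.coord k y = 0 := by
      intro k hk
      have := h k hk
      rw [map_add] at this
      exact (add_eq_zero_iff_of_nonneg (D.coord_nonneg hx k) (D.coord_nonneg hy k)).1 this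
    conv_lhs => rw [ihx fun k hk => (h1 k hk).1, ihy fun k hk => (h1 k hk).2]
    rw [map_add, add_smul]

theorem eq_zero_of_neg_mem_Qplus {x : Module.Dual ℚ 𝔥} (hx : x ∈ D.Qplus)
    (hn : -x ∈ D.Qplus) : x = 0 := by
  by_contra h0
  have h1 := D.ht_pos hx h0
  have h2 := D.ht_nonneg hn
  rw [map_neg] at h2
  linarith

theorem nsmul_mem_Qplus {x : Module.Dual ℚ 𝔥} (hx : x ∈ D.Qplus) (n : ℕ) :
    (n : ℚ) • x ∈ D.Qplus := by
  rw [Nat.cast_smul_eq_nsmul]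
  exact AddSubmonoid.nsmul_mem _ hx n

theorem int_of_mem_Qplus {x : Module.Dual ℚ 𝔥} (hx : x ∈ D.Qplus) (i : I) :
    ∃ n : ℤ, x (D.coroot i) = n := by
  refine AddSubmonoid.closure_induction ?_ ?_ ?_ hx
  · rintro _ ⟨k, rfl⟩
    exact ⟨A i k, D.root_coroot i k⟩
  · exact ⟨0, by simp⟩
  · rintro x y - - ⟨m, hm⟩ ⟨n, hn⟩
    exact ⟨m + n, by rw [LinearMap.add_apply, hm, hn, Int.cast_add]⟩

theorem apply_coroot_nonpos_of_mem_Qplus (hA : IsBorcherdsCartan A) {i : I} (hi : A i i ≠ 2)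
    {x : Module.Dual ℚ 𝔥} (hx : x ∈ D.Qplus) : x (D.coroot i) ≤ 0 := by
  refine AddSubmonoid.closure_induction ?_ ?_ ?_ hx
  · rintro _ ⟨k, rfl⟩
    rw [D.root_coroot]
    by_cases h : i = k
    · subst h
      exact_mod_cast (hA.diag i).resolve_left hi
    · exact_mod_cast hA.off_diag i k h
  · simp
  · intro x y _ _ h1 h2
    rw [LinearMap.add_apply]
    exact add_nonpos h1 h2

/-! ### Simple reflections and words in the real ones -/

theorem r_apply_coroot (i k : I) (x : Module.Dual ℚ 𝔥) :
    D.r i x (D.coroot k) = x (D.coroot k) - x (D.coroot i) * A k i := by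
  rw [r_apply, LinearMap.sub_apply, LinearMap.smul_apply, D.root_coroot, smul_eq_mul]

theorem r_apply_coroot_self {i : I} (hi : A i i = 2) (x : Module.Dual ℚ 𝔥) :
    D.r i x (D.coroot i) = - x (D.coroot i) := by
  rw [r_apply_coroot, hi]
  push_cast
  ring

theorem r_r {i : I} (hi : A i i = 2) (x : Module.Dual ℚ 𝔥) : D.r i (D.r i x) = x := by
  rw [D.r_apply i (D.r i x), r_apply_coroot_self D hi, r_apply]
  module

theorem r_root_self {i : I} (hi : A i i = 2) : D.r i (D.root i) = - D.root i := by
  rw [r_apply, D.root_coroot, hi]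
  module

theorem r_mul_r {i : I} (hi : A i i = 2) : D.r i * D.r i = 1 :=
  LinearMap.ext fun x => D.r_r hi x

theorem rv_rv {i : I} (hi : A i i = 2) (h : 𝔥) : D.rv i (D.rv i h) = h := by
  rw [D.rv_apply i (D.rv i h), rv_apply, map_sub, map_smul, D.root_coroot, hi]
  module

theorem r_apply_rv {i : I} (hi : A i i = 2) (x : Module.Dual ℚ 𝔥) (h : 𝔥) :
    D.r i x (D.rv i h) = x h := by
  rw [r_apply, rv_apply, LinearMap.sub_apply, LinearMap.smul_apply, map_sub, map_sub, map_smul,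
    map_smul, D.root_coroot, hi]
  simp only [smul_eq_mul]
  push_cast
  ring

/-- `D.IsWord n w v`: for some real `i₁, …, iₙ`, the endomorphism `w` of `𝔥*` is
`r_{i₁} ⋯ r_{iₙ}` and `v` is the product of the corresponding reflections of `𝔥`. -/
inductive IsWord : ℕ → Module.End ℚ (Module.Dual ℚ 𝔥) → Module.End ℚ 𝔥 → Prop
  | one : IsWord 0 1 1
  | mul_r (n : ℕ) (w : Module.End ℚ (Module.Dual ℚ 𝔥)) (v : Module.End ℚ 𝔥) (i : I)
      (hi : A i i = 2) (hw : IsWord n w v) : IsWord (n + 1) (w * D.r i) (v * D.rv i)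

variable {D}

theorem IsWord.r_mul {n : ℕ} {w : Module.End ℚ (Module.Dual ℚ 𝔥)} {v : Module.End ℚ 𝔥}
    (h : D.IsWord n w v) {i : I} (hi : A i i = 2) :
    D.IsWord (n + 1) (D.r i * w) (D.rv i * v) := by
  induction h with
  | one => simpa using IsWord.mul_r 0 1 1 i hi IsWord.one
  | mul_r n w v k hk _ ih =>
    rw [← mul_assoc, ← mul_assoc]
    exact IsWord.mul_r _ _ _ k hk ih

theorem IsWord.apply_apply {n : ℕ} {w : Module.End ℚ (Module.Dual ℚ 𝔥)} {v : Module.End ℚ 𝔥}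
    (h : D.IsWord n w v) (x : Module.Dual ℚ 𝔥) (y : 𝔥) : w x (v y) = x y := by
  induction h generalizing x y with
  | one => rfl
  | mul_r n w v k hk _ ih =>
    rw [Module.End.mul_apply, Module.End.mul_apply, ih, D.r_apply_rv hk]

theorem IsWord.surjective {n : ℕ} {w : Module.End ℚ (Module.Dual ℚ 𝔥)} {v : Module.End ℚ 𝔥}
    (h : D.IsWord n w v) : Function.Surjective w := by
  induction h with
  | one => exact fun x => ⟨x, rfl⟩
  | mul_r n w v k hk _ ih =>
    intro x
    obtain ⟨y, rfl⟩ := ih x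
    exact ⟨D.r k y, by rw [Module.End.mul_apply, D.r_r hk]⟩

theorem IsWord.injective {n : ℕ} {w : Module.End ℚ (Module.Dual ℚ 𝔥)} {v : Module.End ℚ 𝔥}
    (h : D.IsWord n w v) : Function.Injective w := by
  induction h with
  | one => exact fun x y h => h
  | mul_r n w v k hk _ ih =>
    intro x y h
    have := ih h
    rw [← D.r_r hk x, this, D.r_r hk]

/-- The action of a word on `𝔥` is determined by its action on `𝔥*`. -/
theorem IsWord.unique {n n' : ℕ} {w : Module.End ℚ (Module.Dual ℚ 𝔥)} {v v' : Module.End ℚ 𝔥}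
    (h : D.IsWord n w v) (h' : D.IsWord n' w v') : v = v' := by
  ext y
  rw [← sub_eq_zero, ← Module.forall_dual_apply_eq_zero_iff ℚ]
  intro z
  obtain ⟨x, rfl⟩ := h.surjective z
  rw [map_sub, h.apply_apply, h'.apply_apply, sub_self]

theorem IsRoot.exists_isWord {j : I} {β : Module.Dual ℚ 𝔥} {h : 𝔥} (hβ : D.IsRoot j β h) :
    ∃ n w v, D.IsWord n w v ∧ β = w (D.root j) ∧ h = v (D.coroot j) := by
  induction hβ with
  | simple => exact ⟨0, 1, 1, IsWord.one, rfl, rfl⟩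
  | reflect i hi β h _ ih =>
    obtain ⟨n, w, v, hw, rfl, rfl⟩ := ih
    exact ⟨n + 1, _, _, hw.r_mul hi, rfl, rfl⟩

theorem IsWord.isRoot_apply {n : ℕ} {w : Module.End ℚ (Module.Dual ℚ 𝔥)} {v : Module.End ℚ 𝔥}
    (h : D.IsWord n w v) {j : I} {β : Module.Dual ℚ 𝔥} {g : 𝔥} (hβ : D.IsRoot j β g) :
    D.IsRoot j (w β) (v g) := by
  induction h generalizing β g with
  | one => exact hβ
  | mul_r n w v k hk _ ih => exact ih (IsRoot.reflect k hk _ _ hβ)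

/-- A word that carries a given root back to the simple root it comes from. -/
theorem IsRoot.exists_isWord_apply_eq {j : I} {β : Module.Dual ℚ 𝔥} {h : 𝔥}
    (hβ : D.IsRoot j β h) : ∃ n w v, D.IsWord n w v ∧ w β = D.root j := by
  induction hβ with
  | simple => exact ⟨0, 1, 1, IsWord.one, rfl⟩
  | reflect i hi β h _ ih =>
    obtain ⟨n, w, v, hw, h1⟩ := ih
    exact ⟨n + 1, _, _, IsWord.mul_r _ _ _ i hi hw, by rw [Module.End.mul_apply, D.r_r hi, h1]⟩

theorem IsRoot.ne_zero {j : I} {β : Module.Dual ℚ 𝔥} {h : 𝔥} (hβ : D.IsRoot j β h) : β ≠ 0 := by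
  obtain ⟨n, w, v, hw, h1⟩ := hβ.exists_isWord_apply_eq
  rintro rfl
  rw [map_zero] at h1
  exact D.root_ne_zero j h1.symm

theorem IsRoot.apply_self {j : I} {β : Module.Dual ℚ 𝔥} {h : 𝔥} (hβ : D.IsRoot j β h) :
    β h = A j j := by
  obtain ⟨n, w, v, hw, rfl, rfl⟩ := hβ.exists_isWord
  rw [hw.apply_apply, D.root_coroot]

/-- The reflection in a real root is a product of simple real reflections. -/
theorem IsRoot.exists_isWord_reflection {j : I} (hj : A j j = 2) {β : Module.Dual ℚ 𝔥} {h : 𝔥}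
    (hβ : D.IsRoot j β h) : ∃ n w v, D.IsWord n w v ∧ ∀ x, w x = x - x h • β := by
  induction hβ with
  | simple =>
    exact ⟨1, _, _, IsWord.mul_r 0 1 1 j hj IsWord.one, fun x => by rw [one_mul, r_apply]⟩
  | reflect i hi β h _ ih =>
    obtain ⟨n, w, v, hw, h1⟩ := ih
    refine ⟨_, _, _, (hw.r_mul hi).mul_r _ _ _ i hi, fun x => ?_⟩
    have h2 : D.r i x h = x (D.rv i h) := by
      rw [← D.r_apply_rv hi x (D.rv i h), D.rv_rv hi]
    rw [Module.End.mul_apply, Module.End.mul_apply, h1, map_sub, map_smul, D.r_r hi, h2]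

variable (D)

/-- The length of `w`: the least number of factors in a product of simple real reflections
that equals `w` (and `0` if there is no such product). -/
noncomputable def len (w : Module.End ℚ (Module.Dual ℚ 𝔥)) : ℕ :=
  sInf {n | ∃ v, D.IsWord n w v}

variable {D}

theorem IsWord.len_le {n : ℕ} {w : Module.End ℚ (Module.Dual ℚ 𝔥)} {v : Module.End ℚ 𝔥}
    (h : D.IsWord n w v) : D.len w ≤ n := Nat.sInf_le ⟨v, h⟩

theorem IsWord.reduced {n : ℕ} {w : Module.End ℚ (Module.Dual ℚ 𝔥)} {v : Module.End ℚ 𝔥}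
    (h : D.IsWord n w v) : D.IsWord (D.len w) w v := by
  obtain ⟨v', h'⟩ := Nat.sInf_mem (⟨n, v, h⟩ : {n | ∃ v, D.IsWord n w v}.Nonempty)
  rwa [h.unique h']

theorem IsWord.len_mul_r_le {n : ℕ} {w : Module.End ℚ (Module.Dual ℚ 𝔥)} {v : Module.End ℚ 𝔥}
    (h : D.IsWord n w v) {i : I} (hi : A i i = 2) : D.len (w * D.r i) ≤ D.len w + 1 :=
  (IsWord.mul_r _ _ _ i hi h.reduced).len_le

theorem IsWord.len_le_mul_r {n : ℕ} {w : Module.End ℚ (Module.Dual ℚ 𝔥)} {v : Module.End ℚ 𝔥}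
    (h : D.IsWord n w v) {i : I} (hi : A i i = 2) : D.len w ≤ D.len (w * D.r i) + 1 := by
  have := (IsWord.mul_r _ _ _ i hi h).len_mul_r_le hi
  rwa [mul_assoc, D.r_mul_r hi, mul_one] at this

/-- Every word of positive length has a last letter whose removal makes it shorter. -/
theorem IsWord.exists_eq_mul_r {n : ℕ} {w : Module.End ℚ (Module.Dual ℚ 𝔥)}
    {v : Module.End ℚ 𝔥} (h : D.IsWord n w v) (h0 : D.len w ≠ 0) :
    ∃ w' v' k, A k k = 2 ∧ D.IsWord (D.len w') w' v' ∧ w = w' * D.r k ∧ v = v' * D.rv k ∧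
      D.len w = D.len w' + 1 := by
  have hr := h.reduced
  generalize hm : D.len w = m at hr h0
  cases hr with
  | one => exact absurd rfl h0
  | mul_r n w' v' k hk hw =>
    refine ⟨w', v', k, hk, hw.reduced, rfl, rfl, ?_⟩
    have h1 := hw.len_le
    have h2 := hw.len_mul_r_le hk
    omega

end Coordinates

end Realization

end GLS

namespace GLS

namespace Realization

section SignCoherence

variable {I : Type*} {A : Matrix I I ℤ} {𝔥 : Type*} [AddCommGroup 𝔥] [Module ℚ 𝔥]
  (D : Realization A 𝔥)

/-! ### Sign coherence of the roots -/

/-- `w rⱼ rᵢ rⱼ ⋯` with `l` alternating factors after `w`, the first of which is `rⱼ`. -/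
def altMul (w : Module.End ℚ (Module.Dual ℚ 𝔥)) (i j : I) : ℕ → Module.End ℚ (Module.Dual ℚ 𝔥)
  | 0 => w
  | l + 1 => altMul w i j l * D.r (if Even l then j else i)

/-- The coefficients of `αᵢ` and `αⱼ` in `⋯ rⱼ rᵢ rⱼ αᵢ` (`l` alternating factors, the last of
which is `rⱼ`), where `a = -aᵢⱼ` and `b = -aⱼᵢ`. -/
def altCoeff (a b : ℤ) : ℕ → ℤ × ℤ
  | 0 => (1, 0)
  | l + 1 =>
    if Even l then ((altCoeff a b l).1, b * (altCoeff a b l).1 - (altCoeff a b l).2)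
    else (a * (altCoeff a b l).2 - (altCoeff a b l).1, (altCoeff a b l).2)

theorem altMul_apply_altCoeff {i j : I} (hi : A i i = 2) (hj : A j j = 2)
    (w : Module.End ℚ (Module.Dual ℚ 𝔥)) (l : ℕ) :
    D.altMul w i j l (((altCoeff (-A i j) (-A j i) l).1 : ℚ) • D.root i +
      ((altCoeff (-A i j) (-A j i) l).2 : ℚ) • D.root j) = w (D.root i) := by
  induction l with
  | zero => simp [altMul, altCoeff]
  | succ l ih =>
    rw [← ih, altMul, altCoeff, Module.End.mul_apply]
    congr 1
    split_ifs
    · simp only [map_add, map_smul, r_apply, D.root_coroot, hj]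
      push_cast
      module
    · simp only [map_add, map_smul, r_apply, D.root_coroot, hi]
      push_cast
      module

theorem altCoeff_nonneg {a b : ℤ} (ha : 0 ≤ a) (hb : 0 ≤ b) (hab : 4 ≤ a * b) (l : ℕ) :
    0 ≤ (altCoeff a b l).1 ∧ 0 ≤ (altCoeff a b l).2 := by
  -- The coefficient that was updated last dominates the other one.
  have key : (0 ≤ (altCoeff a b l).1 ∧ 0 ≤ (altCoeff a b l).2) ∧
      (Even l → a * (altCoeff a b l).2 ≤ 2 * (altCoeff a b l).1) ∧
      (¬ Even l → b * (altCoeff a b l).1 ≤ 2 * (altCoeff a b l).2) := by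
    induction l with
    | zero => simp [altCoeff]
    | succ l ih =>
      obtain ⟨⟨h1, h2⟩, h3, h4⟩ := ih
      rw [altCoeff]
      by_cases hl : Even l
      · have h5 := h3 hl
        have h6 : ¬ Even (l + 1) := by rw [Nat.even_add_one]; exact not_not.2 hl
        simp only [if_pos hl, h6, false_imp_iff, not_false_iff, true_imp_iff, true_and]
        have h7 : 2 * (altCoeff a b l).2 ≤ b * (altCoeff a b l).1 := by nlinarith
        exact ⟨⟨h1, by linarith⟩, by linarith⟩
      · have h5 := h4 hl
        have h6 : Even (l + 1) := by rw [Nat.even_add_one]; exact hl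
        simp only [if_neg hl, h6, not_true, false_imp_iff, true_imp_iff, and_true]
        have h7 : 2 * (altCoeff a b l).1 ≤ a * (altCoeff a b l).2 := by nlinarith
        exact ⟨⟨by linarith, h2⟩, by linarith⟩
  exact key.1

/-- If `aᵢⱼ aⱼᵢ < 4`, then `rᵢ` and `rⱼ` satisfy the braid relation of length `m`, and the
coefficients of the roots that come before it are nonnegative. -/
theorem exists_braid (hA : IsBorcherdsCartan A) {i j : I} (hij : i ≠ j) (hi : A i i = 2)
    (hj : A j j = 2) (h4 : A i j * A j i < 4) :
    ∃ m, 0 < m ∧ (∀ l < m, 0 ≤ (altCoeff (-A i j) (-A j i) l).1 ∧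
        0 ≤ (altCoeff (-A i j) (-A j i) l).2) ∧
      ∃ x y, A x x = 2 ∧ A y y = 2 ∧
        ∀ w, w * D.r i = D.altMul (D.altMul w i j m) x y (m - 1) := by
  have h1 := hA.off_diag i j hij
  have h2 := hA.off_diag j i hij.symm
  have h0 := hA.zero_iff i j
  have hri : ∀ (x : Module.Dual ℚ 𝔥) (u v : ℚ), D.r i (x + u • D.root i + v • D.root j) =
      x + (-u - x (D.coroot i) - v * A i j) • D.root i + v • D.root j := by
    intro x u v
    simp only [map_add, map_smul, r_apply, D.root_coroot, hi]
    push_cast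
    module
  have hrj : ∀ (x : Module.Dual ℚ 𝔥) (u v : ℚ), D.r j (x + u • D.root i + v • D.root j) =
      x + u • D.root i + (-v - x (D.coroot j) - u * A j i) • D.root j := by
    intro x u v
    simp only [map_add, map_smul, r_apply, D.root_coroot, hj]
    push_cast
    module
  have hx : ∀ x : Module.Dual ℚ 𝔥, x = x + (0 : ℚ) • D.root i + (0 : ℚ) • D.root j := by simp
  have hcases : (A i j = 0 ∧ A j i = 0) ∨ (A i j = -1 ∧ A j i = -1) ∨
      ((A i j = -1 ∧ A j i = -2) ∨ (A i j = -2 ∧ A j i = -1)) ∨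
      ((A i j = -1 ∧ A j i = -3) ∨ (A i j = -3 ∧ A j i = -1)) := by
    by_cases h5 : A i j = 0
    · exact Or.inl ⟨h5, h0.1 h5⟩
    · have h6 : A j i ≠ 0 := fun h => h5 (h0.2 h)
      have h7 : A i j ≤ -1 := by omega
      have h8 : A j i ≤ -1 := by omega
      have h9 : -3 ≤ A i j := by nlinarith
      have h10 : -3 ≤ A j i := by nlinarith
      generalize A i j = a at *
      generalize A j i = b at *
      interval_cases a <;> interval_cases b <;> simp at h4 ⊢
  rcases hcases with ⟨ha, hb⟩ | ⟨ha, hb⟩ | h | h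
  · refine ⟨2, by omega, ?_, i, j, hi, hj, fun w => ?_⟩
    · intro l hl
      rw [ha, hb]
      interval_cases l <;> decide
    · ext1 x
      simp only [altMul, Module.End.mul_apply]
      rw [hx x]
      norm_num only [hri, hrj, ha, hb, if_true, if_false]
      congr 1
      module
  · refine ⟨3, by omega, ?_, j, i, hj, hi, fun w => ?_⟩
    · intro l hl
      rw [ha, hb]
      interval_cases l <;> decide
    · ext1 x
      simp only [altMul, Module.End.mul_apply]
      rw [hx x]
      norm_num only [hri, hrj, ha, hb, if_true, if_false]
      congr 1
      module
  · refine ⟨4, by omega, ?_, i, j, hi, hj, fun w => ?_⟩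
    · intro l hl
      rcases h with ⟨ha, hb⟩ | ⟨ha, hb⟩ <;> rw [ha, hb] <;> interval_cases l <;> decide
    · ext1 x
      simp only [altMul, Module.End.mul_apply]
      rw [hx x]
      rcases h with ⟨ha, hb⟩ | ⟨ha, hb⟩ <;>
      · norm_num only [hri, hrj, ha, hb, if_true, if_false]
        congr 1
        module
  · refine ⟨6, by omega, ?_, i, j, hi, hj, fun w => ?_⟩
    · intro l hl
      rcases h with ⟨ha, hb⟩ | ⟨ha, hb⟩ <;> rw [ha, hb] <;> interval_cases l <;> decide
    · ext1 x
      simp only [altMul, Module.End.mul_apply]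
      rw [hx x]
      rcases h with ⟨ha, hb⟩ | ⟨ha, hb⟩ <;>
      · norm_num only [hri, hrj, ha, hb, if_true, if_false]
        congr 1
        module

variable {D}

theorem IsWord.altMul {n : ℕ} {w : Module.End ℚ (Module.Dual ℚ 𝔥)} {v : Module.End ℚ 𝔥}
    (h : D.IsWord n w v) {i j : I} (hi : A i i = 2) (hj : A j j = 2) (l : ℕ) :
    ∃ v', D.IsWord (n + l) (D.altMul w i j l) v' := by
  induction l with
  | zero => exact ⟨v, h⟩
  | succ l ih =>
    obtain ⟨v', hv'⟩ := ih
    exact ⟨_, hv'.mul_r _ _ _ _ (by split_ifs <;> assumption)⟩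

/-- The length criterion for positivity: if `rᵢ` does not shorten `w`, then `w αᵢ ∈ Q⁺`.

By induction on the length, it is enough to write `w = g u` with `g` strictly shorter and not
shortened by `rᵢ` and `rⱼ`, where `u` is an alternating product of `rᵢ` and `rⱼ` such that
`u αᵢ` is a nonnegative combination of `αᵢ` and `αⱼ`; the longest alternating end of a reduced word
serves. -/
theorem apply_root_mem_Qplus (hA : IsBorcherdsCartan A) {n : ℕ}
    {w : Module.End ℚ (Module.Dual ℚ 𝔥)} {v : Module.End ℚ 𝔥} (hw : D.IsWord n w v) {i : I}
    (hi : A i i = 2) (hle : D.len w ≤ D.len (w * D.r i)) : w (D.root i) ∈ D.Qplus := by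
  induction hN : D.len w using Nat.strong_induction_on generalizing w v n i with
  | _ N ih =>
  by_cases h0 : D.len w = 0
  · have := hw.reduced
    rw [h0] at this
    cases this
    exact D.root_mem_Qplus i
  obtain ⟨w', v', j, hj, hw', hww, -, hlen⟩ := hw.exists_eq_mul_r h0
  have hij : i ≠ j := by
    rintro rfl
    have h1 : w * D.r i = w' := by rw [hww, mul_assoc, D.r_mul_r hi, mul_one]
    rw [h1] at hle
    omega
  have hone : w * D.r j = w' := by rw [hww, mul_assoc, D.r_mul_r hj, mul_one]
  -- the longest alternating end of a reduced word
  have hex : ∃ k, 1 ≤ k ∧ k ≤ N ∧ D.len (D.altMul w i j k) + k = N ∧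
      (∀ k', k' ≤ N → D.len (D.altMul w i j k') + k' = N → k' ≤ k) := by
    classical
    have hP1 : 1 ≤ N ∧ D.len (D.altMul w i j 1) + 1 = N := by
      have : D.altMul w i j 1 = w' := by simp [Realization.altMul, hone]
      rw [this]
      omega
    have h1 := Nat.findGreatest_spec (P := fun k => D.len (D.altMul w i j k) + k = N) hP1.1 hP1.2
    refine ⟨Nat.findGreatest (fun k => D.len (D.altMul w i j k) + k = N) N,
      Nat.le_findGreatest hP1.1 hP1.2, Nat.findGreatest_le _, h1, fun k' h2 h3 =>
      Nat.le_findGreatest h2 h3⟩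
  obtain ⟨k, hk1, hkN, hk, hmax⟩ := hex
  have hlow : ∀ l, N ≤ D.len (D.altMul w i j l) + l := by
    intro l
    induction l with
    | zero => exact hN.ge
    | succ l ihl =>
      obtain ⟨v1, h1⟩ := hw.altMul hi hj l
      have := h1.len_le_mul_r (i := if Even l then j else i) (by split_ifs <;> assumption)
      rw [Realization.altMul]
      omega
  obtain ⟨v1, hg⟩ := hw.altMul hi hj k
  have hnext : D.len (D.altMul w i j k) ≤
      D.len (D.altMul w i j k * D.r (if Even k then j else i)) := by
    have h1 := hlow (k + 1)
    have h2 := hmax (k + 1)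
    rw [Realization.altMul] at h1 h2
    by_contra hcon
    have := h2 (by omega) (by omega)
    omega
  have hprev : D.len (D.altMul w i j k) ≤
      D.len (D.altMul w i j k * D.r (if Even k then i else j)) := by
    obtain ⟨k, rfl⟩ : ∃ k', k = k' + 1 := ⟨k - 1, by omega⟩
    have h1 : D.altMul w i j (k + 1) * D.r (if Even (k + 1) then i else j) =
        D.altMul w i j k := by
      rw [Realization.altMul, mul_assoc]
      by_cases hE : Even k
      · rw [if_pos hE, if_neg (by rw [Nat.even_add_one]; exact not_not.2 hE), D.r_mul_r hj,
          mul_one]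
      · rw [if_neg hE, if_pos (by rw [Nat.even_add_one]; exact hE), D.r_mul_r hi, mul_one]
    rw [h1]
    have := hlow k
    omega
  have hpos : D.altMul w i j k (D.root i) ∈ D.Qplus ∧ D.altMul w i j k (D.root j) ∈ D.Qplus := by
    by_cases hE : Even k
    · rw [if_pos hE] at hnext hprev
      exact ⟨ih _ (by omega) hg hi hprev rfl, ih _ (by omega) hg hj hnext rfl⟩
    · rw [if_neg hE] at hnext hprev
      exact ⟨ih _ (by omega) hg hi hnext rfl, ih _ (by omega) hg hj hprev rfl⟩
  have hcoef : 0 ≤ (altCoeff (-A i j) (-A j i) k).1 ∧ 0 ≤ (altCoeff (-A i j) (-A j i) k).2 := by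
    by_cases h4 : A i j * A j i < 4
    · obtain ⟨m, hm0, hm, x, y, hx, hy, hbraid⟩ := D.exists_braid hA hij hi hj h4
      refine hm k ?_
      -- an alternating end as long as the braid relation could be rewritten to end in `rᵢ`
      by_contra hmk
      have hup : ∀ l, D.len (D.altMul w i j m) ≤ D.len (D.altMul w i j (m + l)) + l := by
        intro l
        induction l with
        | zero => exact le_rfl
        | succ l ihl =>
          obtain ⟨v1, h1⟩ := hw.altMul hi hj (m + l)
          have := h1.len_le_mul_r (i := if Even (m + l) then j else i)
            (by split_ifs <;> assumption)
          change D.len (D.altMul w i j m) ≤ D.len (D.altMul w i j (m + l) *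
            D.r (if Even (m + l) then j else i)) + (l + 1)
          omega
      have h1 := hup (k - m)
      rw [show m + (k - m) = k by omega] at h1
      obtain ⟨v1, h2⟩ := hw.altMul hi hj m
      obtain ⟨v2, h3⟩ := h2.reduced.altMul hx hy (m - 1)
      have h5 := h3.len_le
      rw [← hbraid w] at h5
      omega
    · refine altCoeff_nonneg ?_ ?_ ?_ k
      · have := hA.off_diag i j hij
        omega
      · have := hA.off_diag j i hij.symm
        omega
      · rw [neg_mul_neg]
        omega
  rw [← D.altMul_apply_altCoeff hi hj w k, map_add, map_smul, map_smul]
  obtain ⟨⟨p, hp⟩, ⟨q, hq⟩⟩ := And.intro (Int.eq_ofNat_of_zero_le hcoef.1)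
    (Int.eq_ofNat_of_zero_le hcoef.2)
  rw [hp, hq]
  exact D.Qplus.add_mem (by exact_mod_cast D.nsmul_mem_Qplus hpos.1 p)
    (by exact_mod_cast D.nsmul_mem_Qplus hpos.2 q)

/-- Sign coherence: a real root or its negative is positive. -/
theorem IsRoot.mem_Qplus_or_neg (hA : IsBorcherdsCartan A) {j : I} (hj : A j j = 2)
    {β : Module.Dual ℚ 𝔥} {h : 𝔥} (hβ : D.IsRoot j β h) : β ∈ D.Qplus ∨ -β ∈ D.Qplus := by
  obtain ⟨n, w, v, hw, rfl, -⟩ := hβ.exists_isWord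
  by_cases hle : D.len w ≤ D.len (w * D.r j)
  · exact Or.inl (apply_root_mem_Qplus hA hw hj hle)
  · right
    have h1 := apply_root_mem_Qplus hA (hw.mul_r _ _ _ j hj) hj (by
      rw [mul_assoc, D.r_mul_r hj, mul_one]
      omega)
    rwa [Module.End.mul_apply, D.r_root_self hj, map_neg] at h1

/-- An element of the Weyl group that keeps all real simple roots out of `-Q⁺` is trivial. -/
theorem IsWord.eq_one (hA : IsBorcherdsCartan A) {n : ℕ}
    {w : Module.End ℚ (Module.Dual ℚ 𝔥)} {v : Module.End ℚ 𝔥} (hw : D.IsWord n w v)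
    (h : ∀ k, A k k = 2 → -w (D.root k) ∉ D.Qplus) : w = 1 := by
  by_cases h0 : D.len w = 0
  · have := hw.reduced
    rw [h0] at this
    cases this
    rfl
  · obtain ⟨w', v', k, hk, hw', rfl, -, hlen⟩ := hw.exists_eq_mul_r h0
    refine absurd ?_ (h k hk)
    rw [Module.End.mul_apply, D.r_root_self hk, map_neg, neg_neg]
    exact apply_root_mem_Qplus hA hw' hk (by omega)

/-- Words move an antidominant element of `𝔥*` upwards. -/
theorem IsWord.apply_sub_mem_Qplus (hA : IsBorcherdsCartan A) {n : ℕ}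
    {w : Module.End ℚ (Module.Dual ℚ 𝔥)} {v : Module.End ℚ 𝔥} (hw : D.IsWord n w v)
    {x : Module.Dual ℚ 𝔥} (hx : ∀ k, A k k = 2 → ∃ m : ℕ, x (D.coroot k) = -m) :
    w x - x ∈ D.Qplus := by
  induction hN : D.len w generalizing w v n with
  | zero =>
    have := hw.reduced
    rw [hN] at this
    cases this
    simp
  | succ N ih =>
    obtain ⟨w', v', k, hk, hw', rfl, -, hlen⟩ := hw.exists_eq_mul_r (by omega)
    obtain ⟨m, hm⟩ := hx k hk
    have h1 := ih hw' (by omega)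
    have h2 := D.nsmul_mem_Qplus (apply_root_mem_Qplus hA hw' hk (by omega)) m
    rw [Module.End.mul_apply, r_apply, hm, map_sub, map_smul]
    have h3 : w' x - -(m : ℚ) • w' (D.root k) - x =
        (w' x - x) + (m : ℚ) • w' (D.root k) := by module
    rw [h3]
    exact D.Qplus.add_mem h1 h2

theorem root_antidominant (hA : IsBorcherdsCartan A) {j : I} (hj : A j j ≠ 2) (k : I)
    (hk : A k k = 2) : ∃ m : ℕ, D.root j (D.coroot k) = -m := by
  have h1 := hA.off_diag k j (by rintro rfl; exact hj hk)
  refine ⟨(-A k j).toNat, ?_⟩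
  rw [D.root_coroot]
  have : (((-A k j).toNat : ℤ) : ℚ) = ((-A k j : ℤ) : ℚ) := by rw [Int.toNat_of_nonneg (by omega)]
  rw [← Int.cast_natCast, this]
  push_cast
  ring

/-- Imaginary roots are positive. -/
theorem IsRoot.mem_Qplus (hA : IsBorcherdsCartan A) {j : I} (hj : A j j ≠ 2)
    {β : Module.Dual ℚ 𝔥} {h : 𝔥} (hβ : D.IsRoot j β h) : β ∈ D.Qplus := by
  obtain ⟨n, w, v, hw, rfl, -⟩ := hβ.exists_isWord
  have h1 := hw.apply_sub_mem_Qplus hA (root_antidominant hA hj)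
  have := D.Qplus.add_mem h1 (D.root_mem_Qplus j)
  rwa [sub_add_cancel] at this

theorem IsRoot.coord_of_imaginary {i j : I} (hi : A i i ≠ 2) {β : Module.Dual ℚ 𝔥} {h : 𝔥}
    (hβ : D.IsRoot j β h) : D.coord i β = D.coord i (D.root j) := by
  induction hβ with
  | simple => rfl
  | reflect k hk β h _ ih =>
    rw [r_apply, map_sub, map_smul, D.coord_root_ne (by rintro rfl; exact hi hk), smul_zero,
      sub_zero, ih]

/-- A Weyl group element that fixes an imaginary simple root fixes its coroot. -/
theorem IsWord.apply_coroot_eq (hA : IsBorcherdsCartan A) {n : ℕ}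
    {w : Module.End ℚ (Module.Dual ℚ 𝔥)} {v : Module.End ℚ 𝔥} (hw : D.IsWord n w v)
    {j : I} (hj : A j j ≠ 2) (h : w (D.root j) = D.root j) : v (D.coroot j) = D.coroot j := by
  induction hN : D.len w generalizing w v n with
  | zero =>
    have := hw.reduced
    rw [hN] at this
    cases this
    rfl
  | succ N ih =>
    obtain ⟨w', v', k, hk, hw', rfl, rfl, hlen⟩ := hw.exists_eq_mul_r (by omega)
    have h1 := hw'.apply_sub_mem_Qplus hA (root_antidominant hA hj)
    have hp := apply_root_mem_Qplus hA hw' hk (by omega)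
    obtain ⟨m, hm⟩ := root_antidominant (D := D) hA hj k hk
    have h2 := D.nsmul_mem_Qplus hp m
    rw [Module.End.mul_apply, r_apply, hm, map_sub, map_smul] at h
    have h3 : (m : ℚ) • w' (D.root k) = -(w' (D.root j) - D.root j) := by
      rw [← sub_eq_zero, ← sub_eq_zero.2 h]
      module
    have h4 : w' (D.root j) - D.root j = 0 := D.eq_zero_of_neg_mem_Qplus h1 (h3 ▸ h2)
    rw [h4, neg_zero, smul_eq_zero] at h3
    have h5 : (m : ℚ) = 0 := by
      refine h3.resolve_right fun h6 => D.root_ne_zero k (hw'.injective ?_)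
      rw [h6, map_zero]
    have h6 : A k j = 0 := by
      rw [h5, neg_zero, D.root_coroot] at hm
      exact_mod_cast hm
    have h7 : A j k = 0 := (hA.zero_iff k j).1 h6
    rw [Module.End.mul_apply, rv_apply, D.root_coroot, h7, Int.cast_zero, zero_smul, sub_zero]
    exact ih hw' (sub_eq_zero.1 h4) (by omega)

end SignCoherence

end Realization

end GLS

namespace GLS

namespace Realization

section Order

variable {I : Type*} {A : Matrix I I ℤ} {𝔥 : Type*} [AddCommGroup 𝔥] [Module ℚ 𝔥]
  {D : Realization A 𝔥} {lam μ ν κ : Module.Dual ℚ 𝔥} {a : ℚ} {i j : I}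

/-! ### Ascents and simple real reflections -/

theorem IsAscent.sub_eq {β : Module.Dual ℚ 𝔥} {h : 𝔥} (H : D.IsAscent j β h μ ν) :
    ν - μ = ν h • β := by
  rw [H.2.2.2]
  module

theorem isAscent_simple (hν : 0 < ν (D.coroot i)) :
    D.IsAscent i (D.root i) (D.coroot i) (D.r i ν) ν :=
  ⟨IsRoot.simple, D.root_mem_Qplus i, hν, D.r_apply i ν⟩

/-- A simple real reflection either makes a positive root `β` another positive root, or the
reflection in `β` is that simple reflection. -/
theorem IsRoot.r_mem_Qplus_or (hA : IsBorcherdsCartan A) (hi : A i i = 2)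
    {β : Module.Dual ℚ 𝔥} {h : 𝔥} (hβ : D.IsRoot j β h) (hp : β ∈ D.Qplus) :
    D.r i β ∈ D.Qplus ∨ ∀ x : Module.Dual ℚ 𝔥, x h • β = x (D.coroot i) • D.root i := by
  by_cases hj : A j j = 2
  swap
  · exact Or.inl ((hβ.reflect i hi).mem_Qplus hA hj)
  refine ((hβ.reflect i hi).mem_Qplus_or_neg hA hj).imp_right fun hn => ?_
  have hcoord : ∀ k, k ≠ i → D.coord k β = 0 := by
    intro k hk
    have h1 := D.coord_nonneg hn k
    rw [r_apply, map_neg, map_sub, map_smul, D.coord_root_ne hk.symm, smul_zero, sub_zero] at h1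
    linarith [D.coord_nonneg hp k]
  have hβi := D.eq_coord_smul_of_mem_Qplus hp i hcoord
  -- The product of the two reflections fixes all simple roots modulo `αᵢ`, so it is trivial.
  obtain ⟨n, w, v, hw, hwx⟩ := hβ.exists_isWord_reflection hj
  have hβh : β h = 2 := by
    rw [hβ.apply_self, hj]
    norm_num
  have hri : ∀ x, (D.r i * w) x = x + (-x (D.coroot i) + x h * D.coord i β) • D.root i := by
    intro x
    rw [Module.End.mul_apply, hwx, map_sub, map_smul]
    conv_lhs => rw [hβi]
    rw [map_smul, D.r_root_self hi, r_apply]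
    module
  have hone : D.r i * w = 1 := by
    refine (hw.r_mul hi).eq_one hA fun k hk hcon => ?_
    rw [hri] at hcon
    have h1 := D.coord_nonneg hcon k
    by_cases hki : k = i
    · subst hki
      have h2 : D.root k h * D.coord k β = 2 := by
        rw [← hβh]
        conv_rhs => rw [hβi]
        rw [LinearMap.smul_apply, smul_eq_mul, mul_comm]
      rw [h2, D.root_coroot, hk, map_neg, map_add, map_smul, coord_root_self] at h1
      norm_num at h1
    · rw [map_neg, map_add, map_smul, coord_root_self, D.coord_root_ne (Ne.symm hki)] at h1
      norm_num at h1
  intro x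
  have h1 := hri x
  rw [hone, Module.End.one_apply, left_eq_add, smul_eq_zero] at h1
  have h2 := h1.resolve_right (D.root_ne_zero i)
  rw [hβi, smul_smul]
  congr 1
  linarith

/-- An ascent is either given by `rᵢ`, or `rᵢ` maps it to another ascent. -/
theorem IsAscent.eq_r_or (hA : IsBorcherdsCartan A) (hi : A i i = 2)
    {β : Module.Dual ℚ 𝔥} {h : 𝔥} (H : D.IsAscent j β h μ ν) :
    μ = D.r i ν ∨ D.IsAscent j (D.r i β) (D.rv i h) (D.r i μ) (D.r i ν) := by
  rcases H.1.r_mem_Qplus_or hA hi H.2.1 with h1 | h1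
  · refine Or.inr ⟨H.1.reflect i hi, h1, ?_, ?_⟩
    · rw [D.r_apply_rv hi]
      exact H.2.2.1
    · rw [D.r_apply_rv hi, H.2.2.2, map_sub, map_smul]
  · left
    rw [H.2.2.2, h1, r_apply]

theorem hasSeq_zero : D.HasSeq 0 μ ν ↔ μ = ν := by
  constructor
  · rintro ⟨κ, rfl, rfl, -⟩
    rfl
  · rintro rfl
    exact ⟨fun _ => μ, rfl, rfl, fun k hk => absurd hk (Nat.not_lt_zero k)⟩

theorem hasSeq_succ {n : ℕ} :
    D.HasSeq (n + 1) μ ν ↔ ∃ κ, (∃ j β h, D.IsAscent j β h μ κ) ∧ D.HasSeq n κ ν := by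
  constructor
  · rintro ⟨κ, rfl, rfl, h⟩
    exact ⟨κ 1, h 0 (Nat.succ_pos n), fun k => κ (k + 1), rfl, rfl,
      fun k hk => h (k + 1) (by omega)⟩
  · rintro ⟨κ₁, h1, κ, rfl, rfl, h⟩
    refine ⟨fun k => Nat.casesOn k μ κ, rfl, rfl, fun k hk => ?_⟩
    cases k with
    | zero => exact h1
    | succ k => exact h k (by omega)

theorem IsAscent.hasSeq {β : Module.Dual ℚ 𝔥} {h : 𝔥} (H : D.IsAscent j β h μ ν) :
    D.HasSeq 1 μ ν :=
  hasSeq_succ.2 ⟨ν, ⟨j, β, h, H⟩, hasSeq_zero.2 rfl⟩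

theorem HasSeq.trans {m n : ℕ} (h1 : D.HasSeq m μ κ) (h2 : D.HasSeq n κ ν) :
    D.HasSeq (m + n) μ ν := by
  induction m generalizing μ with
  | zero =>
    rw [hasSeq_zero.1 h1, zero_add]
    exact h2
  | succ m ih =>
    obtain ⟨κ', h3, h4⟩ := hasSeq_succ.1 h1
    rw [Nat.add_right_comm]
    exact hasSeq_succ.2 ⟨κ', h3, ih h4⟩

theorem hasSeq_succ' {n : ℕ} (h : D.HasSeq (n + 1) μ ν) :
    ∃ κ, D.HasSeq n μ κ ∧ ∃ j β h, D.IsAscent j β h κ ν := by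
  obtain ⟨κ, rfl, rfl, h⟩ := h
  exact ⟨κ n, ⟨κ, rfl, rfl, fun k hk => h k (by omega)⟩, h n (by omega)⟩

/-- The end of a sequence of ascents minus its beginning is a sum of positive multiples of
positive roots. -/
theorem HasSeq.induction_cone {p : Module.Dual ℚ 𝔥 → Prop} (h0 : p 0)
    (hadd : ∀ x y, p x → p y → p (x + y))
    (hsmul : ∀ (c : ℚ) j β h, 0 < c → D.IsRoot j β h → β ∈ D.Qplus → p (c • β)) {n : ℕ}
    (h : D.HasSeq n μ ν) : p (ν - μ) := by
  induction n generalizing μ with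
  | zero =>
    rw [hasSeq_zero.1 h, sub_self]
    exact h0
  | succ n ih =>
    obtain ⟨κ, ⟨j, β, g, h1⟩, h2⟩ := hasSeq_succ.1 h
    rw [← sub_add_sub_cancel ν κ μ, h1.sub_eq]
    exact hadd _ _ (ih h2) (hsmul _ j β g h1.2.2.1 h1.1 h1.2.1)

theorem HasSeq.coord_le {n : ℕ} (h : D.HasSeq n μ ν) (k : I) : D.coord k μ ≤ D.coord k ν := by
  have := h.induction_cone (p := fun x => 0 ≤ D.coord k x) (by simp)
    (fun x y hx hy => by rw [map_add]; exact add_nonneg hx hy)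
    (fun c j β h hc _ hβ => by
      rw [map_smul]
      exact smul_nonneg hc.le (D.coord_nonneg hβ k))
  rw [map_sub] at this
  linarith

theorem HasSeq.ht_lt_or_eq_zero {n : ℕ} (h : D.HasSeq n μ ν) : D.ht μ < D.ht ν ∨ n = 0 := by
  cases n with
  | zero => exact Or.inr rfl
  | succ n =>
    left
    obtain ⟨κ, ⟨j, β, g, h1⟩, h2⟩ := hasSeq_succ.1 h
    have h3 := h2.induction_cone (p := fun x => 0 ≤ D.ht x) (by simp)
      (fun x y hx hy => by rw [map_add]; exact add_nonneg hx hy)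
      (fun c j β h hc _ hβ => by
        rw [map_smul]
        exact smul_nonneg hc.le (D.ht_nonneg hβ))
    have h4 := congrArg D.ht h1.sub_eq
    rw [map_smul, map_sub, smul_eq_mul] at h4
    have := mul_pos h1.2.2.1 (D.ht_pos h1.2.1 h1.1.ne_zero)
    rw [map_sub] at h3
    linarith

theorem HasSeq.eq_zero_of_self {n : ℕ} (h : D.HasSeq n μ μ) : n = 0 :=
  h.ht_lt_or_eq_zero.resolve_left (lt_irrefl _)

theorem HasSeq.apply_coroot_le_of_imaginary (hA : IsBorcherdsCartan A) (hi : A i i ≠ 2) {n : ℕ}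
    (h : D.HasSeq n μ ν) : ν (D.coroot i) ≤ μ (D.coroot i) := by
  have := h.induction_cone (p := fun x => x (D.coroot i) ≤ 0) (by simp)
    (fun x y hx hy => by rw [LinearMap.add_apply]; exact add_nonpos hx hy)
    (fun c j β h hc _ hβ => by
      rw [LinearMap.smul_apply]
      exact smul_nonpos_of_nonneg_of_nonpos hc.le (D.apply_coroot_nonpos_of_mem_Qplus hA hi hβ))
  rw [LinearMap.sub_apply] at this
  linarith

/-- Replacing the weights of a sequence by the members of their `rᵢ`-orbits that are nonnegative
on `αᵢ^∨` loses at most as many steps as the change of sign at the ends accounts for. -/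
theorem HasSeq.exists_nonneg (hA : IsBorcherdsCartan A) (hi : A i i = 2) {n : ℕ}
    (h : D.HasSeq n μ ν) :
    ∃ m, D.HasSeq m (if μ (D.coroot i) < 0 then D.r i μ else μ)
        (if ν (D.coroot i) < 0 then D.r i ν else ν) ∧
      n + (if ν (D.coroot i) < 0 then 1 else 0) ≤ m + (if μ (D.coroot i) < 0 then 1 else 0) := by
  induction n generalizing μ with
  | zero =>
    obtain rfl := hasSeq_zero.1 h
    exact ⟨0, hasSeq_zero.2 rfl, le_rfl⟩
  | succ n ih =>
    obtain ⟨κ, ⟨j, β, g, h1⟩, h2⟩ := hasSeq_succ.1 h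
    obtain ⟨m, h3, h4⟩ := ih h2
    suffices hs : ∃ l, D.HasSeq l (if μ (D.coroot i) < 0 then D.r i μ else μ)
        (if κ (D.coroot i) < 0 then D.r i κ else κ) ∧
        1 + (if κ (D.coroot i) < 0 then 1 else 0) ≤ l + (if μ (D.coroot i) < 0 then 1 else 0) by
      obtain ⟨l, h5, h6⟩ := hs
      exact ⟨l + m, h5.trans h3, by omega⟩
    have hup : ∀ x : Module.Dual ℚ 𝔥, x (D.coroot i) < 0 → D.HasSeq 1 x (D.r i x) := by
      intro x hx
      have h7 : 0 < D.r i x (D.coroot i) := by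
        rw [D.r_apply_coroot_self hi]
        linarith
      have := (isAscent_simple h7).hasSeq
      rwa [D.r_r hi] at this
    rcases h1.eq_r_or hA hi with h7 | h7
    · subst h7
      rw [D.r_apply_coroot_self hi, D.r_r hi]
      rcases lt_trichotomy (κ (D.coroot i)) 0 with h8 | h8 | h8
      · rw [if_pos h8, if_neg (by linarith)]
        have := ((h1.hasSeq.trans (hup κ h8))).eq_zero_of_self
        omega
      · have h9 : D.r i κ = κ := by rw [r_apply, h8, zero_smul, sub_zero]
        rw [h9] at h1
        have := h1.hasSeq.eq_zero_of_self
        omega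
      · rw [if_pos (by linarith), if_neg (by linarith)]
        exact ⟨0, hasSeq_zero.2 rfl, by simp [h8, h8.le]⟩
    · by_cases h8 : μ (D.coroot i) < 0 <;> by_cases h9 : κ (D.coroot i) < 0
      · simp only [if_pos h8, if_pos h9]
        exact ⟨1, h7.hasSeq, le_rfl⟩
      · simp only [if_pos h8, if_neg h9]
        rcases (not_lt.1 h9).eq_or_lt with h10 | h10
        · have h11 : D.r i κ = κ := by rw [r_apply, ← h10, zero_smul, sub_zero]
          rw [h11] at h7
          exact ⟨1, h7.hasSeq, by omega⟩
        · have := hup (D.r i κ) (by rw [D.r_apply_coroot_self hi]; linarith)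
          rw [D.r_r hi] at this
          exact ⟨2, h7.hasSeq.trans this, by omega⟩
      · simp only [if_neg h8, if_pos h9]
        exact ⟨2, h1.hasSeq.trans (hup κ h9), by omega⟩
      · simp only [if_neg h8, if_neg h9]
        exact ⟨1, h1.hasSeq, le_rfl⟩

/-- The analogue of `HasSeq.exists_nonneg` for the members of the `rᵢ`-orbits that are nonpositive
on `αᵢ^∨`. -/
theorem HasSeq.exists_nonpos (hA : IsBorcherdsCartan A) (hi : A i i = 2) {n : ℕ}
    (h : D.HasSeq n μ ν) :
    ∃ m, D.HasSeq m (if 0 < μ (D.coroot i) then D.r i μ else μ)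
        (if 0 < ν (D.coroot i) then D.r i ν else ν) ∧
      n + (if 0 < μ (D.coroot i) then 1 else 0) ≤ m + (if 0 < ν (D.coroot i) then 1 else 0) := by
  induction n generalizing μ with
  | zero =>
    obtain rfl := hasSeq_zero.1 h
    exact ⟨0, hasSeq_zero.2 rfl, le_rfl⟩
  | succ n ih =>
    obtain ⟨κ, ⟨j, β, g, h1⟩, h2⟩ := hasSeq_succ.1 h
    obtain ⟨m, h3, h4⟩ := ih h2
    suffices hs : ∃ l, D.HasSeq l (if 0 < μ (D.coroot i) then D.r i μ else μ)
        (if 0 < κ (D.coroot i) then D.r i κ else κ) ∧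
        1 + (if 0 < μ (D.coroot i) then 1 else 0) ≤ l + (if 0 < κ (D.coroot i) then 1 else 0) by
      obtain ⟨l, h5, h6⟩ := hs
      exact ⟨l + m, h5.trans h3, by omega⟩
    rcases h1.eq_r_or hA hi with h7 | h7
    · subst h7
      rw [D.r_apply_coroot_self hi, D.r_r hi]
      rcases lt_trichotomy (κ (D.coroot i)) 0 with h8 | h8 | h8
      · have h9 : 0 < D.r i κ (D.coroot i) := by
          rw [D.r_apply_coroot_self hi]
          linarith
        have h10 := (isAscent_simple h9).hasSeq
        rw [D.r_r hi] at h10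
        have := (h10.trans h1.hasSeq).eq_zero_of_self
        omega
      · have h9 : D.r i κ = κ := by rw [r_apply, h8, zero_smul, sub_zero]
        rw [h9] at h1
        have := h1.hasSeq.eq_zero_of_self
        omega
      · rw [if_neg (by linarith), if_pos (by linarith)]
        exact ⟨0, hasSeq_zero.2 rfl, by simp [h8, h8.le]⟩
    · by_cases h8 : 0 < μ (D.coroot i) <;> by_cases h9 : 0 < κ (D.coroot i)
      · simp only [if_pos h8, if_pos h9]
        exact ⟨1, h7.hasSeq, le_rfl⟩
      · simp only [if_pos h8, if_neg h9]
        exact ⟨2, (isAscent_simple h8).hasSeq.trans h1.hasSeq, by omega⟩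
      · simp only [if_neg h8, if_pos h9]
        rcases (not_lt.1 h8).eq_or_lt with h10 | h10
        · have h11 : D.r i μ = μ := by rw [r_apply, h10, zero_smul, sub_zero]
          rw [h11] at h7
          exact ⟨1, h7.hasSeq, by omega⟩
        · have h11 : 0 < D.r i μ (D.coroot i) := by
            rw [D.r_apply_coroot_self hi]
            linarith
          have h12 := (isAscent_simple h11).hasSeq
          rw [D.r_r hi] at h12
          exact ⟨2, h12.trans h7.hasSeq, by omega⟩
      · simp only [if_neg h8, if_neg h9]
        exact ⟨1, h1.hasSeq, le_rfl⟩

end Order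

end Realization

end GLS

namespace GLS

namespace Realization

section Chains

variable {I : Type*} {A : Matrix I I ℤ} {𝔥 : Type*} [AddCommGroup 𝔥] [Module ℚ 𝔥]
  {D : Realization A 𝔥} {lam μ ν κ : Module.Dual ℚ 𝔥} {a : ℚ} {i j : I}

/-! ### Ascents and imaginary simple roots -/

theorem IsRoot.exists_pos (hA : IsBorcherdsCartan A) (hj : A j j = 2) {β : Module.Dual ℚ 𝔥}
    {h : 𝔥} (hβ : D.IsRoot j β h) (hp : β ∈ D.Qplus) : ∃ k, A k k = 2 ∧ 0 < β (D.coroot k) := by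
  by_contra! hcon
  -- Otherwise `β` is antidominant, and `-αⱼ`, which is conjugate to it, would be at least `β`.
  obtain ⟨n, w, v, hw, hwβ⟩ := hβ.exists_isWord_apply_eq
  have h1 := (hw.r_mul hj).apply_sub_mem_Qplus hA (x := β) fun k hk => by
    obtain ⟨z, hz⟩ := D.int_of_mem_Qplus hp k
    have h2 := hcon k hk
    rw [hz] at h2 ⊢
    have h3 : z ≤ 0 := by exact_mod_cast h2
    obtain ⟨m, rfl⟩ := Int.exists_eq_neg_ofNat h3
    exact ⟨m, by push_cast; rfl⟩
  rw [Module.End.mul_apply, hwβ, D.r_root_self hj] at h1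
  have h2 := D.ht_nonneg h1
  have h3 := D.ht_nonneg hp
  rw [map_sub, map_neg, ht_root] at h2
  linarith

/-- If a positive real root vanishes on the coroot of an imaginary `αᵢ`, then its coroot vanishes on
`αᵢ`. By induction on the height, since the zero pattern of `A` is symmetric. -/
theorem IsRoot.root_apply_eq_zero_of_real (hA : IsBorcherdsCartan A) (hi : A i i ≠ 2)
    (hj : A j j = 2) {β : Module.Dual ℚ 𝔥} {h : 𝔥} (hβ : D.IsRoot j β h) (hp : β ∈ D.Qplus)
    (h0 : β (D.coroot i) = 0) : D.root i h = 0 := by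
  obtain ⟨N, hN⟩ := D.ht_of_mem_Qplus hp
  induction N using Nat.strong_induction_on generalizing β h with
  | _ N ih =>
  obtain ⟨k, hk, hkpos⟩ := hβ.exists_pos hA hj hp
  rcases hβ.r_mem_Qplus_or hA hk hp with h1 | h1
  · have h2 := D.apply_coroot_nonpos_of_mem_Qplus hA hi h1
    have hik : A i k ≤ 0 := hA.off_diag i k (by rintro rfl; exact hi hk)
    have hik' : (A i k : ℚ) ≤ 0 := by exact_mod_cast hik
    rw [r_apply_coroot, h0] at h2
    have h3 : (A i k : ℚ) = 0 := by nlinarith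
    have h4 : A k i = 0 := (hA.zero_iff i k).1 (by exact_mod_cast h3)
    obtain ⟨M, hM⟩ := D.ht_of_mem_Qplus h1
    have hlt : M < N := by
      have : (M : ℚ) < N := by
        rw [← hM, ← hN, r_apply, map_sub, map_smul, ht_root, smul_eq_mul]
        linarith
      exact_mod_cast this
    have h5 := ih M hlt (hβ.reflect k hk) h1 (by rw [r_apply_coroot, h0, h3]; ring) hM
    rwa [rv_apply, map_sub, map_smul, D.root_coroot, h4, Int.cast_zero, smul_zero, sub_zero] at h5
  · have h2 := LinearMap.congr_fun (h1 β) (D.coroot i)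
    rw [LinearMap.smul_apply, h0, smul_zero, LinearMap.smul_apply, D.root_coroot] at h2
    have h3 : (A i k : ℚ) = 0 := (smul_eq_zero.1 h2.symm).resolve_left hkpos.ne'
    have h4 : A k i = 0 := (hA.zero_iff i k).1 (by exact_mod_cast h3)
    have h5 := h1 (D.root i)
    rw [D.root_coroot, h4, Int.cast_zero, zero_smul] at h5
    exact (smul_eq_zero.1 h5).resolve_right hβ.ne_zero

theorem IsWord.root_apply_eq_zero (hA : IsBorcherdsCartan A) (hi : A i i ≠ 2) (hj : A j j ≠ 2)
    {n : ℕ} {w : Module.End ℚ (Module.Dual ℚ 𝔥)} {v : Module.End ℚ 𝔥} (hw : D.IsWord n w v)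
    (h0 : w (D.root j) (D.coroot i) = 0) : D.root i (v (D.coroot j)) = 0 := by
  induction hN : D.len w generalizing w v n with
  | zero =>
    have := hw.reduced
    rw [hN] at this
    cases this
    rw [Module.End.one_apply, D.root_coroot] at h0 ⊢
    exact_mod_cast (hA.zero_iff i j).1 (by exact_mod_cast h0)
  | succ N ih =>
    obtain ⟨w', v', k, hk, hw', rfl, rfl, hlen⟩ := hw.exists_eq_mul_r (by omega)
    have hpk := apply_root_mem_Qplus hA hw' hk (by omega)
    have hpj := (hw'.isRoot_apply (IsRoot.simple (D := D) (j := j))).mem_Qplus hA hj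
    have h1 := D.apply_coroot_nonpos_of_mem_Qplus hA hi hpk
    have h2 := D.apply_coroot_nonpos_of_mem_Qplus hA hi hpj
    have hkj : (A k j : ℚ) ≤ 0 := by
      exact_mod_cast hA.off_diag k j (by rintro rfl; exact hj hk)
    rw [Module.End.mul_apply, r_apply, map_sub, map_smul, LinearMap.sub_apply,
      LinearMap.smul_apply, D.root_coroot, smul_eq_mul] at h0
    -- Both summands are nonpositive, so they vanish.
    have h3 : 0 ≤ (A k j : ℚ) * w' (D.root k) (D.coroot i) := mul_nonneg_of_nonpos_of_nonpos hkj h1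
    have h4 : w' (D.root j) (D.coroot i) = 0 := by linarith
    have h5 : (A k j : ℚ) * w' (D.root k) (D.coroot i) = 0 := by linarith
    rw [Module.End.mul_apply, rv_apply, map_sub, map_smul, map_sub, map_smul, D.root_coroot,
      ih hw' h4 (by omega), smul_eq_mul, zero_sub, neg_eq_zero]
    rcases mul_eq_zero.1 h5 with h6 | h6
    · rw [(hA.zero_iff k j).1 (by exact_mod_cast h6), Int.cast_zero, zero_mul]
    · rw [(hw'.isRoot_apply (IsRoot.simple (D := D) (j := k))).root_apply_eq_zero_of_real hA hi hk
        hpk h6, mul_zero]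

/-- Orthogonality of a positive root to an imaginary simple root is symmetric. -/
theorem IsRoot.root_apply_eq_zero (hA : IsBorcherdsCartan A) (hi : A i i ≠ 2)
    {β : Module.Dual ℚ 𝔥} {h : 𝔥} (hβ : D.IsRoot j β h) (hp : β ∈ D.Qplus)
    (h0 : β (D.coroot i) = 0) : D.root i h = 0 := by
  by_cases hj : A j j = 2
  · exact hβ.root_apply_eq_zero_of_real hA hi hj hp h0
  · obtain ⟨n, w, v, hw, rfl, rfl⟩ := hβ.exists_isWord
    exact hw.root_apply_eq_zero hA hi hj h0

/-- An ascent between weights with the same value on `αᵢ^∨`, `i` imaginary, is invariant under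
translations by multiples of `αᵢ`. -/
theorem IsAscent.add_smul_root (hA : IsBorcherdsCartan A) (hi : A i i ≠ 2)
    {β : Module.Dual ℚ 𝔥} {h : 𝔥} (H : D.IsAscent j β h μ ν)
    (hμν : μ (D.coroot i) = ν (D.coroot i)) (c : ℚ) :
    (ν + c • D.root i) h = ν h ∧ D.IsAscent j β h (μ + c • D.root i) (ν + c • D.root i) := by
  have h1 := LinearMap.congr_fun H.sub_eq (D.coroot i)
  rw [LinearMap.sub_apply, hμν, sub_self, LinearMap.smul_apply, eq_comm, smul_eq_zero] at h1
  have h2 := H.1.root_apply_eq_zero hA hi H.2.1 (h1.resolve_left H.2.2.1.ne')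
  have h3 : (ν + c • D.root i) h = ν h := by
    rw [LinearMap.add_apply, LinearMap.smul_apply, h2, smul_zero, add_zero]
  refine ⟨h3, H.1, H.2.1, h3 ▸ H.2.2.1, ?_⟩
  rw [h3, H.2.2.2]
  module

theorem HasSeq.add_smul_root (hA : IsBorcherdsCartan A) (hi : A i i ≠ 2) {n : ℕ}
    (h : D.HasSeq n μ ν) (hμν : μ (D.coroot i) = ν (D.coroot i)) (c : ℚ) :
    D.HasSeq n (μ + c • D.root i) (ν + c • D.root i) := by
  induction n generalizing μ with
  | zero =>
    rw [hasSeq_zero.1 h]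
    exact hasSeq_zero.2 rfl
  | succ n ih =>
    obtain ⟨κ, ⟨j, β, g, h1⟩, h2⟩ := hasSeq_succ.1 h
    have h3 := h1.hasSeq.apply_coroot_le_of_imaginary hA hi
    have h4 := h2.apply_coroot_le_of_imaginary hA hi
    exact hasSeq_succ.2 ⟨κ + c • D.root i,
      ⟨j, β, g, (h1.add_smul_root hA hi (by linarith) c).2⟩, ih h2 (by linarith)⟩

/-! ### Steps of chains -/

theorem isDist_r (hA : IsBorcherdsCartan A) (hν : 0 < ν (D.coroot i)) :
    D.IsDist (D.r i ν) ν 1 := by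
  refine ⟨(isAscent_simple hν).hasSeq, fun n hn => ?_⟩
  by_cases hi : A i i = 2
  · obtain ⟨m, h1, h2⟩ := HasSeq.exists_nonneg hA hi hn
    rw [D.r_apply_coroot_self hi, D.r_r hi, if_pos (by linarith), if_neg (by linarith)] at h1
    rw [D.r_apply_coroot_self hi, if_neg (by linarith), if_pos (by linarith),
      h1.eq_zero_of_self] at h2
    omega
  · cases n with
    | zero => exact Nat.zero_le 1
    | succ n =>
      obtain ⟨κ, h1, j, β, h, h2⟩ := hasSeq_succ' hn
      -- The last root of the sequence is a multiple of `αᵢ`, hence `αᵢ` itself.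
      have hcoord : ∀ k, k ≠ i → D.coord k β = 0 := by
        intro k hk
        have h3 := h1.coord_le k
        have h4 := congrArg (D.coord k) h2.sub_eq
        rw [map_sub, map_smul, smul_eq_mul] at h4
        rw [r_apply, map_sub, map_smul, D.coord_root_ne hk.symm, smul_zero, sub_zero] at h3
        have h5 := D.coord_nonneg h2.2.1 k
        have h6 := mul_nonneg h2.2.2.1.le h5
        exact (mul_eq_zero.1 (by linarith : ν h * D.coord k β = 0)).resolve_left h2.2.2.1.ne'
      have hβi := D.eq_coord_smul_of_mem_Qplus h2.2.1 i hcoord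
      have hc := h2.1.coord_of_imaginary hi
      have hji : j = i := by
        by_contra hne
        rw [D.coord_root_ne hne] at hc
        rw [hc, zero_smul] at hβi
        exact h2.1.ne_zero hβi
      subst hji
      rw [hc, coord_root_self, one_smul] at hβi
      obtain ⟨N, w, v, hw, hw1, hw2⟩ := h2.1.exists_isWord
      have h3 : h = D.coroot j := by
        rw [hw2]
        exact hw.apply_coroot_eq hA hi (hw1.symm.trans hβi)
      have h4 : κ = D.r j ν := by rw [h2.2.2.2, h3, hβi, r_apply]
      rw [h4] at h1
      rw [h1.eq_zero_of_self]

theorem r_mem_orbit (hμ : μ ∈ D.orbit lam) (i : I) : D.r i μ ∈ D.orbit lam := by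
  obtain ⟨τ, hτ, rfl⟩ := hμ
  exact ⟨D.r i * τ, D.T.mul_mem (Submonoid.subset_closure ⟨i, rfl⟩) hτ, rfl⟩

theorem gt_r (hν : ν ∈ D.orbit lam) (h : 0 < ν (D.coroot i)) : D.Gt lam (D.r i ν) ν :=
  ⟨r_mem_orbit hν i, hν, 1, le_rfl, (isAscent_simple h).hasSeq⟩

theorem chainStep_r (hA : IsBorcherdsCartan A) (hν : ν ∈ D.orbit lam) (h : 0 < ν (D.coroot i))
    (ha : 0 < a) (hre : A i i = 2 → ∃ n : ℤ, a * ν (D.coroot i) = n)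
    (him : A i i ≠ 2 → a * ν (D.coroot i) = 1) : D.ChainStep lam a (D.r i ν) ν := by
  refine ⟨r_mem_orbit hν i, hν, isDist_r hA h, i, _, _, isAscent_simple h, fun hi => ?_, him⟩
  obtain ⟨n, hn⟩ := hre hi
  have h1 : 0 < n := by
    have := mul_pos ha h
    rw [hn] at this
    exact_mod_cast this
  obtain ⟨m, rfl⟩ := Int.eq_ofNat_of_zero_le h1.le
  exact ⟨m, by exact_mod_cast h1, by rw [hn]; rfl⟩

theorem ChainStep.smul_sub_mem (h : D.ChainStep lam a μ ν) : a • (ν - μ) ∈ D.Qplus := by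
  obtain ⟨-, -, -, j, β, g, h1, h2, h3⟩ := h
  rw [h1.sub_eq, smul_smul]
  by_cases hj : A j j = 2
  · obtain ⟨n, -, hn⟩ := h2 hj
    rw [hn]
    exact D.nsmul_mem_Qplus h1.2.1 n
  · rw [h3 hj, one_smul]
    exact h1.2.1

theorem ChainStep.hasSeq (h : D.ChainStep lam a μ ν) : D.HasSeq 1 μ ν := by
  obtain ⟨-, -, -, j, β, g, h1, -⟩ := h
  exact h1.hasSeq

theorem ChainStep.r_eq_of_neg (hA : IsBorcherdsCartan A) (hi : A i i = 2)
    (h : D.ChainStep lam a μ ν) (hμ : μ (D.coroot i) < 0) (hν : 0 ≤ ν (D.coroot i)) :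
    D.r i μ = ν := by
  obtain ⟨-, -, hd, j, β, g, h1, -⟩ := h
  rcases h1.eq_r_or hA hi with h2 | h2
  · rw [h2, D.r_r hi]
  · -- Otherwise `μ > rᵢ μ > rᵢ ν ≥ ν`.
    exfalso
    have h3 : 0 < D.r i μ (D.coroot i) := by
      rw [D.r_apply_coroot_self hi]
      linarith
    have h4 := (isAscent_simple h3).hasSeq.trans h2.hasSeq
    rw [D.r_r hi] at h4
    rcases hν.eq_or_lt with h5 | h5
    · rw [r_apply _ _ ν, ← h5, zero_smul, sub_zero] at h4
      exact absurd (hd.2 h4) (by norm_num)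
    · exact absurd (hd.2 (h4.trans (isAscent_simple h5).hasSeq)) (by norm_num)

theorem ChainStep.eq_r_of_pos (hA : IsBorcherdsCartan A) (hi : A i i = 2)
    (h : D.ChainStep lam a μ ν) (hμ : μ (D.coroot i) ≤ 0) (hν : 0 < ν (D.coroot i)) :
    μ = D.r i ν := by
  obtain ⟨-, -, hd, j, β, g, h1, -⟩ := h
  refine (h1.eq_r_or hA hi).resolve_right fun h2 => ?_
  -- Otherwise `μ ≥ rᵢ μ > rᵢ ν > ν`.
  have h4 := h2.hasSeq.trans (isAscent_simple hν).hasSeq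
  rcases hμ.eq_or_lt with h5 | h5
  · rw [r_apply _ _ μ, h5, zero_smul, sub_zero] at h4
    exact absurd (hd.2 h4) (by norm_num)
  · have h3 : 0 < D.r i μ (D.coroot i) := by
      rw [D.r_apply_coroot_self hi]
      linarith
    have h6 := (isAscent_simple h3).hasSeq
    rw [D.r_r hi] at h6
    exact absurd (hd.2 (h6.trans h4)) (by norm_num)

theorem ChainStep.int_of_eq_r (h : D.ChainStep lam a μ ν) (hμ : μ = D.r i ν) :
    ∃ n : ℤ, a * ν (D.coroot i) = n := by
  have h1 := h.smul_sub_mem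
  rw [hμ, r_apply, sub_sub_cancel, smul_smul] at h1
  obtain ⟨n, hn⟩ := D.coord_of_mem_Qplus h1 i
  rw [map_smul, coord_root_self, smul_eq_mul, mul_one] at hn
  exact ⟨n, by rw [hn]; rfl⟩

/-- A simple real reflection maps a step between weights of the same sign to a step. -/
theorem ChainStep.r_r (hA : IsBorcherdsCartan A) (hi : A i i = 2) (h : D.ChainStep lam a μ ν)
    (hs : (0 < μ (D.coroot i) ∧ 0 < ν (D.coroot i)) ∨
      (μ (D.coroot i) < 0 ∧ ν (D.coroot i) < 0)) :
    D.ChainStep lam a (D.r i μ) (D.r i ν) := by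
  obtain ⟨hμo, hνo, hd, j, β, g, h1, h2⟩ := h
  have h3 : D.IsAscent j (D.r i β) (D.rv i g) (D.r i μ) (D.r i ν) := by
    refine (h1.eq_r_or hA hi).resolve_left fun h3 => ?_
    rw [h3, D.r_apply_coroot_self hi] at hs
    rcases hs with h4 | h4 <;> linarith
  refine ⟨r_mem_orbit hμo i, r_mem_orbit hνo i, ⟨h3.hasSeq, fun n hn => ?_⟩, j, _, _, h3, ?_⟩
  · rcases hs with ⟨h4, h5⟩ | ⟨h4, h5⟩
    · obtain ⟨m, h6, h7⟩ := HasSeq.exists_nonneg hA hi hn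
      simp only [D.r_apply_coroot_self hi, D.r_r hi, Left.neg_neg_iff, h4, h5, if_true] at h6 h7
      have := hd.2 h6
      omega
    · obtain ⟨m, h6, h7⟩ := HasSeq.exists_nonpos hA hi hn
      simp only [D.r_apply_coroot_self hi, D.r_r hi, Left.neg_pos_iff, h4, h5, if_true] at h6 h7
      have := hd.2 h6
      omega
  · rw [D.r_apply_rv hi]
    exact h2

theorem ChainStep.r_r_of_imaginary (hA : IsBorcherdsCartan A) (hi : A i i ≠ 2)
    (h : D.ChainStep lam a μ ν) (hμν : μ (D.coroot i) = ν (D.coroot i)) :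
    D.ChainStep lam a (D.r i μ) (D.r i ν) := by
  obtain ⟨hμo, hνo, hd, j, β, g, h1, h2⟩ := h
  have hμ : D.r i μ = μ + (-ν (D.coroot i)) • D.root i := by
    rw [r_apply, hμν]
    module
  have hν : D.r i ν = ν + (-ν (D.coroot i)) • D.root i := by
    rw [r_apply]
    module
  obtain ⟨h3, h4⟩ := h1.add_smul_root hA hi hμν (-ν (D.coroot i))
  refine ⟨r_mem_orbit hμo i, r_mem_orbit hνo i, ⟨?_, fun n hn => ?_⟩, j, β, g, ?_, ?_⟩
  · rw [hμ, hν]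
    exact h4.hasSeq
  · refine hd.2 ?_
    have h5 := hn.add_smul_root hA hi (by rw [r_apply_coroot, r_apply_coroot, hμν])
      (ν (D.coroot i))
    rwa [hμ, hν, add_assoc, ← add_smul, neg_add_cancel, zero_smul, add_zero, add_assoc,
      ← add_smul, neg_add_cancel, zero_smul, add_zero] at h5
  · rwa [hμ, hν]
  · rwa [hν, h3]

/-! ### Chains -/

variable (D lam a) in
/-- There is an `a`-chain for the pair, or its members are equal. -/
abbrev WeakChain : Module.Dual ℚ 𝔥 → Module.Dual ℚ 𝔥 → Prop :=
  Relation.ReflTransGen (D.ChainStep lam a)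

theorem weakChain_of_seq {n : ℕ} {κ : ℕ → Module.Dual ℚ 𝔥}
    (h : ∀ k < n, D.ChainStep lam a (κ k) (κ (k + 1))) : D.WeakChain lam a (κ 0) (κ n) := by
  induction n with
  | zero => exact Relation.ReflTransGen.refl
  | succ n ih => exact (ih fun k hk => h k (by omega)).tail (h n (by omega))

theorem HasChain.weakChain (h : D.HasChain lam a μ ν) : D.WeakChain lam a μ ν := by
  obtain ⟨-, -, -, n, -, κ, rfl, rfl, h1⟩ := h
  exact weakChain_of_seq h1

theorem WeakChain.exists_seq (h : D.WeakChain lam a μ ν) :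
    ∃ n, D.HasSeq n μ ν ∧ ∃ κ : ℕ → Module.Dual ℚ 𝔥, κ 0 = μ ∧ κ n = ν ∧
      ∀ k < n, D.ChainStep lam a (κ k) (κ (k + 1)) := by
  induction h using Relation.ReflTransGen.head_induction_on with
  | refl => exact ⟨0, hasSeq_zero.2 rfl, fun _ => ν, rfl, rfl, fun k hk => absurd hk k.not_lt_zero⟩
  | @head μ _ h1 _ ih =>
    obtain ⟨n, hs, κ, rfl, hκ, hk⟩ := ih
    refine ⟨1 + n, h1.hasSeq.trans hs, fun k => Nat.casesOn k μ κ, rfl, ?_, fun k h => ?_⟩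
    · rw [add_comm]
      exact hκ
    · cases k with
      | zero => exact h1
      | succ k => exact hk k (by omega)

theorem WeakChain.mem_orbit (h : D.WeakChain lam a μ ν) (hne : μ ≠ ν) :
    μ ∈ D.orbit lam ∧ ν ∈ D.orbit lam := by
  constructor
  · obtain ⟨κ, h1, -⟩ := (Relation.ReflTransGen.cases_head h).resolve_left hne
    exact h1.1
  · obtain ⟨κ, -, h1⟩ := (Relation.ReflTransGen.cases_tail h).resolve_left hne.symm
    exact h1.2.1

theorem WeakChain.gt (h : D.WeakChain lam a μ ν) (hne : μ ≠ ν) : D.Gt lam μ ν := by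
  obtain ⟨n, hs, -⟩ := WeakChain.exists_seq h
  refine ⟨(WeakChain.mem_orbit h hne).1, (WeakChain.mem_orbit h hne).2, n, ?_, hs⟩
  rcases n.eq_zero_or_pos with rfl | h1
  · exact absurd (hasSeq_zero.1 hs) hne
  · exact h1

theorem WeakChain.hasChain (h : D.WeakChain lam a μ ν) (hne : μ ≠ ν) (h0 : 0 < a) (h1 : a ≤ 1) :
    D.HasChain lam a μ ν := by
  obtain ⟨n, hs, hκ⟩ := WeakChain.exists_seq h
  refine ⟨h0, h1, WeakChain.gt h hne, n, ?_, hκ⟩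
  rcases n.eq_zero_or_pos with rfl | h1
  · exact absurd (hasSeq_zero.1 hs) hne
  · exact h1

theorem WeakChain.smul_sub_mem (h : D.WeakChain lam a μ ν) : a • (ν - μ) ∈ D.Qplus := by
  induction h with
  | refl => simp
  | @tail κ ν _ h1 ih =>
    rw [← sub_add_sub_cancel ν κ μ, smul_add]
    exact D.Qplus.add_mem h1.smul_sub_mem ih

theorem WeakChain.int_sub (h : D.WeakChain lam a μ ν) (i : I) :
    ∃ n : ℤ, a * ν (D.coroot i) = a * μ (D.coroot i) + n := by
  obtain ⟨n, hn⟩ := D.int_of_mem_Qplus (WeakChain.smul_sub_mem h) i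
  refine ⟨n, ?_⟩
  rw [← hn, LinearMap.smul_apply, LinearMap.sub_apply, smul_eq_mul]
  ring

theorem WeakChain.le_of_imaginary (hA : IsBorcherdsCartan A) (hi : A i i ≠ 2)
    (h : D.WeakChain lam a μ ν) : ν (D.coroot i) ≤ μ (D.coroot i) := by
  obtain ⟨n, hs, -⟩ := WeakChain.exists_seq h
  exact hs.apply_coroot_le_of_imaginary hA hi

theorem WeakChain.r_left (hA : IsBorcherdsCartan A) (hi : A i i = 2)
    (h : D.WeakChain lam a μ ν) (hμ : μ (D.coroot i) < 0) (hν : 0 ≤ ν (D.coroot i)) :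
    D.WeakChain lam a (D.r i μ) ν := by
  induction h using Relation.ReflTransGen.head_induction_on with
  | refl => linarith
  | @head μ κ h1 h2 ih =>
    by_cases hκ : κ (D.coroot i) < 0
    · exact (ih hκ).head (h1.r_r hA hi (Or.inr ⟨hμ, hκ⟩))
    · rwa [h1.r_eq_of_neg hA hi hμ (not_lt.1 hκ)]

theorem WeakChain.r_right (hA : IsBorcherdsCartan A) (hi : A i i = 2)
    (h : D.WeakChain lam a μ ν) (hμ : μ (D.coroot i) ≤ 0) (hν : 0 < ν (D.coroot i)) :
    D.WeakChain lam a μ (D.r i ν) := by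
  induction h with
  | refl => linarith
  | @tail κ ν h2 h1 ih =>
    by_cases hκ : 0 < κ (D.coroot i)
    · exact (ih hκ).tail (h1.r_r hA hi (Or.inl ⟨hκ, hν⟩))
    · rwa [← h1.eq_r_of_pos hA hi (not_lt.1 hκ) hν]

theorem WeakChain.int_of_neg (hA : IsBorcherdsCartan A) (hi : A i i = 2)
    (h : D.WeakChain lam a μ ν) (hμ : μ (D.coroot i) < 0) (hν : 0 ≤ ν (D.coroot i)) :
    ∃ n : ℤ, a * μ (D.coroot i) = n := by
  induction h using Relation.ReflTransGen.head_induction_on with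
  | refl => linarith
  | @head μ κ h1 h2 ih =>
    obtain ⟨m, hm⟩ := WeakChain.int_sub (Relation.ReflTransGen.single h1) i
    have hκ : ∃ n : ℤ, a * κ (D.coroot i) = n := by
      by_cases hκ : κ (D.coroot i) < 0
      · exact ih hκ
      · refine h1.int_of_eq_r ?_
        rw [← h1.r_eq_of_neg hA hi hμ (not_lt.1 hκ), D.r_r hi]
    obtain ⟨n, hn⟩ := hκ
    exact ⟨n - m, by push_cast; linarith⟩

theorem WeakChain.int_of_pos (hA : IsBorcherdsCartan A) (hi : A i i = 2)
    (h : D.WeakChain lam a μ ν) (hμ : μ (D.coroot i) ≤ 0) (hν : 0 < ν (D.coroot i)) :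
    ∃ n : ℤ, a * ν (D.coroot i) = n := by
  induction h with
  | refl => linarith
  | @tail κ ν h2 h1 ih =>
    by_cases hκ : 0 < κ (D.coroot i)
    · obtain ⟨m, hm⟩ := WeakChain.int_sub (Relation.ReflTransGen.single h1) i
      obtain ⟨n, hn⟩ := ih hκ
      exact ⟨n + m, by push_cast; linarith⟩
    · exact h1.int_of_eq_r (h1.eq_r_of_pos hA hi (not_lt.1 hκ) hν)

theorem WeakChain.r_r_of_pos (hA : IsBorcherdsCartan A) (hi : A i i = 2)
    (h : D.WeakChain lam a μ ν) (hν : 0 < ν (D.coroot i))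
    (hint : ¬ ∃ n : ℤ, a * ν (D.coroot i) = n) : D.WeakChain lam a (D.r i μ) (D.r i ν) := by
  induction h with
  | refl => exact Relation.ReflTransGen.refl
  | @tail κ ν h2 h1 ih =>
    have hκ : 0 < κ (D.coroot i) := by
      by_contra hκ
      exact hint (h1.int_of_eq_r (h1.eq_r_of_pos hA hi (not_lt.1 hκ) hν))
    refine (ih hκ ?_).tail (h1.r_r hA hi (Or.inl ⟨hκ, hν⟩))
    rintro ⟨n, hn⟩
    obtain ⟨m, hm⟩ := WeakChain.int_sub (Relation.ReflTransGen.single h1) i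
    exact hint ⟨n + m, by push_cast; linarith⟩

theorem WeakChain.r_r_of_neg (hA : IsBorcherdsCartan A) (hi : A i i = 2)
    (h : D.WeakChain lam a μ ν) (hμ : μ (D.coroot i) < 0)
    (hint : ¬ ∃ n : ℤ, a * μ (D.coroot i) = n) : D.WeakChain lam a (D.r i μ) (D.r i ν) := by
  induction h using Relation.ReflTransGen.head_induction_on with
  | refl => exact Relation.ReflTransGen.refl
  | @head μ κ h1 h2 ih =>
    have hκ : κ (D.coroot i) < 0 := by
      by_contra hκ
      exact hint (WeakChain.int_of_neg hA hi (Relation.ReflTransGen.single h1) hμ (not_lt.1 hκ))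
    refine (ih hκ ?_).head (h1.r_r hA hi (Or.inr ⟨hμ, hκ⟩))
    rintro ⟨n, hn⟩
    obtain ⟨m, hm⟩ := WeakChain.int_sub (Relation.ReflTransGen.single h1) i
    exact hint ⟨n - m, by push_cast; linarith⟩

theorem WeakChain.r_r_of_imaginary (hA : IsBorcherdsCartan A) (hi : A i i ≠ 2)
    (h : D.WeakChain lam a μ ν) (hμν : μ (D.coroot i) = ν (D.coroot i)) :
    D.WeakChain lam a (D.r i μ) (D.r i ν) := by
  induction h using Relation.ReflTransGen.head_induction_on with
  | refl => exact Relation.ReflTransGen.refl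
  | @head μ κ h1 h2 ih =>
    have h3 := h1.hasSeq.apply_coroot_le_of_imaginary hA hi
    have h4 := WeakChain.le_of_imaginary hA hi h2
    exact (ih (by linarith)).head (h1.r_r_of_imaginary hA hi (by linarith))

end Chains

end Realization

end GLS

namespace GLS

/-! ### Piecewise linear functions -/

/-- The piecewise linear function on the rational line that vanishes at `a 0` and has slope `c j`
between `a (j - 1)` and `a j`, `1 ≤ j ≤ s`: the scalar version of `linePath`. -/
def lineFun (s : ℕ) (c a : ℕ → ℚ) (t : ℚ) : ℚ :=
  ∑ j ∈ Finset.Icc 1 s, (min t (a j) - min t (a (j - 1))) * c j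

theorem linePath_apply {𝔥 : Type*} [AddCommGroup 𝔥] [Module ℚ 𝔥] (s : ℕ)
    (L : ℕ → Module.Dual ℚ 𝔥) (a : ℕ → ℚ) (t : UnitQ) (h : 𝔥) :
    linePath s L a t h = lineFun s (fun j => L j h) a t := by
  simp only [linePath, lineFun, LinearMap.sum_apply, LinearMap.smul_apply, smul_eq_mul]

theorem le_of_le_of_step {s : ℕ} {a : ℕ → ℚ} (ha : ∀ j < s, a j ≤ a (j + 1)) {m n : ℕ}
    (hmn : m ≤ n) (hn : n ≤ s) : a m ≤ a n := by
  induction n, hmn using Nat.le_induction with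
  | base => exact le_rfl
  | succ n _ ih => exact (ih (by omega)).trans (ha n (by omega))

theorem lineFun_sub {s : ℕ} {a : ℕ → ℚ} (ha : ∀ j < s, a j ≤ a (j + 1)) (c : ℕ → ℚ) {j : ℕ}
    (hj : 1 ≤ j) (hjs : j ≤ s) {t u : ℚ} (ht : a (j - 1) ≤ t) (ht' : t ≤ a j)
    (hu : a (j - 1) ≤ u) (hu' : u ≤ a j) :
    lineFun s c a t = lineFun s c a u + (t - u) * c j := by
  have h1 : lineFun s c a t - lineFun s c a u = (t - u) * c j := by
    rw [lineFun, lineFun, ← Finset.sum_sub_distrib, Finset.sum_eq_single_of_mem j]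
    · rw [min_eq_left ht', min_eq_right ht, min_eq_left hu', min_eq_right hu]
      ring
    · exact Finset.mem_Icc.2 ⟨hj, hjs⟩
    · intro k hk hkj
      rw [Finset.mem_Icc] at hk
      rcases lt_or_gt_of_ne hkj with h | h
      · have h1 : a k ≤ a (j - 1) := le_of_le_of_step ha (by omega) (by omega)
        have h2 : a (k - 1) ≤ a (j - 1) := le_of_le_of_step ha (by omega) (by omega)
        rw [min_eq_right (h1.trans ht), min_eq_right (h2.trans ht), min_eq_right (h1.trans hu),
          min_eq_right (h2.trans hu)]
        ring
      · have h1 : a j ≤ a k := le_of_le_of_step ha (by omega) (by omega)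
        have h2 : a j ≤ a (k - 1) := le_of_le_of_step ha (by omega) (by omega)
        rw [min_eq_left (ht'.trans h1), min_eq_left (ht'.trans h2), min_eq_left (hu'.trans h1),
          min_eq_left (hu'.trans h2)]
        ring
  linarith

/-- Breakpoints `0 = a₀ < ⋯ < aₛ = 1` and slopes `c₁, …, cₛ` for which the piecewise linear
function has an integral value at `1` and wherever its slope changes from negative to nonnegative
or from nonpositive to positive. -/
structure IsIntegralLine (s : ℕ) (c a : ℕ → ℚ) : Prop where
  a_zero : a 0 = 0
  a_last : a s = 1
  a_lt : ∀ j < s, a j < a (j + 1)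
  int_of_change : ∀ j, 1 ≤ j → j < s → (c j < 0 ∧ 0 ≤ c (j + 1)) ∨ (c j ≤ 0 ∧ 0 < c (j + 1)) →
    ∃ n : ℤ, lineFun s c a (a j) = n
  int_last : ∃ n : ℤ, lineFun s c a 1 = n

namespace IsIntegralLine

variable {s : ℕ} {c a : ℕ → ℚ}

theorem a_le (H : IsIntegralLine s c a) : ∀ j < s, a j ≤ a (j + 1) := fun j hj => (H.a_lt j hj).le

theorem lineFun_zero (H : IsIntegralLine s c a) : lineFun s c a 0 = 0 := by
  refine Finset.sum_eq_zero fun j hj => ?_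
  rw [Finset.mem_Icc] at hj
  have h1 : 0 ≤ a j := H.a_zero ▸ le_of_le_of_step H.a_le j.zero_le hj.2
  have h2 : 0 ≤ a (j - 1) := H.a_zero ▸ le_of_le_of_step H.a_le (j - 1).zero_le (by omega)
  rw [min_eq_left h1, min_eq_left h2, sub_self, zero_mul]

theorem a_pred_lt (H : IsIntegralLine s c a) {j : ℕ} (hj : 1 ≤ j) (hjs : j ≤ s) :
    a (j - 1) < a j := by
  have := H.a_lt (j - 1) (by omega)
  rwa [Nat.sub_add_cancel hj] at this

theorem lineFun_eq (H : IsIntegralLine s c a) {j : ℕ} (hj : 1 ≤ j) (hjs : j ≤ s) {t : ℚ}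
    (ht : a (j - 1) ≤ t) (ht' : t ≤ a j) :
    lineFun s c a t = lineFun s c a (a (j - 1)) + (t - a (j - 1)) * c j :=
  lineFun_sub H.a_le c hj hjs ht ht' le_rfl (H.a_pred_lt hj hjs).le

theorem exists_left_open (H : IsIntegralLine s c a) {k : ℕ} (hk : k ≤ s) {t : ℚ}
    (hkt : a k < t) (ht : t ≤ 1) : ∃ j, k < j ∧ j ≤ s ∧ a (j - 1) < t ∧ t ≤ a j := by
  have hks : k < s := by
    refine hk.lt_of_ne ?_
    rintro rfl
    rw [H.a_last] at hkt
    linarith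
  have hex : ∃ j, k < j ∧ t ≤ a j := ⟨s, hks, by rwa [H.a_last]⟩
  classical
  refine ⟨Nat.find hex, (Nat.find_spec hex).1, Nat.find_min' hex ⟨hks, by rwa [H.a_last]⟩, ?_,
    (Nat.find_spec hex).2⟩
  by_contra hcon
  have h1 := (Nat.find_spec hex).1
  by_cases h2 : Nat.find hex - 1 = k
  · rw [h2] at hcon
    exact hcon hkt
  · exact Nat.find_min hex (m := Nat.find hex - 1) (by omega) ⟨by omega, not_lt.1 hcon⟩

theorem exists_right_open (H : IsIntegralLine s c a) {k : ℕ} {t : ℚ} (h0 : 0 ≤ t)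
    (hkt : t < a k) : ∃ j, 1 ≤ j ∧ j ≤ k ∧ a (j - 1) ≤ t ∧ t < a j := by
  have hex : ∃ j, t < a j := ⟨k, hkt⟩
  classical
  have h1 : Nat.find hex ≠ 0 := by
    intro h
    have h2 := Nat.find_spec hex
    rw [h, H.a_zero] at h2
    linarith
  exact ⟨Nat.find hex, by omega, Nat.find_min' hex hkt,
    not_lt.1 (Nat.find_min hex (m := Nat.find hex - 1) (by omega)), Nat.find_spec hex⟩

/-- The minimum is an integer, and it is first and last attained at breakpoints. -/
theorem exists_min (H : IsIntegralLine s c a) :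
    ∃ m : ℤ, ∃ k t : ℕ, k ≤ s ∧ t ≤ s ∧ lineFun s c a (a k) = m ∧ lineFun s c a (a t) = m ∧
      (∀ x, 0 ≤ x → x ≤ 1 → (m : ℚ) ≤ lineFun s c a x) ∧
      (∀ x, 0 ≤ x → x < a k → (m : ℚ) < lineFun s c a x) ∧
      (∀ x, a t < x → x ≤ 1 → (m : ℚ) < lineFun s c a x) := by
  classical
  obtain ⟨k₀, hk₀, hmin₀⟩ := Finset.exists_min_image (Finset.range (s + 1))
    (fun j => lineFun s c a (a j)) ⟨0, Finset.mem_range.2 (Nat.succ_pos s)⟩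
  have hk₀' : k₀ ≤ s := by
    rw [Finset.mem_range] at hk₀
    omega
  set M := lineFun s c a (a k₀) with hM
  have hminM : ∀ j ≤ s, M ≤ lineFun s c a (a j) := fun j hj =>
    hmin₀ j (Finset.mem_range.2 (by omega))
  have hex : ∃ j, lineFun s c a (a j) = M := ⟨k₀, rfl⟩
  set k := Nat.find hex with hk
  have hkM : lineFun s c a (a k) = M := Nat.find_spec hex
  have hks : k ≤ s := (Nat.find_min' hex hM.symm).trans hk₀'
  have hkmin : ∀ j < k, M < lineFun s c a (a j) := fun j hj =>
    (hminM j (by omega)).lt_of_ne fun h => Nat.find_min hex hj h.symm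
  set t := Nat.findGreatest (fun j => lineFun s c a (a j) = M) s with ht
  have htM : lineFun s c a (a t) = M :=
    Nat.findGreatest_spec (P := fun j => lineFun s c a (a j) = M) hk₀' hM.symm
  have hts : t ≤ s := Nat.findGreatest_le s
  have htmax : ∀ j, t < j → j ≤ s → M < lineFun s c a (a j) := fun j hj hjs =>
    (hminM j hjs).lt_of_ne fun h => Nat.findGreatest_is_greatest hj hjs h.symm
  have hint : ∃ m : ℤ, M = m := by
    rcases k.eq_zero_or_pos with h0 | h0
    · refine ⟨0, ?_⟩
      rw [← hkM, h0, H.a_zero, H.lineFun_zero, Int.cast_zero]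
    · rcases hks.eq_or_lt with h1 | h1
      · obtain ⟨n, hn⟩ := H.int_last
        exact ⟨n, by rw [← hkM, h1, H.a_last, hn]⟩
      · have h2 := H.a_pred_lt h0 hks
        have h3 := H.lineFun_eq h0 hks h2.le le_rfl
        have h4 := H.a_lt k h1
        have h5 := H.lineFun_eq (j := k + 1) (by omega) (by omega) h4.le le_rfl
        rw [Nat.add_sub_cancel] at h5
        have h6 := hkmin (k - 1) (by omega)
        have h7 := hminM (k + 1) (by omega)
        obtain ⟨n, hn⟩ := H.int_of_change k h0 h1 (Or.inl
          ⟨by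
            by_contra hcon
            have := mul_nonneg (sub_nonneg.2 h2.le) (not_lt.1 hcon)
            linarith,
          by
            by_contra hcon
            have := mul_neg_of_pos_of_neg (sub_pos.2 h4) (not_le.1 hcon)
            linarith⟩)
        exact ⟨n, by rw [← hkM, hn]⟩
  obtain ⟨m, hm⟩ := hint
  have hright : ∀ x, a t < x → x ≤ 1 → M < lineFun s c a x := by
    intro x hx hx1
    obtain ⟨j, h1, h2, h3, h4⟩ := H.exists_left_open hts hx hx1
    have h5 := H.lineFun_eq (by omega) h2 h3.le h4
    have h6 := H.lineFun_eq (by omega) h2 (H.a_pred_lt (by omega) h2).le le_rfl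
    have h7 := hminM (j - 1) (by omega)
    have h8 := htmax j h1 h2
    rcases lt_or_ge 0 (c j) with h9 | h9
    · have := mul_pos (sub_pos.2 h3) h9
      linarith
    · have := mul_nonneg_of_nonpos_of_nonpos (sub_nonpos.2 h4) h9
      linarith
  have hleft : ∀ x, 0 ≤ x → x < a k → M < lineFun s c a x := by
    intro x hx hx1
    obtain ⟨j, h1, h2, h3, h4⟩ := H.exists_right_open hx hx1
    have h5 := H.lineFun_eq h1 (by omega) h3 h4.le
    have h6 := H.lineFun_eq h1 (by omega) (H.a_pred_lt h1 (by omega)).le le_rfl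
    have h7 := hkmin (j - 1) (by omega)
    have h8 := hminM j (by omega)
    rcases lt_or_ge (c j) 0 with h9 | h9
    · have := mul_pos_of_neg_of_neg (sub_neg.2 h4) h9
      linarith
    · have := mul_nonneg (sub_nonneg.2 h3) h9
      linarith
  refine ⟨m, k, t, hks, hts, hkM.trans hm, htM.trans hm, ?_, hm ▸ hleft, hm ▸ hright⟩
  intro x hx hx1
  rw [← hm]
  rcases hx.eq_or_lt with rfl | hx0
  · have := hminM 0 s.zero_le
    rwa [H.a_zero] at this
  obtain ⟨j, h1, h2, h3, h4⟩ := H.exists_left_open (k := 0) s.zero_le (by rwa [H.a_zero]) hx1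
  have h5 := H.lineFun_eq h1 h2 h3.le h4
  have h6 := H.lineFun_eq h1 h2 (H.a_pred_lt h1 h2).le le_rfl
  have h7 := hminM (j - 1) (by omega)
  have h8 := hminM j h2
  rcases le_total 0 (c j) with h9 | h9
  · have := mul_nonneg (sub_nonneg.2 h3.le) h9
    linarith
  · have := mul_nonneg_of_nonpos_of_nonpos (sub_nonpos.2 h4) h9
    linarith

/-- After the last minimum `aₜ`, the function increases strictly until it first takes the value
`m + 1`: at a change of slope in between it would have an integral value. -/
theorem exists_next (H : IsIntegralLine s c a) {m : ℤ} {t : ℕ} (hts : t < s)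
    (hm : lineFun s c a (a t) = m) (hlt : ∀ x, a t < x → x ≤ 1 → (m : ℚ) < lineFun s c a x)
    (hle : ∀ x, 0 ≤ x → x ≤ 1 → (m : ℚ) ≤ lineFun s c a x) :
    ∃ (p : ℕ) (x : ℚ), t < p ∧ p ≤ s ∧ a (p - 1) < x ∧ x ≤ a p ∧ lineFun s c a x = m + 1 ∧
      (∀ y, a t ≤ y → y < x → lineFun s c a y < m + 1) ∧ (∀ j, t < j → j ≤ p → 0 < c j) ∧
      (1 ≤ t → c t ≤ 0) ∧ ∀ j, t < j → j < p → ¬ ∃ n : ℤ, lineFun s c a (a j) = n := by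
  classical
  have hmono : ∀ {j l : ℕ}, j ≤ l → l ≤ s → a j ≤ a l := fun h1 h2 =>
    le_of_le_of_step H.a_le h1 h2
  have hlast : ∀ {j : ℕ}, j ≤ s → a j ≤ 1 := fun h => H.a_last ▸ hmono h le_rfl
  have hfirst : ∀ {j : ℕ}, j ≤ s → 0 ≤ a j := fun h => H.a_zero ▸ hmono (Nat.zero_le _) h
  have hstep : ∀ {j : ℕ}, t < j → j ≤ s → a t < a j := fun {j} h1 h2 =>
    (H.a_lt t (by omega)).trans_le (hmono h1 h2)
  have hex : ∃ p, t < p ∧ (m : ℚ) + 1 ≤ lineFun s c a (a p) := by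
    refine ⟨s, hts, ?_⟩
    obtain ⟨n, hn⟩ := H.int_last
    have h1 := hlt 1 (H.a_last ▸ hstep hts le_rfl) le_rfl
    rw [H.a_last, hn]
    rw [hn] at h1
    have h2 : m < n := by exact_mod_cast h1
    exact_mod_cast h2
  set p := Nat.find hex with hp
  obtain ⟨htp, hpm⟩ : t < p ∧ (m : ℚ) + 1 ≤ lineFun s c a (a p) := Nat.find_spec hex
  have hbelow : ∀ j, t < j → j < p → lineFun s c a (a j) < m + 1 := fun j h1 h2 => by
    by_contra hcon
    exact Nat.find_min hex h2 ⟨h1, not_lt.1 hcon⟩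
  have hps : p ≤ s := by
    by_contra hcon
    have h1 := hbelow s hts (by omega)
    obtain ⟨n, hn⟩ := H.int_last
    have h2 := hlt 1 (H.a_last ▸ hstep hts le_rfl) le_rfl
    rw [H.a_last, hn] at h1
    rw [hn] at h2
    have h3 : n < m + 1 := by exact_mod_cast h1
    have h4 : m < n := by exact_mod_cast h2
    omega
  have hbelow' : ∀ j, t ≤ j → j < p → lineFun s c a (a j) < m + 1 := fun j h1 h2 => by
    rcases h1.eq_or_lt with rfl | h1
    · rw [hm]
      linarith
    · exact hbelow j h1 h2
  have hnotint : ∀ j, t < j → j < p → ¬ ∃ n : ℤ, lineFun s c a (a j) = n := by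
    rintro j h1 h2 ⟨n, hn⟩
    have h3 := hbelow j h1 h2
    have h4 := hlt (a j) (hstep h1 (by omega)) (hlast (by omega))
    rw [hn] at h3 h4
    have h5 : n < m + 1 := by exact_mod_cast h3
    have h6 : m < n := by exact_mod_cast h4
    omega
  have hap := H.a_pred_lt (j := p) (by omega) hps
  have hpeq := H.lineFun_eq (j := p) (by omega) hps hap.le le_rfl
  have hpred := hbelow' (p - 1) (by omega) (by omega)
  have hcp : 0 < c p := by
    by_contra hcon
    have := mul_nonpos_of_nonneg_of_nonpos (sub_nonneg.2 hap.le) (not_lt.1 hcon)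
    linarith
  set x := a (p - 1) + (m + 1 - lineFun s c a (a (p - 1))) / c p with hx
  have hx1 : a (p - 1) < x := by
    have := div_pos (sub_pos.2 hpred) hcp
    linarith
  have hx2 : x ≤ a p := by
    have : (m + 1 - lineFun s c a (a (p - 1))) / c p ≤ a p - a (p - 1) := by
      rw [div_le_iff₀ hcp]
      linarith
    linarith
  have hx3 : lineFun s c a x = m + 1 := by
    rw [H.lineFun_eq (by omega) hps hx1.le hx2, hx, add_sub_cancel_left, div_mul_cancel₀ _ hcp.ne']
    ring
  refine ⟨p, x, htp, hps, hx1, hx2, hx3, ?_, ?_, ?_, hnotint⟩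
  · intro y hy1 hy2
    rcases hy1.eq_or_lt with rfl | hy1
    · rw [hm]
      linarith
    obtain ⟨j, h1, h2, h3, h4⟩ := H.exists_left_open hts.le hy1
      (hy2.le.trans (hx2.trans (hlast hps)))
    have h5 := H.lineFun_eq (by omega) h2 h3.le h4
    have h6 := H.lineFun_eq (by omega) h2 (H.a_pred_lt (by omega) h2).le le_rfl
    have hjp : j ≤ p := by
      by_contra hcon
      have := hmono (show p ≤ j - 1 by omega) (by omega)
      linarith
    rcases hjp.eq_or_lt with rfl | hjp
    · have h7 := H.lineFun_eq (by omega) h2 hx1.le hx2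
      have := mul_pos (sub_pos.2 hy2) hcp
      linarith
    · have h7 := hbelow' (j - 1) (by omega) (by omega)
      have h8 := hbelow' j h1.le hjp
      rcases le_total 0 (c j) with h9 | h9
      · have := mul_nonneg (sub_nonneg.2 h4) h9
        linarith
      · have := mul_nonpos_of_nonneg_of_nonpos (sub_nonneg.2 h3.le) h9
        linarith
  · have key : ∀ d j, t < j → j + d = p → 0 < c j := by
      intro d
      induction d with
      | zero =>
        rintro j - h2
        rwa [show j = p from h2]
      | succ d ih =>
        intro j h1 h2
        by_contra hcon
        exact hnotint j h1 (by omega) (H.int_of_change j (by omega) (by omega)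
          (Or.inr ⟨not_lt.1 hcon, ih (j + 1) (by omega) (by omega)⟩))
    exact fun j h1 h2 => key (p - j) j h1 (by omega)
  · intro ht1
    have h1 := H.a_pred_lt ht1 hts.le
    have h2 := H.lineFun_eq ht1 hts.le h1.le le_rfl
    have h3 := hle (a (t - 1)) (hfirst (by omega)) (hlast (by omega))
    by_contra hcon
    have := mul_pos (sub_pos.2 h1) (not_le.1 hcon)
    linarith

/-- Before the first minimum `aₖ`, the function decreases strictly since it last took the value
`m + 1`. -/
theorem exists_prev (H : IsIntegralLine s c a) {m : ℤ} {k : ℕ} (hk : 1 ≤ k) (hks : k ≤ s)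
    (hm : lineFun s c a (a k) = m) (hlt : ∀ x, 0 ≤ x → x < a k → (m : ℚ) < lineFun s c a x)
    (hle : ∀ x, 0 ≤ x → x ≤ 1 → (m : ℚ) ≤ lineFun s c a x) :
    ∃ (q : ℕ) (x : ℚ), 1 ≤ q ∧ q ≤ k ∧ a (q - 1) ≤ x ∧ x < a q ∧ lineFun s c a x = m + 1 ∧
      (∀ y, x < y → y ≤ a k → lineFun s c a y < m + 1) ∧ (∀ j, q ≤ j → j ≤ k → c j < 0) ∧
      (k < s → 0 ≤ c (k + 1)) ∧
      ∀ j, q ≤ j → j < k → ¬ ∃ n : ℤ, lineFun s c a (a j) = n := by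
  classical
  have hmono : ∀ {j l : ℕ}, j ≤ l → l ≤ s → a j ≤ a l := fun h1 h2 =>
    le_of_le_of_step H.a_le h1 h2
  have hlast : ∀ {j : ℕ}, j ≤ s → a j ≤ 1 := fun h => H.a_last ▸ hmono h le_rfl
  have hfirst : ∀ {j : ℕ}, j ≤ s → 0 ≤ a j := fun h => H.a_zero ▸ hmono (Nat.zero_le _) h
  have hstep : ∀ {j : ℕ}, j < k → a j < a k := fun {j} h1 =>
    (H.a_lt j (by omega)).trans_le (hmono h1 hks)
  have h0 : (m : ℚ) + 1 ≤ lineFun s c a (a 0) := by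
    have h1 := hlt (a 0) (hfirst (Nat.zero_le s)) (hstep hk)
    rw [H.a_zero, H.lineFun_zero] at h1 ⊢
    have h2 : m < 0 := by exact_mod_cast h1
    exact_mod_cast h2
  set q₀ := Nat.findGreatest (fun j => (m : ℚ) + 1 ≤ lineFun s c a (a j)) k with hq₀
  have hq₀m : (m : ℚ) + 1 ≤ lineFun s c a (a q₀) :=
    Nat.findGreatest_spec (P := fun j => (m : ℚ) + 1 ≤ lineFun s c a (a j)) (Nat.zero_le k) h0
  have hq₀k : q₀ < k := by
    refine (Nat.findGreatest_le k).lt_of_ne fun h => ?_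
    rw [hq₀, h, hm] at hq₀m
    linarith
  have hbelow : ∀ j, q₀ < j → j ≤ k → lineFun s c a (a j) < m + 1 := fun j h1 h2 => by
    by_contra hcon
    exact Nat.findGreatest_is_greatest h1 h2 (not_lt.1 hcon)
  have hnotint : ∀ j, q₀ < j → j < k → ¬ ∃ n : ℤ, lineFun s c a (a j) = n := by
    rintro j h1 h2 ⟨n, hn⟩
    have h3 := hbelow j h1 h2.le
    have h4 := hlt (a j) (hfirst (by omega)) (hstep h2)
    rw [hn] at h3 h4
    have h5 : n < m + 1 := by exact_mod_cast h3
    have h6 : m < n := by exact_mod_cast h4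
    omega
  have haq := H.a_lt q₀ (by omega)
  have hseg : ∀ {x : ℚ}, a q₀ ≤ x → x ≤ a (q₀ + 1) →
      lineFun s c a x = lineFun s c a (a q₀) + (x - a q₀) * c (q₀ + 1) := fun h1 h2 =>
    H.lineFun_eq (j := q₀ + 1) (by omega) (by omega) h1 h2
  have hqeq := hseg haq.le le_rfl
  have hnext := hbelow (q₀ + 1) (by omega) (by omega)
  have hcq : c (q₀ + 1) < 0 := by
    by_contra hcon
    have := mul_nonneg (sub_nonneg.2 haq.le) (not_lt.1 hcon)
    linarith
  set x := a q₀ + (m + 1 - lineFun s c a (a q₀)) / c (q₀ + 1) with hx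
  have hx1 : a q₀ ≤ x := by
    have := div_nonneg_of_nonpos (sub_nonpos.2 hq₀m) hcq.le
    linarith
  have hx2 : x < a (q₀ + 1) := by
    have : (m + 1 - lineFun s c a (a q₀)) / c (q₀ + 1) < a (q₀ + 1) - a q₀ := by
      rw [div_lt_iff_of_neg hcq]
      linarith
    linarith
  have hx3 : lineFun s c a x = m + 1 := by
    rw [hseg hx1 hx2.le, hx, add_sub_cancel_left, div_mul_cancel₀ _ hcq.ne]
    ring
  refine ⟨q₀ + 1, x, by omega, hq₀k, hx1, hx2, hx3, ?_, ?_, ?_,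
    fun j h1 h2 => hnotint j (by omega) h2⟩
  · intro y hy1 hy2
    rcases hy2.eq_or_lt with rfl | hy2
    · rw [hm]
      linarith
    have hy0 : 0 ≤ y := (hfirst (show q₀ ≤ s by omega)).trans (hx1.trans hy1.le)
    obtain ⟨j, h1, h2, h3, h4⟩ := H.exists_right_open hy0 hy2
    have h5 := H.lineFun_eq h1 (by omega) h3 h4.le
    have h6 := H.lineFun_eq h1 (by omega) (H.a_pred_lt h1 (by omega)).le le_rfl
    have hjq : q₀ + 1 ≤ j := by
      by_contra hcon
      have := hmono (show j ≤ q₀ by omega) (by omega)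
      linarith
    rcases hjq.eq_or_lt with rfl | hjq
    · have h7 := hseg hx1 hx2.le
      rw [Nat.add_sub_cancel] at h5
      have := mul_neg_of_pos_of_neg (sub_pos.2 hy1) hcq
      linarith
    · have h7 := hbelow (j - 1) (by omega) (by omega)
      have h8 := hbelow j (by omega) h2
      rcases le_total 0 (c j) with h9 | h9
      · have := mul_nonneg (sub_nonneg.2 h4.le) h9
        linarith
      · have := mul_nonpos_of_nonneg_of_nonpos (sub_nonneg.2 h3) h9
        linarith
  · intro j h1
    induction j, h1 using Nat.le_induction with
    | base => exact fun _ => hcq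
    | succ l hl ih =>
      intro h2
      by_contra hcon
      exact hnotint l (by omega) (by omega) (H.int_of_change l (by omega) (by omega)
        (Or.inl ⟨ih (by omega), not_lt.1 hcon⟩))
  · intro h1
    have h2 := H.a_lt k h1
    have h3 := H.lineFun_eq (j := k + 1) (by omega) (by omega) h2.le le_rfl
    rw [Nat.add_sub_cancel] at h3
    have h4 := hle (a (k + 1)) (hfirst (by omega)) (hlast (by omega))
    by_contra hcon
    have := mul_neg_of_pos_of_neg (sub_pos.2 h2) (not_le.1 hcon)
    linarith

end IsIntegralLine

end GLS

namespace GLS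

/-! ### Deleting and inserting breakpoints -/

/-- The sequence without its `j`-th term. -/
def del {α : Type*} (j : ℕ) (f : ℕ → α) : ℕ → α := fun k => if k < j then f k else f (k + 1)

/-- The sequence with its `p`-th term repeated. -/
def dup {α : Type*} (p : ℕ) (f : ℕ → α) : ℕ → α := fun k => if k ≤ p then f k else f (k - 1)

theorem del_dup {α : Type*} (p : ℕ) (f : ℕ → α) : del p (dup p f) = f := by
  funext k
  by_cases h : k < p
  · simp [del, dup, h, h.le]
  · have h1 : ¬ k + 1 ≤ p := by omega
    simp [del, dup, h, h1]

theorem del_insertAt (a : ℕ → ℚ) (p : ℕ) (c : ℚ) : del p (insertAt a p c) = a := by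
  funext k
  by_cases h : k < p
  · simp [del, insertAt, h]
  · have h1 : ¬ k + 1 < p := by omega
    have h2 : ¬ k + 1 = p := by omega
    simp [del, insertAt, h, h1, h2]

theorem insertAt_le_step {s : ℕ} {a : ℕ → ℚ} (ha : ∀ j < s, a j ≤ a (j + 1)) {p : ℕ} {c : ℚ}
    (hps : p ≤ s) (h1 : a (p - 1) ≤ c) (h2 : c ≤ a p) :
    ∀ j < s + 1, insertAt a p c j ≤ insertAt a p c (j + 1) := by
  intro j hj
  simp only [insertAt, Nat.add_sub_cancel]
  rcases lt_trichotomy j p with h | h | h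
  · rw [if_pos h]
    by_cases h3 : j + 1 < p
    · rw [if_pos h3]
      exact ha j (by omega)
    · rw [if_neg h3, if_pos (by omega), show j = p - 1 by omega]
      exact h1
  · subst h
    rw [if_neg (lt_irrefl j), if_pos rfl, if_neg (by omega), if_neg (by omega)]
    exact h2
  · rw [if_neg h.not_gt, if_neg h.ne', if_neg (by omega), if_neg (by omega)]
    have := ha (j - 1) (by omega)
    rwa [Nat.sub_add_cancel (by omega)] at this

section

variable {𝔥 : Type*} [AddCommGroup 𝔥] [Module ℚ 𝔥]

/-- A path does not change when an interval of length zero is deleted or two successive intervals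
with the same direction are merged. -/
theorem linePath_del {s j : ℕ} (hj : 1 ≤ j) (hjs : j ≤ s + 1) (L : ℕ → Module.Dual ℚ 𝔥)
    (a : ℕ → ℚ) (h : a (j - 1) = a j ∨ (j ≤ s ∧ L j = L (j + 1))) :
    linePath s (del j L) (del j a) = linePath (s + 1) L a := by
  have hA : ∀ n < j, linePath n (del j L) (del j a) = linePath n L a := by
    intro n hn
    funext t
    refine Finset.sum_congr rfl fun k hk => ?_
    rw [Finset.mem_Icc] at hk
    simp only [del]
    rw [if_pos (by omega), if_pos (by omega), if_pos (by omega)]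
  have hsucc : ∀ (n : ℕ) (L : ℕ → Module.Dual ℚ 𝔥) (a : ℕ → ℚ) (t : UnitQ),
      linePath (n + 1) L a t =
        linePath n L a t + (min (t : ℚ) (a (n + 1)) - min (t : ℚ) (a n)) • L (n + 1) := by
    intro n L a t
    rw [linePath, Finset.sum_Icc_succ_top (by omega), Nat.add_sub_cancel]
    rfl
  have hB : ∀ n, j ≤ n → linePath n (del j L) (del j a) = linePath (n + 1) L a := by
    intro n hn
    induction n, hn using Nat.le_induction with
    | base =>
      obtain ⟨j, rfl⟩ : ∃ i, j = i + 1 := ⟨j - 1, by omega⟩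
      funext t
      rw [hsucc, hsucc, hsucc, hA j (by omega)]
      simp only [del]
      rw [if_neg (by omega), if_pos (by omega), if_neg (by omega)]
      rw [Nat.add_sub_cancel] at h
      rcases h with h | ⟨-, h⟩
      · rw [h]
        module
      · rw [h]
        module
    | succ n hn ih =>
      funext t
      rw [hsucc, hsucc, ih]
      simp only [del]
      rw [if_neg (by omega), if_neg (by omega), if_neg (by omega)]
  rcases hjs.lt_or_eq with h1 | h1
  · exact hB s (by omega)
  · subst h1
    rw [hA s (by omega)]
    funext t
    rw [hsucc]
    rw [Nat.add_sub_cancel] at h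
    rw [h.resolve_right fun h2 => by omega, sub_self, zero_smul, add_zero]

theorem linePath_congr {s : ℕ} {L L' : ℕ → Module.Dual ℚ 𝔥} (a : ℕ → ℚ)
    (h : ∀ j, 1 ≤ j → j ≤ s → L j = L' j) : linePath s L a = linePath s L' a := by
  funext t
  refine Finset.sum_congr rfl fun k hk => ?_
  rw [Finset.mem_Icc] at hk
  rw [h k hk.1 hk.2]

theorem linePath_dup {s p : ℕ} (hp : 1 ≤ p) (hps : p ≤ s) (L : ℕ → Module.Dual ℚ 𝔥)
    (a : ℕ → ℚ) (c : ℚ) : linePath (s + 1) (dup p L) (insertAt a p c) = linePath s L a := by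
  have := linePath_del (s := s) hp (by omega) (dup p L) (insertAt a p c)
    (Or.inr ⟨hps, by simp [dup]⟩)
  rw [← this, del_dup, del_insertAt]

end

theorem lineFun_min {s k : ℕ} {a : ℕ → ℚ} (ha : ∀ j < s, a j ≤ a (j + 1)) (hk : k ≤ s)
    (c : ℕ → ℚ) (t : ℚ) : lineFun s c a (min t (a k)) =
      ∑ j ∈ Finset.Icc 1 s, if j ≤ k then (min t (a j) - min t (a (j - 1))) * c j else 0 := by
  refine Finset.sum_congr rfl fun j hj => ?_
  rw [Finset.mem_Icc] at hj
  split_ifs with h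
  · rw [min_assoc, min_assoc, min_eq_right (le_of_le_of_step ha h hk),
      min_eq_right (le_of_le_of_step ha (show j - 1 ≤ k by omega) hk)]
  · rw [min_assoc, min_assoc, min_eq_left (le_of_le_of_step ha (show k ≤ j by omega) hj.2),
      min_eq_left (le_of_le_of_step ha (show k ≤ j - 1 by omega) (by omega)), sub_self, zero_mul]

namespace Realization

section Paths

variable {I : Type*} {A : Matrix I I ℤ} {𝔥 : Type*} [AddCommGroup 𝔥] [Module ℚ 𝔥]

/-- The sequence of weights in which `rᵢ` is applied to the terms with index in `(u, v]`. -/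
def reflectOn (D : Realization A 𝔥) (i : I) (u v : ℕ) (L : ℕ → Module.Dual ℚ 𝔥) :
    ℕ → Module.Dual ℚ 𝔥 :=
  fun j => if u < j ∧ j ≤ v then D.r i (L j) else L j

/-- Weakly monotone data for a path of shape `lam`: weights `L 1, …, L s`, followed by
`L (s + 1) = lam`, such that successive weights are equal or joined by an `a j`-chain whenever
`a j` is positive. -/
structure IsWeakGLSData (D : Realization A 𝔥) (lam : Module.Dual ℚ 𝔥) (s : ℕ)
    (L : ℕ → Module.Dual ℚ 𝔥) (a : ℕ → ℚ) : Prop where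
  mem_orbit : ∀ j, 1 ≤ j → j ≤ s → L j ∈ D.orbit lam
  last : L (s + 1) = lam
  a_zero : a 0 = 0
  a_last : a s = 1
  a_le : ∀ j < s, a j ≤ a (j + 1)
  chain : ∀ j, 1 ≤ j → j ≤ s → 0 < a j → D.WeakChain lam (a j) (L j) (L (j + 1))

variable {D : Realization A 𝔥} {lam : Module.Dual ℚ 𝔥} {s : ℕ} {L : ℕ → Module.Dual ℚ 𝔥}
  {a : ℕ → ℚ} {i : I}

theorem linePath_reflectOn (ha : ∀ j < s, a j ≤ a (j + 1)) {u v : ℕ} (huv : u ≤ v) (hv : v ≤ s)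
    (t : UnitQ) : linePath s (D.reflectOn i u v L) a t = linePath s L a t -
      (lineFun s (fun j => L j (D.coroot i)) a (min (t : ℚ) (a v)) -
        lineFun s (fun j => L j (D.coroot i)) a (min (t : ℚ) (a u))) • D.root i := by
  rw [lineFun_min ha hv, lineFun_min ha (huv.trans hv), ← Finset.sum_sub_distrib,
    Finset.sum_smul, linePath, linePath, ← Finset.sum_sub_distrib]
  refine Finset.sum_congr rfl fun j _ => ?_
  simp only [reflectOn]
  by_cases h1 : j ≤ u
  · rw [if_neg (by omega), if_pos h1, if_pos (by omega)]
    module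
  · by_cases h2 : j ≤ v
    · rw [if_pos ⟨by omega, h2⟩, if_pos h2, if_neg h1, r_apply]
      module
    · rw [if_neg (by omega), if_neg h2, if_neg h1]
      module

/-- Weakly monotone data can be made strictly monotone without changing the path. -/
theorem IsWeakGLSData.linePath_mem (H : D.IsWeakGLSData lam s L a) :
    linePath s L a ∈ D.glsPaths lam := by
  induction s generalizing L a with
  | zero =>
    have := H.a_zero.symm.trans H.a_last
    norm_num at this
  | succ s ih =>
  by_cases hbad : ∃ j, 1 ≤ j ∧ j ≤ s + 1 ∧ (a (j - 1) = a j ∨ (j ≤ s ∧ L j = L (j + 1)))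
  · obtain ⟨j, hj, hjs, h⟩ := hbad
    rw [← linePath_del hj hjs L a h]
    have hs : j ≤ s ∨ j = s + 1 := by omega
    refine ih ⟨fun k hk hks => ?_, ?_, ?_, ?_, fun k hk => ?_, fun k hk hks hpos => ?_⟩
    · simp only [del]
      split_ifs
      · exact H.mem_orbit k hk (by omega)
      · exact H.mem_orbit (k + 1) (by omega) (by omega)
    · simp only [del]
      rw [if_neg (by omega)]
      exact H.last
    · simp only [del]
      rw [if_pos (by omega)]
      exact H.a_zero
    · simp only [del]
      rcases hs with hs | rfl
      · rw [if_neg (by omega)]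
        exact H.a_last
      · rw [if_pos (by omega), ← H.a_last, ← h.resolve_right fun h2 => by omega,
          Nat.add_sub_cancel]
    · simp only [del]
      by_cases h1 : k + 1 < j
      · rw [if_pos (by omega), if_pos h1]
        exact H.a_le k (by omega)
      · rw [if_neg h1]
        split_ifs
        · exact (H.a_le k (by omega)).trans (H.a_le (k + 1) (by omega))
        · exact H.a_le (k + 1) (by omega)
    · simp only [del] at hpos ⊢
      rcases lt_trichotomy (k + 1) j with h1 | h1 | h1
      · rw [if_pos (by omega)] at hpos
        rw [if_pos (by omega), if_pos (by omega), if_pos h1]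
        exact H.chain k hk (by omega) hpos
      · -- the two steps next to the deleted weight are joined
        rw [if_pos (by omega)] at hpos
        rw [if_pos (by omega), if_pos (by omega), if_neg (by omega)]
        subst h1
        have h2 := H.chain k hk (by omega) hpos
        rw [Nat.add_sub_cancel] at h
        rcases h with h | ⟨-, h⟩
        · refine Relation.ReflTransGen.trans h2 ?_
          rw [h] at hpos ⊢
          exact H.chain (k + 1) (by omega) (by omega) hpos
        · rwa [← h]
      · rw [if_neg (by omega)] at hpos
        rw [if_neg (by omega), if_neg (by omega), if_neg (by omega)]
        exact H.chain (k + 1) (by omega) (by omega) hpos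
  · push Not at hbad
    have hlt : ∀ j < s + 1, a j < a (j + 1) := fun j hj =>
      (H.a_le j hj).lt_of_ne (hbad (j + 1) (by omega) (by omega)).1
    have hpos : ∀ j, 1 ≤ j → j ≤ s + 1 → 0 < a j := by
      intro j h1 h2
      have h3 := hlt 0 (by omega)
      rw [H.a_zero] at h3
      exact h3.trans_le (le_of_le_of_step H.a_le (by omega) h2)
    have hle : ∀ j ≤ s + 1, a j ≤ 1 := fun j hj => H.a_last ▸ le_of_le_of_step H.a_le hj le_rfl
    refine ⟨s + 1, L, a, ⟨by omega, H.mem_orbit, fun j h1 h2 => ?_, H.a_zero, H.a_last, hlt,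
      fun j h1 h2 => ?_, fun hne => ?_⟩, rfl⟩
    · exact WeakChain.gt (H.chain j h1 h2.le (hpos j h1 h2.le))
        ((hbad j h1 h2.le).2 (by omega))
    · exact WeakChain.hasChain (H.chain j h1 h2.le (hpos j h1 h2.le))
        ((hbad j h1 h2.le).2 (by omega)) (hpos j h1 h2.le) (hle j h2.le)
    · have h1 := H.chain (s + 1) (by omega) le_rfl (hpos _ (by omega) le_rfl)
      rw [H.last, H.a_last] at h1
      exact WeakChain.hasChain h1 hne one_pos le_rfl

theorem IsWeakGLSData.isWeakData (H : D.IsWeakGLSData lam s L a)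
    (h0 : ∀ j, 1 ≤ j → j < s → a j = 0 → D.Gt lam (L j) (L (j + 1))) :
    D.IsWeakData lam s L a := by
  refine ⟨?_, H.mem_orbit, fun j h1 h2 => ?_, H.a_zero, H.a_last, H.a_le⟩
  · by_contra hcon
    have h1 := H.a_last
    rw [show s = 0 by omega, H.a_zero] at h1
    norm_num at h1
  · have h3 : 0 ≤ a j := H.a_zero ▸ le_of_le_of_step H.a_le j.zero_le h2.le
    rcases h3.eq_or_lt with h4 | h4
    · exact Or.inr (h0 j h1 h2 h4.symm)
    · by_cases h5 : L j = L (j + 1)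
      · exact Or.inl h5
      · exact Or.inr (WeakChain.gt (H.chain j h1 h2.le h4) h5)

theorem IsWeakGLSData.dup (H : D.IsWeakGLSData lam s L a) {p : ℕ} {c : ℚ} (hp : 1 ≤ p)
    (hps : p ≤ s) (h1 : a (p - 1) ≤ c) (h2 : c ≤ a p) :
    D.IsWeakGLSData lam (s + 1) (GLS.dup p L) (insertAt a p c) := by
  refine ⟨fun j hj hjs => ?_, ?_, ?_, ?_, insertAt_le_step H.a_le hps h1 h2,
    fun j hj hjs hpos => ?_⟩
  · simp only [GLS.dup]
    split_ifs
    · exact H.mem_orbit j hj (by omega)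
    · exact H.mem_orbit (j - 1) (by omega) (by omega)
  · simp only [GLS.dup]
    rw [if_neg (by omega)]
    exact H.last
  · simp only [insertAt]
    rw [if_pos (by omega)]
    exact H.a_zero
  · simp only [insertAt]
    rw [if_neg (by omega), if_neg (by omega), Nat.add_sub_cancel]
    exact H.a_last
  · rcases lt_trichotomy j p with h3 | h3 | h3
    · simp only [GLS.dup, insertAt] at hpos ⊢
      rw [if_pos h3] at hpos
      rw [if_pos h3, if_pos h3.le, if_pos (by omega)]
      exact H.chain j hj (by omega) hpos
    · have h4 : GLS.dup p L j = GLS.dup p L (j + 1) := by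
        simp only [GLS.dup]
        rw [if_pos h3.le, if_neg (by omega), Nat.add_sub_cancel]
      rw [h4]
    · simp only [GLS.dup, insertAt] at hpos ⊢
      rw [if_neg (by omega), if_neg (by omega)] at hpos
      rw [if_neg (by omega), if_neg (by omega), if_neg (by omega), if_neg (by omega),
        Nat.add_sub_cancel]
      have := H.chain (j - 1) (by omega) (by omega) hpos
      rwa [Nat.sub_add_cancel hj] at this

theorem IsWeakGLSData.reflectOn (H : D.IsWeakGLSData lam s L a) {u v : ℕ} (huv : u < v)
    (hv : v ≤ s) (hu : 1 ≤ u → 0 < a u → D.WeakChain lam (a u) (L u) (D.r i (L (u + 1))))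
    (hmid : ∀ j, u < j → j < v → D.WeakChain lam (a j) (D.r i (L j)) (D.r i (L (j + 1))))
    (hlast : 0 < a v → D.WeakChain lam (a v) (D.r i (L v)) (L (v + 1))) :
    D.IsWeakGLSData lam s (D.reflectOn i u v L) a := by
  refine ⟨fun j hj hjs => ?_, ?_, H.a_zero, H.a_last, H.a_le, fun j hj hjs hpos => ?_⟩
  · simp only [Realization.reflectOn]
    split_ifs
    · exact r_mem_orbit (H.mem_orbit j hj hjs) i
    · exact H.mem_orbit j hj hjs
  · simp only [Realization.reflectOn]
    rw [if_neg (by omega)]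
    exact H.last
  · simp only [Realization.reflectOn]
    rcases lt_trichotomy j u with h1 | h1 | h1
    · rw [if_neg (by omega), if_neg (by omega)]
      exact H.chain j hj hjs hpos
    · subst h1
      rw [if_neg (by omega), if_pos (by omega)]
      exact hu hj hpos
    · rcases lt_trichotomy j v with h2 | h2 | h2
      · rw [if_pos (by omega), if_pos (by omega)]
        exact hmid j h1 h2
      · subst h2
        rw [if_pos (by omega), if_neg (by omega)]
        exact hlast hpos
      · rw [if_neg (by omega), if_neg (by omega)]
        exact H.chain j hj hjs hpos

/-! ### Heights of paths -/

theorem IsGLSData.isWeakGLSData (H : D.IsGLSData lam s L a) (hlast : L (s + 1) = lam) :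
    D.IsWeakGLSData lam s L a := by
  refine ⟨H.mem_orbit, hlast, H.a_zero, H.a_last, fun j hj => (H.a_lt j hj).le,
    fun j h1 h2 _ => ?_⟩
  rcases h2.eq_or_lt with rfl | h2
  · rw [hlast, H.a_last]
    by_cases h : L j = lam
    · rw [h]
    · exact (H.chain_last h).weakChain
  · exact (H.chain j h1 h2).weakChain

theorem IsGLSData.pos (H : D.IsGLSData lam s L a) {j : ℕ} (h1 : 1 ≤ j) (h2 : j ≤ s) : 0 < a j := by
  have h3 := H.a_lt 0 (by omega)
  rw [H.a_zero] at h3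
  exact h3.trans_le (le_of_le_of_step (fun j hj => (H.a_lt j hj).le) h1 h2)

theorem IsGLSData.weakChain (H : D.IsGLSData lam s L a) (hlast : L (s + 1) = lam) {j : ℕ}
    (h1 : 1 ≤ j) (h2 : j ≤ s) : D.WeakChain lam (a j) (L j) (L (j + 1)) :=
  (H.isWeakGLSData hlast).chain j h1 h2 (H.pos h1 h2)

/-- On each of its intervals, the height of a path of shape `lam` differs by an integer from the
linear function with the same slope that vanishes at `0`. -/
theorem IsGLSData.exists_int (H : D.IsGLSData lam s L a) (hlast : L (s + 1) = lam) (i : I) {j : ℕ}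
    (hj : 1 ≤ j) (hjs : j ≤ s) : ∃ n : ℤ, ∀ t, a (j - 1) ≤ t → t ≤ a j →
      lineFun s (fun j => L j (D.coroot i)) a t = t * L j (D.coroot i) + n := by
  have hle : ∀ j < s, a j ≤ a (j + 1) := fun j hj => (H.a_lt j hj).le
  induction j, hj using Nat.le_induction with
  | base =>
    refine ⟨0, fun t h1 h2 => ?_⟩
    have h0 : lineFun s (fun j => L j (D.coroot i)) a (min 0 (a 0)) = 0 := by
      rw [lineFun_min hle s.zero_le]
      refine Finset.sum_eq_zero fun j hj => ?_
      rw [Finset.mem_Icc] at hj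
      rw [if_neg (by omega)]
    rw [H.a_zero, min_self] at h0
    rw [Nat.sub_self, H.a_zero] at h1
    rw [lineFun_sub hle _ le_rfl hjs (u := 0) (by rw [Nat.sub_self, H.a_zero]; exact h1) h2
      (by rw [Nat.sub_self, H.a_zero]) (H.pos le_rfl hjs).le, h0]
    push_cast
    ring
  | succ j hj ih =>
    obtain ⟨n, hn⟩ := ih (by omega)
    obtain ⟨m, hm⟩ := WeakChain.int_sub (H.weakChain hlast hj (by omega)) i
    refine ⟨n - m, fun t h1 h2 => ?_⟩
    have h3 := hle (j - 1) (by omega)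
    rw [Nat.sub_add_cancel hj] at h3
    rw [lineFun_sub hle _ (by omega) hjs (u := a j) h1 h2 le_rfl (hle j (by omega)),
      hn (a j) h3 le_rfl]
    push_cast
    linarith

theorem IsGLSData.imaginary_nonneg (hA : IsBorcherdsCartan A) (hi : A i i ≠ 2)
    (hlam : lam ∈ D.dominantWeights) (H : D.IsGLSData lam s L a) (hlast : L (s + 1) = lam)
    {j : ℕ} (hj : 1 ≤ j) (hjs : j ≤ s + 1) : 0 ≤ L j (D.coroot i) := by
  induction hjs using Nat.decreasingInduction with
  | self =>
    obtain ⟨n, hn⟩ := hlam i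
    rw [hlast, hn]
    exact n.cast_nonneg
  | of_succ l hl ih =>
    exact (ih (by omega)).trans
      (WeakChain.le_of_imaginary hA hi (H.weakChain hlast hj (by omega)))

theorem IsGLSData.isIntegralLine (hA : IsBorcherdsCartan A) (hlam : lam ∈ D.dominantWeights)
    (H : D.IsGLSData lam s L a) (hlast : L (s + 1) = lam) (i : I) :
    IsIntegralLine s (fun j => L j (D.coroot i)) a := by
  have hint : ∀ j, 1 ≤ j → j ≤ s → (∃ n : ℤ, a j * L j (D.coroot i) = n) →
      ∃ n : ℤ, lineFun s (fun j => L j (D.coroot i)) a (a j) = n := by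
    rintro j h1 h2 ⟨m, hm⟩
    obtain ⟨n, hn⟩ := H.exists_int hlast i h1 h2
    have h3 := (H.a_lt (j - 1) (by omega)).le
    rw [Nat.sub_add_cancel h1] at h3
    exact ⟨m + n, by rw [hn (a j) h3 le_rfl, hm]; push_cast; rfl⟩
  refine ⟨H.a_zero, H.a_last, H.a_lt, fun j h1 h2 h => ?_, ?_⟩
  · have hc := H.weakChain hlast h1 h2.le
    by_cases hi : A i i = 2
    · refine hint j h1 h2.le ?_
      rcases h with ⟨h3, h4⟩ | ⟨h3, h4⟩
      · exact WeakChain.int_of_neg hA hi hc h3 h4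
      · obtain ⟨n, hn⟩ := WeakChain.int_of_pos hA hi hc h3 h4
        obtain ⟨m, hm⟩ := WeakChain.int_sub hc i
        exact ⟨n - m, by push_cast; linarith⟩
    · have h3 := WeakChain.le_of_imaginary hA hi hc
      have h4 := H.imaginary_nonneg hA hi hlam hlast h1 (by omega)
      rcases h with ⟨h5, h6⟩ | ⟨h5, h6⟩ <;> linarith
  · have h1 := hint s H.one_le le_rfl
    rw [H.a_last] at h1
    refine h1 ?_
    obtain ⟨m, hm⟩ := WeakChain.int_sub (H.weakChain hlast H.one_le le_rfl) i
    obtain ⟨n, hn⟩ := hlam i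
    rw [H.a_last, hlast, hn] at hm
    exact ⟨n - m, by push_cast; linarith⟩

end Paths

end Realization

end GLS

namespace GLS

/-! ### The parameters of the operators -/

theorem greatest_eq {S : Set UnitQ} {t : UnitQ} (h : IsGreatest S t) : greatest S = t := by
  have hex : ∃ t, IsGreatest S t := ⟨t, h⟩
  rw [greatest, dif_pos hex]
  exact hex.choose_spec.unique h

theorem least_eq {S : Set UnitQ} {t : UnitQ} (h : IsLeast S t) : least S = t := by
  have hex : ∃ t, IsLeast S t := ⟨t, h⟩
  rw [least, dif_pos hex]
  exact hex.choose_spec.unique h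

theorem insertAt_of_lt {a : ℕ → ℚ} {p j : ℕ} (c : ℚ) (h : j < p) : insertAt a p c j = a j :=
  if_pos h

theorem insertAt_self (a : ℕ → ℚ) (p : ℕ) (c : ℚ) : insertAt a p c p = c := by
  simp [insertAt]

theorem insertAt_of_gt {a : ℕ → ℚ} {p j : ℕ} (c : ℚ) (h : p < j) :
    insertAt a p c j = a (j - 1) := by
  simp only [insertAt]
  rw [if_neg h.not_gt, if_neg h.ne']

theorem dup_of_le {α : Type*} {f : ℕ → α} {p j : ℕ} (h : j ≤ p) : dup p f j = f j := if_pos h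

theorem dup_of_gt {α : Type*} {f : ℕ → α} {p j : ℕ} (h : p < j) : dup p f j = f (j - 1) :=
  if_neg h.not_ge

namespace Realization

section Operators

variable {I : Type*} {A : Matrix I I ℤ} {𝔥 : Type*} [AddCommGroup 𝔥] [Module ℚ 𝔥]
  {D : Realization A 𝔥} {lam : Module.Dual ℚ 𝔥} {s : ℕ} {L : ℕ → Module.Dual ℚ 𝔥}
  {a : ℕ → ℚ} {i : I} {π : RatPath 𝔥}

theorem height_linePath (t : UnitQ) :
    D.height i (linePath s L a) t = lineFun s (fun j => L j (D.coroot i)) a t :=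
  linePath_apply s L a t _

/-- The minimal integral value of a height, and where it is first and last attained. -/
theorem exists_extremal {c : ℕ → ℚ} (H : IsIntegralLine s c a)
    (hπ : ∀ t : UnitQ, D.height i π t = lineFun s c a t) :
    ∃ k t : ℕ, k ≤ s ∧ t ≤ s ∧ (D.ePlus i π : ℚ) = a k ∧ (D.fPlus i π : ℚ) = a t ∧
      IsLeast {n : ℤ | ∃ t, D.height i π t = n} (D.minInt i π) ∧
      IsGreatest {t | D.height i π t = D.minInt i π} (D.fPlus i π) ∧
      IsLeast {t | D.height i π t = D.minInt i π} (D.ePlus i π) ∧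
      (∀ x, 0 ≤ x → x ≤ 1 → (D.minInt i π : ℚ) ≤ lineFun s c a x) ∧
      (∀ x, 0 ≤ x → x < a k → (D.minInt i π : ℚ) < lineFun s c a x) ∧
      (∀ x, a t < x → x ≤ 1 → (D.minInt i π : ℚ) < lineFun s c a x) := by
  obtain ⟨m, k, t, hk, ht, hkm, htm, h1, h2, h3⟩ := H.exists_min
  have hmem : ∀ j ≤ s, a j ∈ Set.Icc (0 : ℚ) 1 := fun j hj =>
    ⟨H.a_zero ▸ le_of_le_of_step H.a_le j.zero_le hj,
      H.a_last ▸ le_of_le_of_step H.a_le hj le_rfl⟩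
  have hleast : IsLeast {n : ℤ | ∃ t, D.height i π t = n} m := by
    refine ⟨⟨⟨a k, hmem k hk⟩, by rw [hπ, hkm]⟩, ?_⟩
    rintro n ⟨x, hx⟩
    rw [hπ] at hx
    have := h1 x x.2.1 x.2.2
    rw [hx] at this
    exact_mod_cast this
  have hm : D.minInt i π = m := hleast.csInf_eq
  have hgr : IsGreatest {t | D.height i π t = D.minInt i π} (⟨a t, hmem t ht⟩ : UnitQ) := by
    refine ⟨?_, fun x hx => ?_⟩
    · rw [Set.mem_ofPred_eq, hm, hπ, htm]
    · rw [Set.mem_ofPred_eq, hm, hπ] at hx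
      by_contra hcon
      have := h3 x (not_le.1 hcon) x.2.2
      linarith
  have hle : IsLeast {t | D.height i π t = D.minInt i π} (⟨a k, hmem k hk⟩ : UnitQ) := by
    refine ⟨?_, fun x hx => ?_⟩
    · rw [Set.mem_ofPred_eq, hm, hπ, hkm]
    · rw [Set.mem_ofPred_eq, hm, hπ] at hx
      by_contra hcon
      have := h2 x x.2.1 (not_le.1 hcon)
      linarith
  have hf : D.fPlus i π = ⟨a t, hmem t ht⟩ := greatest_eq hgr
  have he : D.ePlus i π = ⟨a k, hmem k hk⟩ := least_eq hle
  refine ⟨k, t, hk, ht, by rw [he], by rw [hf], hm ▸ hleast, hf ▸ hgr, he ▸ hle, ?_, ?_, ?_⟩ <;>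
    rwa [hm]

/-- The interval on which `fᵢ` acts. -/
theorem exists_fMinus {c : ℕ → ℚ} (H : IsIntegralLine s c a)
    (hπ : ∀ t : UnitQ, D.height i π t = lineFun s c a t) (hf : D.fPlus i π < 1) :
    ∃ t p : ℕ, t < p ∧ p ≤ s ∧ (D.fPlus i π : ℚ) = a t ∧
      lineFun s c a (a t) = D.minInt i π ∧
      IsLeast {t | D.fPlus i π ≤ t ∧ D.height i π t = D.minInt i π + 1} (D.fMinus i π) ∧
      a (p - 1) < D.fMinus i π ∧ (D.fMinus i π : ℚ) ≤ a p ∧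
      lineFun s c a (D.fMinus i π) = D.minInt i π + 1 ∧
      (∀ y, a t ≤ y → y < D.fMinus i π → lineFun s c a y < D.minInt i π + 1) ∧
      (∀ j, t < j → j ≤ p → 0 < c j) ∧ (1 ≤ t → c t ≤ 0) ∧
      ∀ j, t < j → j < p → ¬ ∃ n : ℤ, lineFun s c a (a j) = n := by
  obtain ⟨k, t, -, ht, -, hft, -, hgr, -, h1, -, h3⟩ := exists_extremal H hπ
  have hval : lineFun s c a (a t) = D.minInt i π := by
    rw [← hft, ← hπ]
    exact hgr.1
  have hts : t < s := by
    refine ht.lt_of_ne ?_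
    rintro rfl
    have h4 : (D.fPlus i π : ℚ) < 1 := hf
    rw [hft, H.a_last] at h4
    exact lt_irrefl _ h4
  obtain ⟨p, x, h4, h5, h6, h7, h8, h9, h10, h11, h12⟩ := H.exists_next hts hval h3 h1
  have hle : ∀ {j l : ℕ}, j ≤ l → l ≤ s → a j ≤ a l := fun h1 h2 => le_of_le_of_step H.a_le h1 h2
  have hx : x ∈ Set.Icc (0 : ℚ) 1 :=
    ⟨(H.a_zero ▸ hle (Nat.zero_le (p - 1)) (by omega)).trans h6.le,
      h7.trans (H.a_last ▸ hle h5 le_rfl)⟩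
  have hleast : IsLeast {t | D.fPlus i π ≤ t ∧ D.height i π t = D.minInt i π + 1}
      (⟨x, hx⟩ : UnitQ) := by
    refine ⟨⟨?_, by rw [hπ, h8]⟩, fun y hy => ?_⟩
    · change (D.fPlus i π : ℚ) ≤ x
      rw [hft]
      exact (hle (show t ≤ p - 1 by omega) (by omega)).trans h6.le
    · obtain ⟨hy1, hy2⟩ := hy
      rw [hπ] at hy2
      by_contra hcon
      have hy3 : (D.fPlus i π : ℚ) ≤ y := hy1
      rw [hft] at hy3
      have := h9 y hy3 (not_le.1 hcon)
      linarith
  have hfm : D.fMinus i π = ⟨x, hx⟩ := least_eq hleast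
  exact ⟨t, p, h4, h5, hft, hval, by rwa [hfm], by rwa [hfm], by rwa [hfm], by rwa [hfm],
    by rwa [hfm], h10, h11, h12⟩

/-- The interval on which `eᵢ` acts. -/
theorem exists_eMinus {c : ℕ → ℚ} (H : IsIntegralLine s c a)
    (hπ : ∀ t : UnitQ, D.height i π t = lineFun s c a t) (he : 0 < D.ePlus i π) :
    ∃ q k : ℕ, 1 ≤ q ∧ q ≤ k ∧ k ≤ s ∧ (D.ePlus i π : ℚ) = a k ∧
      lineFun s c a (a k) = D.minInt i π ∧
      IsGreatest {t | t ≤ D.ePlus i π ∧ D.height i π t = D.minInt i π + 1} (D.eMinus i π) ∧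
      a (q - 1) ≤ D.eMinus i π ∧ (D.eMinus i π : ℚ) < a q ∧
      lineFun s c a (D.eMinus i π) = D.minInt i π + 1 ∧
      (∀ j, q ≤ j → j ≤ k → c j < 0) ∧ (k < s → 0 ≤ c (k + 1)) ∧
      ∀ j, q ≤ j → j < k → ¬ ∃ n : ℤ, lineFun s c a (a j) = n := by
  obtain ⟨k, t, hk, -, hek, -, -, -, hle, h1, h2, -⟩ := exists_extremal H hπ
  have hval : lineFun s c a (a k) = D.minInt i π := by
    rw [← hek, ← hπ]
    exact hle.1
  have hk1 : 1 ≤ k := by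
    by_contra hcon
    have h4 : 0 < (D.ePlus i π : ℚ) := he
    rw [hek, show k = 0 by omega, H.a_zero] at h4
    exact lt_irrefl _ h4
  obtain ⟨q, x, h4, h5, h6, h7, h8, h9, h10, h11, h12⟩ := H.exists_prev hk1 hk hval h2 h1
  have hle : ∀ {j l : ℕ}, j ≤ l → l ≤ s → a j ≤ a l := fun h1 h2 => le_of_le_of_step H.a_le h1 h2
  have hx : x ∈ Set.Icc (0 : ℚ) 1 :=
    ⟨(H.a_zero ▸ hle (Nat.zero_le (q - 1)) (by omega)).trans h6,
      h7.le.trans (H.a_last ▸ hle (h5.trans hk) le_rfl)⟩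
  have hgr : IsGreatest {t | t ≤ D.ePlus i π ∧ D.height i π t = D.minInt i π + 1}
      (⟨x, hx⟩ : UnitQ) := by
    refine ⟨⟨?_, by rw [hπ, h8]⟩, fun y hy => ?_⟩
    · change x ≤ (D.ePlus i π : ℚ)
      rw [hek]
      exact h7.le.trans (hle h5 hk)
    · obtain ⟨hy1, hy2⟩ := hy
      rw [hπ] at hy2
      by_contra hcon
      have hy3 : (y : ℚ) ≤ D.ePlus i π := hy1
      rw [hek] at hy3
      have := h9 y (not_le.1 hcon) hy3
      linarith
  have hem : D.eMinus i π = ⟨x, hx⟩ := greatest_eq hgr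
  exact ⟨q, k, h4, h5, hk, hek, hval, by rwa [hem], by rwa [hem], by rwa [hem], by rwa [hem],
    h10, h11, h12⟩

/-! ### Arbitrary continuations of the sequence of weights -/

theorem IsGLSData.congr {L' : ℕ → Module.Dual ℚ 𝔥} (H : D.IsGLSData lam s L a)
    (h : ∀ j, 1 ≤ j → j ≤ s → L j = L' j) : D.IsGLSData lam s L' a := by
  refine ⟨H.one_le, fun j h1 h2 => ?_, fun j h1 h2 => ?_, H.a_zero, H.a_last, H.a_lt,
    fun j h1 h2 => ?_, ?_⟩
  · rw [← h j h1 h2]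
    exact H.mem_orbit j h1 h2
  · rw [← h j h1 h2.le, ← h (j + 1) (by omega) h2]
    exact H.gt j h1 h2
  · rw [← h j h1 h2.le, ← h (j + 1) (by omega) h2]
    exact H.chain j h1 h2
  · rw [← h s H.one_le le_rfl]
    exact H.chain_last

theorem IsWeakData.congr {L' : ℕ → Module.Dual ℚ 𝔥} (H : D.IsWeakData lam s L a)
    (h : ∀ j, 1 ≤ j → j ≤ s → L j = L' j) : D.IsWeakData lam s L' a := by
  refine ⟨H.one_le, fun j h1 h2 => ?_, fun j h1 h2 => ?_, H.a_zero, H.a_last, H.a_le⟩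
  · rw [← h j h1 h2]
    exact H.mem_orbit j h1 h2
  · rw [← h j h1 h2.le, ← h (j + 1) (by omega) h2]
    exact H.ge j h1 h2

theorem fWeights_congr {L' : ℕ → Module.Dual ℚ 𝔥} (h : ∀ j, 1 ≤ j → j ≤ s → L j = L' j)
    {t p : ℕ} (htp : t < p) (hps : p ≤ s) (j : ℕ) (h1 : 1 ≤ j) (h2 : j ≤ s + 1) :
    D.fWeights i L t p j = D.fWeights i L' t p j := by
  simp only [fWeights]
  split_ifs
  · exact h j h1 (by omega)
  · rw [h j h1 (by omega)]
  · exact h (j - 1) (by omega) (by omega)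

theorem eWeights_congr {L' : ℕ → Module.Dual ℚ 𝔥} (h : ∀ j, 1 ≤ j → j ≤ s → L j = L' j)
    {q k : ℕ} (hq : 1 ≤ q) (hqk : q ≤ k) (hks : k ≤ s) (j : ℕ) (h1 : 1 ≤ j) (h2 : j ≤ s + 1) :
    D.eWeights i L q k j = D.eWeights i L' q k j := by
  simp only [eWeights]
  split_ifs
  · exact h j h1 (by omega)
  · rw [h (j - 1) (by omega) (by omega)]
  · exact h (j - 1) (by omega) (by omega)

/-- The weights of a path of shape `lam` may be assumed to be continued by `lam`, since only the
first `s` of them matter. -/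
theorem IsGLSData.exists_continuation (H : D.IsGLSData lam s L a) :
    ∃ L', (∀ j, 1 ≤ j → j ≤ s → L' j = L j) ∧ L' (s + 1) = lam ∧ D.IsGLSData lam s L' a ∧
      linePath s L a = linePath s L' a := by
  have h : ∀ j, 1 ≤ j → j ≤ s → L j = (fun j => if j ≤ s then L j else lam) j :=
    fun j _ h2 => (if_pos h2).symm
  exact ⟨_, fun j h1 h2 => (h j h1 h2).symm, if_neg (by omega), H.congr h, linePath_congr a h⟩

/-! ### The operators on paths of shape `lam` -/

theorem fWeights_eq {t p : ℕ} (htp : t < p) :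
    D.fWeights i L t p = D.reflectOn i t p (dup p L) := by
  funext j
  simp only [fWeights, reflectOn, dup]
  by_cases h1 : j ≤ t
  · rw [if_pos h1, if_neg (by omega), if_pos (by omega)]
  · by_cases h2 : j ≤ p
    · rw [if_neg h1, if_pos h2, if_pos ⟨by omega, h2⟩, if_pos h2]
    · rw [if_neg h1, if_neg h2, if_neg (by omega), if_neg h2]

theorem eWeights_eq {q k : ℕ} :
    D.eWeights i L q k = D.reflectOn i q (k + 1) (dup q L) := by
  funext j
  simp only [eWeights, reflectOn, dup]
  by_cases h1 : j ≤ q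
  · rw [if_pos h1, if_neg (by omega), if_pos (by omega)]
  · by_cases h2 : j ≤ k + 1
    · rw [if_neg h1, if_pos h2, if_pos ⟨by omega, h2⟩, if_neg h1]
    · rw [if_neg h1, if_neg h2, if_neg (by omega), if_neg h1]

theorem lineFun_dup {p : ℕ} (hp : 1 ≤ p) (hps : p ≤ s) (c : ℚ) (t : UnitQ) :
    lineFun (s + 1) (fun j => dup p L j (D.coroot i)) (insertAt a p c) t =
      lineFun s (fun j => L j (D.coroot i)) a t := by
  rw [← linePath_apply, ← linePath_apply, linePath_dup hp hps]

theorem f_linePath (ha : ∀ j < s, a j ≤ a (j + 1)) (hπ : π = linePath s L a) {t p : ℕ}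
    (hf : D.fPlus i π < 1) (htp : t < p) (hps : p ≤ s) (hft : (D.fPlus i π : ℚ) = a t)
    (h1 : a (p - 1) < D.fMinus i π) (h2 : (D.fMinus i π : ℚ) ≤ a p)
    (hm : D.height i π (D.fPlus i π) = D.minInt i π)
    (hm' : D.height i π (D.fMinus i π) = D.minInt i π + 1) :
    D.f i π = some (linePath (s + 1) (D.fWeights i L t p) (insertAt a p (D.fMinus i π))) := by
  rw [f, if_pos hf]
  congr 1
  funext x
  have hlt : D.fPlus i π < D.fMinus i π := by
    change (D.fPlus i π : ℚ) < D.fMinus i π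
    rw [hft]
    exact (le_of_le_of_step ha (show t ≤ p - 1 by omega) (by omega)).trans_lt h1
  have hh : ∀ y : UnitQ, lineFun (s + 1) (fun j => dup p L j (D.coroot i))
      (insertAt a p (D.fMinus i π)) y = D.height i π y := fun y => by
    rw [lineFun_dup (by omega) hps, hπ, height_linePath]
  rw [fWeights_eq htp, linePath_reflectOn (insertAt_le_step ha hps h1.le h2) htp.le
    (by omega), linePath_dup (by omega) hps, ← hπ, insertAt_self, insertAt_of_lt _ htp, ← hft]
  by_cases hx1 : x ≤ D.fPlus i π
  · have hx1' : (x : ℚ) ≤ D.fPlus i π := hx1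
    have hx2' : (x : ℚ) ≤ D.fMinus i π := hx1.trans hlt.le
    rw [if_pos hx1, min_eq_left hx1', min_eq_left hx2', sub_self, zero_smul, sub_zero]
  · have hx1' : (D.fPlus i π : ℚ) ≤ x := (not_le.1 hx1).le
    rw [if_neg hx1, min_eq_right hx1', hh, hm]
    by_cases hx2 : x ≤ D.fMinus i π
    · have hx2' : (x : ℚ) ≤ D.fMinus i π := hx2
      rw [if_pos hx2, min_eq_left hx2', hh, r_apply, LinearMap.sub_apply]
      change _ + (_ - (D.height i π x - D.height i π (D.fPlus i π)) • _) = _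
      rw [hm]
      module
    · have hx2' : (D.fMinus i π : ℚ) ≤ x := (not_le.1 hx2).le
      rw [if_neg hx2, min_eq_right hx2', hh, hm']
      module

theorem e_linePath (ha : ∀ j < s, a j ≤ a (j + 1)) (hπ : π = linePath s L a) {q k : ℕ}
    (he : 0 < D.ePlus i π) (hq : 1 ≤ q) (hqk : q ≤ k) (hks : k ≤ s)
    (hek : (D.ePlus i π : ℚ) = a k)
    (h1 : a (q - 1) ≤ D.eMinus i π) (h2 : (D.eMinus i π : ℚ) < a q)
    (hm : D.height i π (D.ePlus i π) = D.minInt i π)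
    (hm' : D.height i π (D.eMinus i π) = D.minInt i π + 1) :
    D.e i π = some (linePath (s + 1) (D.eWeights i L q k) (insertAt a q (D.eMinus i π))) := by
  rw [e, if_pos he]
  congr 1
  funext x
  have hlt : D.eMinus i π < D.ePlus i π := by
    change (D.eMinus i π : ℚ) < D.ePlus i π
    rw [hek]
    exact h2.trans_le (le_of_le_of_step ha hqk hks)
  have hh : ∀ y : UnitQ, lineFun (s + 1) (fun j => dup q L j (D.coroot i))
      (insertAt a q (D.eMinus i π)) y = D.height i π y := fun y => by
    rw [lineFun_dup hq (by omega), hπ, height_linePath]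
  rw [eWeights_eq, linePath_reflectOn (insertAt_le_step ha (by omega) h1 h2.le)
    (by omega) (by omega), linePath_dup hq (by omega), ← hπ, insertAt_self,
    insertAt_of_gt _ (by omega), Nat.add_sub_cancel, ← hek]
  by_cases hx1 : x ≤ D.eMinus i π
  · have hx1' : (x : ℚ) ≤ D.eMinus i π := hx1
    have hx2' : (x : ℚ) ≤ D.ePlus i π := hx1.trans hlt.le
    rw [if_pos hx1, min_eq_left hx1', min_eq_left hx2', sub_self, zero_smul, sub_zero]
  · have hx1' : (D.eMinus i π : ℚ) ≤ x := (not_le.1 hx1).le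
    rw [if_neg hx1, min_eq_right hx1', hh, hm']
    by_cases hx2 : x ≤ D.ePlus i π
    · have hx2' : (x : ℚ) ≤ D.ePlus i π := hx2
      rw [if_pos hx2, min_eq_left hx2', hh, r_apply, LinearMap.sub_apply]
      change _ + (_ - (D.height i π x - D.height i π (D.eMinus i π)) • _) = _
      rw [hm']
      module
    · have hx2' : (D.ePlus i π : ℚ) ≤ x := (not_le.1 hx2).le
      rw [if_neg hx2, min_eq_right hx2', hh, hm]
      module

theorem IsGLSData.not_int (H : D.IsGLSData lam s L a) (hlast : L (s + 1) = lam) {j : ℕ}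
    (h1 : 1 ≤ j) (h2 : j ≤ s)
    (h : ¬ ∃ n : ℤ, lineFun s (fun j => L j (D.coroot i)) a (a j) = n) :
    (¬ ∃ n : ℤ, a j * L j (D.coroot i) = n) ∧ ¬ ∃ n : ℤ, a j * L (j + 1) (D.coroot i) = n := by
  obtain ⟨n, hn⟩ := H.exists_int hlast i h1 h2
  have h3 := (H.a_lt (j - 1) (by omega)).le
  rw [Nat.sub_add_cancel h1] at h3
  obtain ⟨l, hl⟩ := WeakChain.int_sub (H.weakChain hlast h1 h2) i
  have h4 : ¬ ∃ n : ℤ, a j * L j (D.coroot i) = n := by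
    rintro ⟨m, hm⟩
    exact h ⟨m + n, by rw [hn (a j) h3 le_rfl, hm]; push_cast; rfl⟩
  refine ⟨h4, ?_⟩
  rintro ⟨m, hm⟩
  exact h4 ⟨m - l, by push_cast; linarith⟩

/-- The breakpoints of `fᵢ π` other than the first are positive. -/
theorem IsGLSData.insertAt_pos (H : D.IsGLSData lam s L a) {p : ℕ} {x : ℚ} (hp : 1 ≤ p)
    (hps : p ≤ s) (hx : a (p - 1) < x) {j : ℕ} (h1 : 1 ≤ j) (h2 : j ≤ s + 1) :
    0 < insertAt a p x j := by
  rcases lt_trichotomy j p with h | h | h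
  · rw [insertAt_of_lt _ h]
    exact H.pos h1 (by omega)
  · rw [h, insertAt_self]
    refine lt_of_le_of_lt ?_ hx
    rw [← H.a_zero]
    exact le_of_le_of_step (fun j hj => (H.a_lt j hj).le) (p - 1).zero_le (by omega)
  · rw [insertAt_of_gt _ h]
    exact H.pos (by omega) (by omega)

theorem IsGLSData.f_of_real (hA : IsBorcherdsCartan A) (hlam : lam ∈ D.dominantWeights)
    (H : D.IsGLSData lam s L a) (hπ : π = linePath s L a)
    (hi : A i i = 2) (hf : D.f i π ≠ none) :
    ∃ t p : ℕ, t < p ∧ p ≤ s ∧ (D.fPlus i π : ℚ) = a t ∧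
      a (p - 1) < D.fMinus i π ∧ (D.fMinus i π : ℚ) ≤ a p ∧
      D.f i π = some (linePath (s + 1) (D.fWeights i L t p) (insertAt a p (D.fMinus i π))) ∧
      D.IsWeakData lam (s + 1) (D.fWeights i L t p) (insertAt a p (D.fMinus i π)) ∧
      linePath (s + 1) (D.fWeights i L t p) (insertAt a p (D.fMinus i π)) ∈ D.glsPaths lam := by
  wlog hlast : L (s + 1) = lam generalizing L
  · obtain ⟨L', hL', hlast, H', hπ'⟩ := H.exists_continuation
    obtain ⟨t, p, htp, hps, h1, h2, h3, h4, h5, h6⟩ := this H' (hπ.trans hπ') hlast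
    have hw := fWeights_congr (D := D) (i := i) hL' htp hps
    rw [linePath_congr _ hw] at h4 h6
    exact ⟨t, p, htp, hps, h1, h2, h3, h4, h5.congr hw, h6⟩
  have hf1 : D.fPlus i π < 1 := by
    by_contra hcon
    exact hf (if_neg hcon)
  have hh : ∀ t : UnitQ, D.height i π t = lineFun s (fun j => L j (D.coroot i)) a t := fun t => by
    rw [hπ, height_linePath]
  obtain ⟨t, p, htp, hps, hft, hval, -, h1, h2, hval', -, hpos, hnonpos, hint⟩ :=
    exists_fMinus (H.isIntegralLine hA hlam hlast i) hh hf1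
  have hle : ∀ j < s, a j ≤ a (j + 1) := fun j hj => (H.a_lt j hj).le
  have hx0 := H.insertAt_pos (by omega) hps h1 (show 1 ≤ p by omega) (by omega)
  rw [insertAt_self] at hx0
  have hW : D.IsWeakGLSData lam (s + 1) (D.fWeights i L t p)
      (insertAt a p (D.fMinus i π)) := by
    rw [fWeights_eq htp]
    refine ((H.isWeakGLSData hlast).dup (by omega) hps h1.le h2).reflectOn htp (by omega)
      (fun ht _ => ?_) (fun j hj1 hj2 => ?_) fun _ => ?_
    · rw [insertAt_of_lt _ htp, dup_of_le htp.le, dup_of_le (by omega)]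
      exact WeakChain.r_right hA hi (H.weakChain hlast ht (by omega)) (hnonpos ht)
        (hpos (t + 1) (by omega) (by omega))
    · rw [insertAt_of_lt _ hj2, dup_of_le hj2.le, dup_of_le (by omega)]
      exact WeakChain.r_r_of_pos hA hi (H.weakChain hlast (by omega) (by omega))
        (hpos (j + 1) (by omega) (by omega))
        (H.not_int hlast (by omega) (by omega) (hint j hj1 hj2)).2
    · rw [insertAt_self, dup_of_le le_rfl, dup_of_gt (Nat.lt_add_one p), Nat.add_sub_cancel]
      refine Relation.ReflTransGen.single (chainStep_r hA (H.mem_orbit p (by omega) hps)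
        (hpos p htp le_rfl) hx0 (fun _ => ?_) fun h => absurd hi h)
      obtain ⟨n, hn⟩ := H.exists_int hlast i (show 1 ≤ p by omega) hps
      rw [hn _ h1.le h2] at hval'
      exact ⟨D.minInt i π + 1 - n, by push_cast; linarith⟩
  refine ⟨t, p, htp, hps, hft, h1, h2, f_linePath hle hπ hf1 htp hps hft h1 h2 ?_ ?_,
    hW.isWeakData fun j hj1 hj2 hj0 => ?_, hW.linePath_mem⟩
  · rw [hh, hft, hval]
  · rw [hh, hval']
  · exact absurd hj0 (H.insertAt_pos (by omega) hps h1 hj1 hj2.le).ne'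

/-- For imaginary `i` the slopes of the height are weakly decreasing, and they are constant until
the height reaches `1`: if the slope drops from `c` to `c'` at `aⱼ` for the first time, then
`aⱼ (c - c')` is a positive integer, but at most the height `aⱼ c` at `aⱼ`. -/
theorem IsGLSData.slope_eq_of_imaginary (hA : IsBorcherdsCartan A) (hi : A i i ≠ 2)
    (hlam : lam ∈ D.dominantWeights) (H : D.IsGLSData lam s L a) (hlast : L (s + 1) = lam)
    {p : ℕ} (hps : p ≤ s)
    (hlt : ∀ j < p, lineFun s (fun j => L j (D.coroot i)) a (a j) < 1) {j : ℕ} (hj : 1 ≤ j)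
    (hjp : j ≤ p) : L j (D.coroot i) = L 1 (D.coroot i) ∧ ∀ t, a (j - 1) ≤ t → t ≤ a j →
      lineFun s (fun j => L j (D.coroot i)) a t = t * L j (D.coroot i) := by
  have hI := H.isIntegralLine hA hlam hlast i
  induction j, hj using Nat.le_induction with
  | base =>
    refine ⟨rfl, fun t h1 h2 => ?_⟩
    rw [hI.lineFun_eq le_rfl (by omega) h1 h2, Nat.sub_self, H.a_zero, hI.lineFun_zero]
    ring
  | succ j hj ih =>
    obtain ⟨h1, h2⟩ := ih (by omega)
    have h3 := (hI.a_pred_lt hj (by omega)).le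
    have h4 := hlt j (by omega)
    rw [h2 (a j) h3 le_rfl] at h4
    have hc := H.weakChain hlast hj (by omega)
    obtain ⟨n, hn⟩ := WeakChain.int_sub hc i
    have h5 := WeakChain.le_of_imaginary hA hi hc
    have h6 := H.imaginary_nonneg hA hi hlam hlast (j := j + 1) (by omega) (by omega)
    have h7 := H.pos hj (show j ≤ s by omega)
    have h8 := mul_nonneg h7.le h6
    have h9 := mul_le_mul_of_nonneg_left h5 h7.le
    have h10 : n = 0 := by
      have h11 : (n : ℚ) ≤ 0 := by linarith
      have h12 : (-1 : ℚ) < n := by linarith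
      have h13 : n ≤ 0 := by exact_mod_cast h11
      have h14 : -1 < n := by exact_mod_cast h12
      omega
    rw [h10, Int.cast_zero, add_zero] at hn
    have h15 := mul_left_cancel₀ h7.ne' hn
    refine ⟨h15.trans h1, fun t ht1 ht2 => ?_⟩
    rw [hI.lineFun_eq (by omega) (by omega) ht1 ht2, Nat.add_sub_cancel, h2 (a j) h3 le_rfl, h15]
    ring

theorem IsGLSData.f_of_imaginary (hA : IsBorcherdsCartan A) (hlam : lam ∈ D.dominantWeights)
    (H : D.IsGLSData lam s L a) (hπ : π = linePath s L a)
    (hi : A i i ≠ 2) (hf : D.f i π ≠ none) :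
    ∃ p : ℕ, 1 ≤ p ∧ p ≤ s ∧ D.fPlus i π = 0 ∧
      a (p - 1) < D.fMinus i π ∧ (D.fMinus i π : ℚ) ≤ a p ∧
      D.f i π = some (linePath (s + 1) (D.fWeights i L 0 p) (insertAt a p (D.fMinus i π))) ∧
      D.IsWeakData lam (s + 1) (D.fWeights i L 0 p) (insertAt a p (D.fMinus i π)) ∧
      (∀ j, 1 ≤ j → j ≤ p - 1 → L j (D.coroot i) = L (j + 1) (D.coroot i)) ∧
      linePath (s + 1) (D.fWeights i L 0 p) (insertAt a p (D.fMinus i π)) ∈ D.glsPaths lam := by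
  wlog hlast : L (s + 1) = lam generalizing L
  · obtain ⟨L', hL', hlast, H', hπ'⟩ := H.exists_continuation
    obtain ⟨p, hp, hps, h1, h2, h3, h4, h5, h6, h7⟩ := this H' (hπ.trans hπ') hlast
    have hw := fWeights_congr (D := D) (i := i) hL' (t := 0) hp hps
    rw [linePath_congr _ hw] at h4 h7
    refine ⟨p, hp, hps, h1, h2, h3, h4, h5.congr hw, fun j hj1 hj2 => ?_, h7⟩
    rw [← hL' j hj1 (by omega), ← hL' (j + 1) (by omega) (by omega)]
    exact h6 j hj1 hj2
  have hf1 : D.fPlus i π < 1 := by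
    by_contra hcon
    exact hf (if_neg hcon)
  have hh : ∀ t : UnitQ, D.height i π t = lineFun s (fun j => L j (D.coroot i)) a t := fun t => by
    rw [hπ, height_linePath]
  have hI := H.isIntegralLine hA hlam hlast i
  obtain ⟨t, p, htp, hps, hft, hval, -, h1, h2, hval', hbelow, hpos, hnonpos, -⟩ :=
    exists_fMinus hI hh hf1
  have hle : ∀ j < s, a j ≤ a (j + 1) := fun j hj => (H.a_lt j hj).le
  -- The slopes decrease weakly, so the height increases from the start.
  obtain rfl : t = 0 := by
    by_contra h0
    have h3 := WeakChain.le_of_imaginary hA hi (H.weakChain hlast (j := t) (by omega) (by omega))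
    have h4 := hnonpos (by omega)
    have h5 := hpos (t + 1) (by omega) (by omega)
    linarith
  rw [H.a_zero] at hft
  have hm : (D.minInt i π : ℚ) = 0 := by rw [← hval, H.a_zero, hI.lineFun_zero]
  have hx0 := H.insertAt_pos (by omega) hps h1 (show 1 ≤ p by omega) (by omega)
  rw [insertAt_self] at hx0
  have hslope := fun {j : ℕ} => H.slope_eq_of_imaginary (j := j) hA hi hlam hlast hps
    (fun j hj => by
      have h3 := hbelow (a j) (le_of_le_of_step hle j.zero_le (by omega))
        ((le_of_le_of_step hle (show j ≤ p - 1 by omega) (by omega)).trans_lt h1)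
      rwa [hm, zero_add] at h3)
  have hconst : ∀ j, 1 ≤ j → j ≤ p - 1 → L j (D.coroot i) = L (j + 1) (D.coroot i) :=
    fun j hj1 hj2 => (hslope hj1 (by omega)).1.trans (hslope (by omega) (by omega)).1.symm
  have hW : D.IsWeakGLSData lam (s + 1) (D.fWeights i L 0 p)
      (insertAt a p (D.fMinus i π)) := by
    rw [fWeights_eq htp]
    refine ((H.isWeakGLSData hlast).dup (by omega) hps h1.le h2).reflectOn htp (by omega)
      (fun ht _ => absurd ht (by omega)) (fun j hj1 hj2 => ?_) fun _ => ?_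
    · rw [insertAt_of_lt _ hj2, dup_of_le hj2.le, dup_of_le (by omega)]
      exact WeakChain.r_r_of_imaginary hA hi (H.weakChain hlast (by omega) (by omega))
        (hconst j hj1 (by omega))
    · rw [insertAt_self, dup_of_le le_rfl, dup_of_gt (Nat.lt_add_one p), Nat.add_sub_cancel]
      refine Relation.ReflTransGen.single (chainStep_r hA (H.mem_orbit p (by omega) hps)
        (hpos p htp le_rfl) hx0 (fun h => absurd h hi) fun _ => ?_)
      rw [(hslope (by omega) le_rfl).2 _ h1.le h2, hm, zero_add] at hval'
      exact hval'
  refine ⟨p, by omega, hps, Subtype.ext hft, h1, h2,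
    f_linePath hle hπ hf1 htp hps (by rw [hft, H.a_zero]) h1 h2 ?_ ?_,
    hW.isWeakData fun j hj1 hj2 hj0 => ?_, hconst, hW.linePath_mem⟩
  · rw [hh, hft, ← hval, H.a_zero]
  · rw [hh, hval']
  · exact absurd hj0 (H.insertAt_pos (by omega) hps h1 hj1 hj2.le).ne'

theorem IsGLSData.e_of_real (hA : IsBorcherdsCartan A) (hlam : lam ∈ D.dominantWeights)
    (H : D.IsGLSData lam s L a) (hπ : π = linePath s L a)
    (hi : A i i = 2) (he : D.e i π ≠ none) :
    0 < D.ePlus i π ∧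
    ∃ q k : ℕ, 1 ≤ q ∧ q ≤ k ∧ k ≤ s ∧ (D.ePlus i π : ℚ) = a k ∧
      a (q - 1) ≤ D.eMinus i π ∧ (D.eMinus i π : ℚ) < a q ∧
      D.e i π = some (linePath (s + 1) (D.eWeights i L q k) (insertAt a q (D.eMinus i π))) ∧
      D.IsWeakData lam (s + 1) (D.eWeights i L q k) (insertAt a q (D.eMinus i π)) ∧
      linePath (s + 1) (D.eWeights i L q k) (insertAt a q (D.eMinus i π)) ∈ D.glsPaths lam := by
  wlog hlast : L (s + 1) = lam generalizing L
  · obtain ⟨L', hL', hlast, H', hπ'⟩ := H.exists_continuation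
    obtain ⟨h0, q, k, hq, hqk, hks, h1, h2, h3, h4, h5, h6⟩ := this H' (hπ.trans hπ') hlast
    have hw := eWeights_congr (D := D) (i := i) hL' hq hqk hks
    rw [linePath_congr _ hw] at h4 h6
    exact ⟨h0, q, k, hq, hqk, hks, h1, h2, h3, h4, h5.congr hw, h6⟩
  have he1 : 0 < D.ePlus i π := by
    by_contra hcon
    exact he (if_neg hcon)
  have hh : ∀ t : UnitQ, D.height i π t = lineFun s (fun j => L j (D.coroot i)) a t := fun t => by
    rw [hπ, height_linePath]
  obtain ⟨q, k, hq, hqk, hks, hek, hval, -, h1, h2, hval', hneg, hnonneg, hint⟩ :=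
    exists_eMinus (H.isIntegralLine hA hlam hlast i) hh he1
  have hle : ∀ j < s, a j ≤ a (j + 1) := fun j hj => (H.a_lt j hj).le
  have hLq := H.mem_orbit q hq (by omega)
  have hcq : 0 < D.r i (L q) (D.coroot i) := by
    rw [D.r_apply_coroot_self hi]
    linarith [hneg q le_rfl hqk]
  have hW : D.IsWeakGLSData lam (s + 1) (D.eWeights i L q k)
      (insertAt a q (D.eMinus i π)) := by
    rw [eWeights_eq]
    refine ((H.isWeakGLSData hlast).dup hq (by omega) h1 h2.le).reflectOn (by omega) (by omega)
      (fun _ hx0 => ?_) (fun j hj1 hj2 => ?_) fun _ => ?_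
    · rw [insertAt_self] at hx0 ⊢
      rw [dup_of_le le_rfl, dup_of_gt (Nat.lt_add_one q), Nat.add_sub_cancel]
      have hstep := chainStep_r (a := D.eMinus i π) hA (r_mem_orbit hLq i) hcq hx0 (fun _ => ?_)
        fun h => absurd hi h
      · rw [D.r_r hi] at hstep
        exact Relation.ReflTransGen.single hstep
      · obtain ⟨n, hn⟩ := H.exists_int hlast i hq (hqk.trans hks)
        rw [hn _ h1 h2.le] at hval'
        rw [D.r_apply_coroot_self hi]
        exact ⟨n - (D.minInt i π + 1), by push_cast; linarith⟩
    · rw [insertAt_of_gt _ hj1, dup_of_gt hj1, dup_of_gt (by omega), Nat.add_sub_cancel]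
      obtain ⟨j, rfl⟩ : ∃ l, j = l + 1 := ⟨j - 1, by omega⟩
      rw [Nat.add_sub_cancel]
      exact WeakChain.r_r_of_neg hA hi (H.weakChain hlast (by omega) (by omega))
        (hneg j (by omega) (by omega))
        (H.not_int hlast (by omega) (by omega) (hint j (by omega) (by omega))).1
    · rw [insertAt_of_gt _ (by omega), dup_of_gt (by omega), dup_of_gt (by omega),
        Nat.add_sub_cancel, Nat.add_sub_cancel]
      refine WeakChain.r_left hA hi (H.weakChain hlast (by omega) hks) (hneg k hqk le_rfl) ?_
      rcases hks.eq_or_lt with rfl | hks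
      · obtain ⟨n, hn⟩ := hlam i
        rw [hlast, hn]
        exact n.cast_nonneg
      · exact hnonneg hks
  refine ⟨he1, q, k, hq, hqk, hks, hek, h1, h2,
    e_linePath hle hπ he1 hq hqk hks hek h1 h2 ?_ ?_,
    hW.isWeakData fun j hj1 hj2 hj0 => ?_, hW.linePath_mem⟩
  · rw [hh, hek, hval]
  · rw [hh, hval']
  · -- A breakpoint other than the first vanishes only if it is the new one, and the weights next to
    -- it are `L q` and `rᵢ (L q)`.
    rcases lt_trichotomy j q with h | rfl | h
    · rw [insertAt_of_lt _ h] at hj0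
      exact absurd hj0 (H.pos hj1 (by omega)).ne'
    · rw [eWeights_eq]
      simp only [reflectOn]
      rw [if_neg (by omega), if_pos (by omega), dup_of_le le_rfl, dup_of_gt (Nat.lt_add_one j),
        Nat.add_sub_cancel]
      have := gt_r (r_mem_orbit hLq i) hcq
      rwa [D.r_r hi] at this
    · rw [insertAt_of_gt _ h] at hj0
      exact absurd hj0 (H.pos (by omega) (by omega)).ne'

end Operators

end Realization

end GLS

theorem mainTheorem6 {I : Type*} [Countable I] {A : Matrix I I ℤ} (hA : GLS.IsBorcherdsCartan A)
    {𝔥 : Type*} [AddCommGroup 𝔥] [Module ℚ 𝔥] (D : GLS.Realization A 𝔥)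
    (lam : Module.Dual ℚ 𝔥) (hlam : lam ∈ D.dominantWeights) :
    -- for a path of shape `lam` the extremal values and parameters that define the operators exist
    (∀ π ∈ D.glsPaths lam, ∀ i : I,
      IsLeast {n : ℤ | ∃ t, D.height i π t = n} (D.minInt i π) ∧
      IsGreatest {t | D.height i π t = D.minInt i π} (D.fPlus i π) ∧
      (D.fPlus i π < 1 →
        IsLeast {t | D.fPlus i π ≤ t ∧ D.height i π t = D.minInt i π + 1} (D.fMinus i π)) ∧
      IsLeast {t | D.height i π t = D.minInt i π} (D.ePlus i π) ∧
      (0 < D.ePlus i π →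
        IsGreatest {t | t ≤ D.ePlus i π ∧ D.height i π t = D.minInt i π + 1} (D.eMinus i π))) ∧
    -- explicit formulas
    (∀ (s : ℕ) (L : ℕ → Module.Dual ℚ 𝔥) (a : ℕ → ℚ), D.IsGLSData lam s L a →
      ∀ π : GLS.RatPath 𝔥, π = GLS.linePath s L a →
      -- `fᵢ` for real `i`
      (∀ i, A i i = 2 → D.f i π ≠ none →
        ∃ t p : ℕ, t < p ∧ p ≤ s ∧ (D.fPlus i π : ℚ) = a t ∧
          a (p - 1) < D.fMinus i π ∧ (D.fMinus i π : ℚ) ≤ a p ∧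
          D.f i π = some (GLS.linePath (s + 1) (D.fWeights i L t p)
            (GLS.insertAt a p (D.fMinus i π))) ∧
          D.IsWeakData lam (s + 1) (D.fWeights i L t p) (GLS.insertAt a p (D.fMinus i π)) ∧
          GLS.linePath (s + 1) (D.fWeights i L t p) (GLS.insertAt a p (D.fMinus i π))
            ∈ D.glsPaths lam) ∧
      -- `fᵢ` for imaginary `i`
      (∀ i, A i i ≠ 2 → D.f i π ≠ none →
        ∃ p : ℕ, 1 ≤ p ∧ p ≤ s ∧ D.fPlus i π = 0 ∧
          a (p - 1) < D.fMinus i π ∧ (D.fMinus i π : ℚ) ≤ a p ∧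
          D.f i π = some (GLS.linePath (s + 1) (D.fWeights i L 0 p)
            (GLS.insertAt a p (D.fMinus i π))) ∧
          D.IsWeakData lam (s + 1) (D.fWeights i L 0 p) (GLS.insertAt a p (D.fMinus i π)) ∧
          (∀ j, 1 ≤ j → j ≤ p - 1 → L j (D.coroot i) = L (j + 1) (D.coroot i)) ∧
          GLS.linePath (s + 1) (D.fWeights i L 0 p) (GLS.insertAt a p (D.fMinus i π))
            ∈ D.glsPaths lam) ∧
      -- `eᵢ` for real `i`
      (∀ i, A i i = 2 → D.e i π ≠ none →
        0 < D.ePlus i π ∧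
        ∃ q k : ℕ, 1 ≤ q ∧ q ≤ k ∧ k ≤ s ∧ (D.ePlus i π : ℚ) = a k ∧
          a (q - 1) ≤ D.eMinus i π ∧ (D.eMinus i π : ℚ) < a q ∧
          D.e i π = some (GLS.linePath (s + 1) (D.eWeights i L q k)
            (GLS.insertAt a q (D.eMinus i π))) ∧
          D.IsWeakData lam (s + 1) (D.eWeights i L q k) (GLS.insertAt a q (D.eMinus i π)) ∧
          GLS.linePath (s + 1) (D.eWeights i L q k) (GLS.insertAt a q (D.eMinus i π))
            ∈ D.glsPaths lam)) ∧
    -- stability of the set of paths of shape `lam`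
    (∀ π ∈ D.glsPaths lam, ∀ (i : I) (π' : GLS.RatPath 𝔥),
      (D.f i π = some π' → π' ∈ D.glsPaths lam) ∧
      (A i i = 2 → D.e i π = some π' → π' ∈ D.glsPaths lam)) := by
  have hfr := fun (s : ℕ) (L : ℕ → Module.Dual ℚ 𝔥) (a : ℕ → ℚ) (H : D.IsGLSData lam s L a)
      (π : GLS.RatPath 𝔥) (hπ : π = GLS.linePath s L a) (i : I) (hi : A i i = 2)
      (hf : D.f i π ≠ none) => H.f_of_real hA hlam hπ hi hf
  have hfi := fun (s : ℕ) (L : ℕ → Module.Dual ℚ 𝔥) (a : ℕ → ℚ) (H : D.IsGLSData lam s L a)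
      (π : GLS.RatPath 𝔥) (hπ : π = GLS.linePath s L a) (i : I) (hi : A i i ≠ 2)
      (hf : D.f i π ≠ none) => H.f_of_imaginary hA hlam hπ hi hf
  have her := fun (s : ℕ) (L : ℕ → Module.Dual ℚ 𝔥) (a : ℕ → ℚ) (H : D.IsGLSData lam s L a)
      (π : GLS.RatPath 𝔥) (hπ : π = GLS.linePath s L a) (i : I) (hi : A i i = 2)
      (he : D.e i π ≠ none) => H.e_of_real hA hlam hπ hi he
  refine ⟨?_, fun s L a H π hπ => ⟨hfr s L a H π hπ, hfi s L a H π hπ, her s L a H π hπ⟩, ?_⟩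
  · rintro _ ⟨s, L, a, H, rfl⟩ i
    obtain ⟨L', -, hlast, H', hL⟩ := H.exists_continuation
    rw [hL]
    have hI := H'.isIntegralLine hA hlam hlast i
    have hh := fun t : GLS.UnitQ =>
      GLS.Realization.height_linePath (D := D) (s := s) (L := L') (a := a) (i := i) t
    obtain ⟨-, -, -, -, -, -, h1, h2, h3, -⟩ := GLS.Realization.exists_extremal hI hh
    refine ⟨h1, h2, fun hf => ?_, h3, fun he => ?_⟩
    · obtain ⟨-, -, -, -, -, -, h4, -⟩ := GLS.Realization.exists_fMinus hI hh hf
      exact h4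
    · obtain ⟨-, -, -, -, -, -, -, h4, -⟩ := GLS.Realization.exists_eMinus hI hh he
      exact h4
  · rintro π ⟨s, L, a, H, hπ⟩ i π'
    refine ⟨fun hf => ?_, fun hi he => ?_⟩
    · have hne : D.f i π ≠ none := by simp [hf]
      by_cases hi : A i i = 2
      · obtain ⟨t, p, -, -, -, -, -, h1, -, h2⟩ := hfr s L a H π hπ i hi hne
        rw [hf, Option.some_inj] at h1
        exact h1 ▸ h2
      · obtain ⟨p, -, -, -, -, -, h1, -, -, h2⟩ := hfi s L a H π hπ i hi hne
        rw [hf, Option.some_inj] at h1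
        exact h1 ▸ h2
    · have hne : D.e i π ≠ none := by simp [he]
      obtain ⟨-, q, k, -, -, -, -, -, -, h1, -, h2⟩ := her s L a H π hπ i hi hne
      rw [he, Option.some_inj] at h1
      exact h1 ▸ h2
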